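/- **Theorem.** Let $M$ be a smooth $6$-manifold with an $SU(3)$-structure: a smooth Riemannian metric $\langle\cdot,\cdot\rangle$, a smooth orthogonal almost complex structure $I$, and a smooth complex volume form $\Psi=\psi_++i\psi_-$ (a three-form, complex multilinear for $ix=Ix$, with $\langle\Psi,\Psi\rangle_{\mathbb C}=1$). Put $\omega(X,Y)=\langle X,IY\rangle$ and $Vol=\tfrac16\,\omega\wedge\omega\wedge\omega$, let $\ast$ be the Hodge star of $Vol$ and $\nabla$ the Levi-Civita connection. On forms, $\langle a,b\rangle=\frac1{p!}\sum a(e_{i_1},\dots,e_{i_p})\,b(e_{i_1},\dots,e_{i_p})$ for an orthonormal basis $(e_i)$, and $(Ib)(X_1,\dots,X_p)=(-1)^p b(IX_1,\dots,IX_p)$. Let $$r(\omega)(X,Y)=\tfrac12\langle \nabla_X\omega,\;Y\lrcorner\psi_+\rangle,\qquad d^*\omega=-\sum_i(\nabla_{e_i}\omega)(e_i,\cdot).$$ There is exactly one pair $(\eta,\xi)$ of a one-form $\eta$ and a tensor $\xi$ such that, with $\eta_XY=(I\eta)(X)\,IY$, the connection $\nabla+\eta+\xi$ is the minimal $SU(3)$-connection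 (that is, the metric, $\omega$, $\psi_+$ and $\psi_-$ are parallel for it, and $\eta_X+\xi_X\in\mathfrak{su}(3)^\perp\subset\mathfrak{so}(6)$ for all $X$) and $\xi_X\in\mathfrak u(3)^\perp$ for all $X$. Write $(d\psi_\pm)_\xi=d\psi_\pm+3\,\eta\wedge\psi_\pm$ and $(X\wedge Y)\lrcorner b=b(X,Y,\cdot,\cdot)$. Then, for all tangent vectors $X,Y$ and every orthonormal basis $e_1,\dots,e_6$ of the tangent space: 1. $\displaystyle \xi_XY=-\tfrac12\sum_{i,j} r(\omega)(X,e_i)\,\psi_+(e_i,e_j,Y)\,Ie_j;$ 2. $\displaystyle 2\,r(\omega)(X,Y)=\langle IX\lrcorner d\omega,\;Y\lrcorner\psi_-\rangle-\langle (X\wedge Y)\lrcorner(d\psi_+)_\xi,\;\omega\rangle+\langle (IX\wedge Y)\lrcorner(d\psi_-)_\xi,\;\omega\rangle;$ 3. $\displaystyle 6\eta+I\,d^*\omega=\ast(\ast d\psi_+\wedge\psi_+)=\ast(\ast d\psi_-\wedge\psi_-)=-I\ast(\ast d\psi_+\wedge\psi_-)=I\ast(\ast d\psi_-\wedge\psi_+)$,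 where $d^*\omega=-\ast(d\omega\wedge\omega)$. In particular the intrinsic $SU(3)$-torsion $\eta+\xi$ is computed by exterior algebra from $d\omega$, $d\psi_+$ and $d\psi_-$. -/

import Mathlib

open Bundle FiberBundle
open scoped Manifold ContDiff InnerProductSpace

noncomputable section

/-! ### Exterior algebra on a tangent space

A `k`-form on `V` is handled through its values, as a function of `k` vectors.  Vectors and
one-forms are identified by the metric, `x ↦ ⟨·, x⟩`. -/

section Algebra

variable {V : Type*}

/-- Exterior product, normalised so that `(a ∧ b)(x, y) = a x * b y - a y * b x` for one-forms. -/
def wedge {p q : ℕ} (a : (Fin p → V) → ℝ) (b : (Fin q → V) → ℝ) : (Fin (p + q) → V) → ℝ :=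
  fun v ↦ ((p.factorial : ℝ) * (q.factorial : ℝ))⁻¹ *
    ∑ σ : Equiv.Perm (Fin (p + q)), ((Equiv.Perm.sign σ : ℤ) : ℝ) *
      a (fun i ↦ v (σ (Fin.castAdd q i))) * b (fun j ↦ v (σ (Fin.natAdd p j)))

/-- Interior product `x ⌟ b = b(x, ·, …, ·)`.  Accordingly
`(x ∧ y) ⌟ b = b(x, y, ·, …, ·)` is `intProd y (intProd x b)`. -/
def intProd {k : ℕ} (x : V) (b : (Fin (k + 1) → V) → ℝ) : (Fin k → V) → ℝ :=
  fun v ↦ b (Fin.cons x v)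

/-- The action `(I b)(X₁, …, Xₖ) = (-1)ᵏ b(I X₁, …, I Xₖ)` on `k`-forms. -/
def formI {k : ℕ} (J : V → V) (b : (Fin k → V) → ℝ) : (Fin k → V) → ℝ :=
  fun v ↦ (-1 : ℝ) ^ k * b (fun i ↦ J (v i))

/-- The scalar product `⟨a, b⟩ = (1/k!) ∑ a(e_{i₁}, …, e_{iₖ}) b(e_{i₁}, …, e_{iₖ})` of `k`-forms,
with respect to an orthonormal basis `e`. -/
def formInner (e : Fin 6 → V) {k : ℕ} (a b : (Fin k → V) → ℝ) : ℝ :=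
  (k.factorial : ℝ)⁻¹ * ∑ f : Fin k → Fin 6, a (fun i ↦ e (f i)) * b (fun i ↦ e (f i))

/-- The Hodge star operator of the volume form `vol` (characterised on forms by
`a ∧ ⋆b = ⟨a, b⟩ vol`), computed in an orthonormal basis `e`:
`(⋆b)(v) = (1/k!) ∑ b(e_{i₁}, …, e_{iₖ}) vol(e_{i₁}, …, e_{iₖ}, v)`. -/
def hodgeStar (e : Fin 6 → V) (vol : (Fin 6 → V) → ℝ) {k l : ℕ} (h : k + l = 6)
    (b : (Fin k → V) → ℝ) : (Fin l → V) → ℝ :=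
  fun v ↦ (k.factorial : ℝ)⁻¹ * ∑ f : Fin k → Fin 6, b (fun i ↦ e (f i)) *
    vol (fun m ↦ Fin.append (fun i ↦ e (f i)) v (Fin.cast h.symm m))

end Algebra

/-! ### The Lie algebras `su(3) ⊆ u(3) ⊆ so(6)` and their orthogonal complements -/

section LieAlgebras

variable {V : Type*} [NormedAddCommGroup V] [InnerProductSpace ℝ V]

/-- Skew-symmetric endomorphisms. -/
def soAlg (V : Type*) [NormedAddCommGroup V] [InnerProductSpace ℝ V] : Set (V →ₗ[ℝ] V) :=
  {A | ∀ v w, ⟪A v, w⟫_ℝ = -⟪v, A w⟫_ℝ}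

/-- The Lie algebra of the stabiliser of the metric and of `J`. -/
def uAlg (J : V → V) : Set (V →ₗ[ℝ] V) :=
  {A | A ∈ soAlg V ∧ ∀ v, A (J v) = J (A v)}

/-- The Lie algebra of the stabiliser of the metric, of `J` and of `Ψ`. -/
def suAlg (J : V → V) (Ψ : (Fin 3 → V) → ℂ) : Set (V →ₗ[ℝ] V) :=
  {A | A ∈ uAlg J ∧ ∀ u v w, Ψ ![A u, v, w] + Ψ ![u, A v, w] + Ψ ![u, v, A w] = 0}

/-- The orthogonal complement in `so(V)` of a set of skew endomorphisms, for the scalar product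
`(A, B) ↦ -tr(AB)`. -/
def soPerp (g : Set (V →ₗ[ℝ] V)) : Set (V →ₗ[ℝ] V) :=
  {A | A ∈ soAlg V ∧ ∀ B ∈ g, LinearMap.trace ℝ V (A ∘ₗ B) = 0}

end LieAlgebras

/-! ### Six-manifolds, differential forms and their derivatives -/

/-- The model space of a six-manifold. -/
abbrev E6 : Type := EuclideanSpace ℝ (Fin 6)

/-- The tangent space at `x` of a six-manifold. -/
abbrev T6 {M : Type*} [TopologicalSpace M] [ChartedSpace E6 M] (x : M) : Type :=
  TangentSpace (𝓡 6) x

/-- A smooth Riemannian metric is continuously differentiable. -/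
instance {M : Type*} [TopologicalSpace M] [ChartedSpace E6 M] [IsManifold (𝓡 6) ∞ M]
    [RiemannianBundle (fun x : M ↦ T6 x)]
    [IsContMDiffRiemannianBundle (𝓡 6) ∞ E6 (fun x : M ↦ T6 x)] :
    IsContMDiffRiemannianBundle (𝓡 6) 1 E6 (fun x : M ↦ T6 x) :=
  IsContMDiffRiemannianBundle.of_le (n := ∞) (by simp)

section Forms

variable {M : Type*} [TopologicalSpace M] [ChartedSpace E6 M] [IsManifold (𝓡 6) ∞ M]

/-- The exterior derivative, through the invariant formula
`dα(V₀, …, V_{k+1}) = ∑ᵢ (-1)ⁱ Vᵢ(α(…, V̂ᵢ, …)) + ∑_{i<j} (-1)^{i+j} α([Vᵢ, Vⱼ], …, V̂ᵢ, …, V̂ⱼ, …)`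
for vector fields `Vᵢ`, smooth around `x`, that extend the given tangent vectors at `x`; in the
second sum the pair `i < j` is written `(i, j + 1)` with `i ≤ j`, whence the sign. -/
def extDer {k : ℕ} (α : Π x : M, (Fin (k + 1) → T6 x) → ℝ) (x : M) :
    (Fin (k + 2) → T6 x) → ℝ := fun v ↦
  let V : Fin (k + 2) → Π p : M, T6 p := fun i ↦ extend E6 (v i)
  (∑ i : Fin (k + 2), (-1 : ℝ) ^ (i : ℕ) *
      mvfderiv (𝓡 6) (fun p : M ↦ α p (i.removeNth (fun j ↦ V j p))) x (v i)) -
    ∑ i : Fin (k + 1), ∑ j ∈ Finset.Ici i, (-1 : ℝ) ^ ((i : ℕ) + (j : ℕ)) *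
      α x (Fin.cons (VectorField.mlieBracket (𝓡 6) (V i.castSucc) (V j.succ) x)
        (j.removeNth (i.castSucc.removeNth v)))

/-- The covariant derivative of a `k`-form,
`(∇_X α)(V₁, …, Vₖ) = X(α(V₁, …, Vₖ)) - ∑ᵢ α(V₁, …, ∇_X Vᵢ, …, Vₖ)`
for vector fields `Vᵢ`, smooth around `x`, that extend the given tangent vectors at `x`. -/
def covDer (nabla : CovariantDerivative (𝓡 6) E6 (fun x : M ↦ T6 x)) {k : ℕ}
    (α : Π x : M, (Fin k → T6 x) → ℝ) (x : M) (X : T6 x) : (Fin k → T6 x) → ℝ := fun v ↦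
  mvfderiv (𝓡 6) (fun p : M ↦ α p (fun i ↦ extend E6 (v i) p)) x X -
    ∑ i, α x (Function.update v i (nabla (extend E6 (v i)) x X))

end Forms

/-! ### Special almost Hermitian six-manifolds -/

section SU3

variable {M : Type*} [TopologicalSpace M] [ChartedSpace E6 M] [IsManifold (𝓡 6) ∞ M]
  [RiemannianBundle (fun x : M ↦ T6 x)]

/-- An `SU(3)`-structure on a Riemannian six-manifold `M`: a smooth orthogonal almost complex
structure `J` and a smooth complex volume form `Ψ`, i.e. a three-form which is complex multilinear
for `i x = J x` and satisfies `⟨Ψ, Ψ⟩_ℂ = 1`. -/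
structure SU3Structure (M : Type*) [TopologicalSpace M] [ChartedSpace E6 M]
    [IsManifold (𝓡 6) ∞ M] [RiemannianBundle (fun x : M ↦ T6 x)] where
  /-- the almost complex structure -/
  J : Π x : M, T6 x →L[ℝ] T6 x
  /-- the complex volume form -/
  Ψ : Π x : M, T6 x [⋀^Fin 3]→L[ℝ] ℂ
  J_smooth : ContMDiff (𝓡 6) ((𝓡 6).prod 𝓘(ℝ, E6 →L[ℝ] E6)) ∞
    (fun x : M ↦ TotalSpace.mk' (E6 →L[ℝ] E6) (E := fun x : M ↦ T6 x →L[ℝ] T6 x) x (J x))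
  J_sq : ∀ (x : M) (v : T6 x), J x (J x v) = -v
  J_orthogonal : ∀ (x : M) (v w : T6 x), ⟪J x v, J x w⟫_ℝ = ⟪v, w⟫_ℝ
  /-- `Ψ` takes smooth vector fields (around a point) to smooth functions (around that point) -/
  Ψ_smooth : ∀ (V : Fin 3 → Π x : M, T6 x) (x : M),
    (∀ i, ContMDiffAt (𝓡 6) (𝓡 6).tangent ∞
      (fun p : M ↦ (TotalSpace.mk' E6 p (V i p) : TangentBundle (𝓡 6) M)) x) →
    ContMDiffAt (𝓡 6) 𝓘(ℝ, ℂ) ∞ (fun p : M ↦ Ψ p (fun i ↦ V i p)) x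
  Ψ_complex : ∀ (x : M) (u v w : T6 x), Ψ x ![J x u, v, w] = Complex.I * Ψ x ![u, v, w]
  Ψ_norm : ∀ (x : M) (u : Fin 3 → T6 x),
    (∀ i j, ⟪u i, u j⟫_ℝ = if i = j then 1 else 0) → (∀ i j, ⟪u i, J x (u j)⟫_ℝ = 0) →
    (1 / 6 : ℂ) * ∑ i, ∑ j, ∑ k,
      Ψ x ![u i, u j, u k] * (starRingEnd ℂ) (Ψ x ![u i, u j, u k]) = 1

namespace SU3Structure

variable (S : SU3Structure M)

/-- The Kähler form `ω(x, y) = ⟨x, I y⟩`. -/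
def kahler (x : M) : (Fin 2 → T6 x) → ℝ := fun v ↦ ⟪v 0, S.J x (v 1)⟫_ℝ

/-- The real part `ψ₊` of the complex volume form. -/
def ψp (x : M) : (Fin 3 → T6 x) → ℝ := fun v ↦ (S.Ψ x v).re

/-- The imaginary part `ψ₋` of the complex volume form. -/
def ψm (x : M) : (Fin 3 → T6 x) → ℝ := fun v ↦ (S.Ψ x v).im

/-- The real volume form, `6 Vol = ω ∧ ω ∧ ω`. -/
def vol (x : M) : (Fin 6 → T6 x) → ℝ :=
  fun v ↦ (1 / 6 : ℝ) * wedge (wedge (S.kahler x) (S.kahler x)) (S.kahler x) v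

/-- The endomorphism `η_X Y = (I η)(X) I Y` determined by a one-form `η`,
where `(I η)(X) = - η(I X)`. -/
def etaTensor (η : Π x : M, T6 x →L[ℝ] ℝ) (x : M) : T6 x →L[ℝ] T6 x →L[ℝ] T6 x :=
  (-((η x).comp (S.J x))).smulRight (S.J x)

/-- The bilinear form `r(ω)(X, Y) = ½ ⟨X ⌟ ∇ω, Y ⌟ ψ₊⟩`, where `X ⌟ ∇ω = ∇_X ω`. -/
def r (nabla : CovariantDerivative (𝓡 6) E6 (fun x : M ↦ T6 x)) (x : M) (e : Fin 6 → T6 x)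
    (X Y : T6 x) : ℝ :=
  (1 / 2 : ℝ) * formInner e (covDer nabla S.kahler x X) (intProd Y (S.ψp x))

/-- The coderivative `d^*ω = - ∑ᵢ (∇_{eᵢ} ω)(eᵢ, ·)`. -/
def codiff (nabla : CovariantDerivative (𝓡 6) E6 (fun x : M ↦ T6 x)) (x : M)
    (e : Fin 6 → T6 x) : (Fin 1 → T6 x) → ℝ :=
  fun v ↦ -∑ i, covDer nabla S.kahler x (e i) ![e i, v 0]

/-- A one-form, as a function of one vector. -/
def oneForm (η : Π x : M, T6 x →L[ℝ] ℝ) (x : M) : (Fin 1 → T6 x) → ℝ := fun v ↦ η x (v 0)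

/-- `(dψ)_ξ = dψ + 3 η ∧ ψ`. -/
def dXi (η : Π x : M, T6 x →L[ℝ] ℝ) (ψ : Π x : M, (Fin 3 → T6 x) → ℝ) (x : M) :
    (Fin 4 → T6 x) → ℝ :=
  fun v ↦ extDer ψ x v + 3 * wedge (oneForm η x) (ψ x) v

/-- The one-form `⋆(⋆dψ ∧ φ)`, for three-forms `ψ` and `φ`. -/
def starStar (x : M) (e : Fin 6 → T6 x) (ψ φ : Π x : M, (Fin 3 → T6 x) → ℝ) :
    (Fin 1 → T6 x) → ℝ :=
  hodgeStar e (S.vol x) (k := 5) (l := 1) rfl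
    (wedge (hodgeStar e (S.vol x) (k := 4) (l := 2) rfl (extDer ψ x)) (φ x))

variable [IsContMDiffRiemannianBundle (𝓡 6) ∞ E6 (fun x : M ↦ T6 x)]

/-- An `SU(3)`-connection: the metric, `ω`, `ψ₊` and `ψ₋` are parallel. -/
structure IsSU3Connection (D : CovariantDerivative (𝓡 6) E6 (fun x : M ↦ T6 x)) : Prop where
  metric : D.IsMetricCompatible
  omega : ∀ (x : M) (X : T6 x) (v : Fin 2 → T6 x), covDer D S.kahler x X v = 0
  psi_plus : ∀ (x : M) (X : T6 x) (v : Fin 3 → T6 x), covDer D S.ψp x X v = 0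
  psi_minus : ∀ (x : M) (X : T6 x) (v : Fin 3 → T6 x), covDer D S.ψm x X v = 0

/-- `η + ξ` is the intrinsic `SU(3)`-torsion relative to the Levi-Civita connection `nabla`:
`nabla + η + ξ` is the minimal `SU(3)`-connection, i.e. an `SU(3)`-connection for which
`η_X + ξ_X ∈ su(3)^⊥` for all `X`, and `ξ` is the `u(3)^⊥`-component in the
decomposition `su(3)^⊥ = ℝ I + u(3)^⊥`, `η` being the component along `I`. -/
structure IsIntrinsicTorsion (nabla : CovariantDerivative (𝓡 6) E6 (fun x : M ↦ T6 x))
    (η : Π x : M, T6 x →L[ℝ] ℝ) (ξ : Π x : M, T6 x →L[ℝ] T6 x →L[ℝ] T6 x) : Prop where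
  connection : S.IsSU3Connection
    (nabla.addOneForm fun x ↦ (S.etaTensor η x + ξ x).flip)
  minimal : ∀ (x : M) (X : T6 x),
    ((S.etaTensor η x X + ξ x X : T6 x →L[ℝ] T6 x) : T6 x →ₗ[ℝ] T6 x) ∈
      soPerp (suAlg (S.J x) (S.Ψ x))
  u_perp : ∀ (x : M) (X : T6 x),
    ((ξ x X : T6 x →L[ℝ] T6 x) : T6 x →ₗ[ℝ] T6 x) ∈ soPerp (uAlg (S.J x))

end SU3Structure

end SU3

end

/-! Since ∇ + η + ξ makes ω, ψ₊ and ψ₋ parallel, ∇_X α for each of these forms is the derivation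
action of η_X + ξ_X on α (`covDer_addOneForm`). Every derivative thus becomes linear algebra on one
tangent space, with an endomorphism N·J + ξ_X, where N = −η(JX) and ξ_X is skew and anticommutes
with J.

Such ξ_X form a six-dimensional space spanned by the contractions y ↦ ∑ ψ₊(e_p, e_l, y) J e_l, so
ξ_X is encoded by a vector ρ(X) (`exists_coeff_of_antiHermitian`). In these terms ∇_X ω = ρ ⌟ ψ₊,
∇_X ψ₊ = −ρ ∧ ω − 3N ψ₋ and ∇_X ψ₋ = (ρ∘J) ∧ ω + 3N ψ₊. The relation ⟨p ⌟ ψ₊, q ⌟ ψ₊⟩ = 2⟨p, q⟩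
gives r(ω)(X, ·) = ρ(X), which is item 1. As ∇ is torsion-free, d is the antisymmetrisation of ∇
(`extDer_eq_sum_covDer`), so dω and dψ± are linear in ρ and η. Items 2 and 3 are then linear
identities, checked in an adapted basis u₀, u₁, u₂, Ju₀, Ju₁, Ju₂ with Ψ(u₀, u₁, u₂) = 1 and carried
to all vectors and all orthonormal bases by multilinearity. The double stars are removed by ⋆(⋆a ∧
φ) = −⟨· ⌟ a, φ⟩ (`hodgeStar_wedge_hodgeStar`).

Uniqueness: the skew endomorphisms killing ω, ψ₊ and ψ₋ form su(3), and −tr(AB) is definite, so an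
element of su(3)^⊥ is determined by its action on the three forms
(`IsComplexVolume.eq_of_derAlt_eq`).

Existence: put ξ_X = −½ J(∇_X J). Then ∇_X Ψ − ξ_X·Ψ is complex trilinear and alternating, hence a
multiple of Ψ. The multiple is purely imaginary because Ψ has constant length (`covΨ_re_eq_zero`),
and its imaginary part, divided by 3, defines N and with it η. -/

section OrthonormalInvariance

/-! ### Independence of full contractions from the orthonormal basis. -/

variable {V : Type*} [NormedAddCommGroup V] [InnerProductSpace ℝ V]
  {ι : Type*} [Fintype ι]

theorem MultilinearMap.apply_orthonormalBasis_comp {k : ℕ} [DecidableEq ι]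
    (e b : OrthonormalBasis ι ℝ V)
    (S : MultilinearMap ℝ (fun _ : Fin k ↦ V) ℝ) (f : Fin k → ι) :
    S (fun i ↦ e (f i)) = ∑ g : Fin k → ι, (∏ i, ⟪b (g i), e (f i)⟫_ℝ) * S (fun i ↦ b (g i)) := by
  have h : (fun i ↦ e (f i)) = fun i ↦ ∑ j, ⟪b j, e (f i)⟫_ℝ • b j := by
    funext i
    exact (b.sum_repr' (e (f i))).symm
  rw [h, MultilinearMap.map_sum]
  refine Finset.sum_congr rfl fun g _ ↦ ?_
  rw [MultilinearMap.map_smul_univ, smul_eq_mul]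

/-- Full contractions of multilinear maps do not depend on the orthonormal basis. -/
theorem MultilinearMap.sum_orthonormalBasis_eq {k : ℕ} [DecidableEq ι]
    (e b : OrthonormalBasis ι ℝ V)
    (S T : MultilinearMap ℝ (fun _ : Fin k ↦ V) ℝ) :
    ∑ f : Fin k → ι, S (fun i ↦ e (f i)) * T (fun i ↦ e (f i)) =
      ∑ f : Fin k → ι, S (fun i ↦ b (f i)) * T (fun i ↦ b (f i)) := by
  -- The transition matrix between orthonormal bases is orthogonal, and so is its k-fold tensor
  -- power: the sum over tuples factors into one sum per slot.
  have key : ∀ g h : Fin k → ι,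
      ∑ f : Fin k → ι, (∏ i, ⟪b (g i), e (f i)⟫_ℝ) * (∏ i, ⟪b (h i), e (f i)⟫_ℝ) =
        if g = h then 1 else 0 := by
    intro g h
    simp_rw [← Finset.prod_mul_distrib]
    have := (Finset.prod_univ_sum (fun _ : Fin k ↦ (Finset.univ : Finset ι))
      (fun i j ↦ ⟪b (g i), e j⟫_ℝ * ⟪b (h i), e j⟫_ℝ)).symm
    rw [Fintype.piFinset_univ] at this
    rw [this]
    have h2 : ∀ i, ∑ j, ⟪b (g i), e j⟫_ℝ * ⟪b (h i), e j⟫_ℝ = if g i = h i then 1 else 0 := by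
      intro i
      have h3 := e.sum_inner_mul_inner (b (g i)) (b (h i))
      simp_rw [real_inner_comm (b (h i))] at h3
      rw [h3, real_inner_comm]
      exact b.inner_eq_ite _ _
    simp_rw [h2]
    by_cases hgh : g = h
    · simp [hgh]
    · rw [if_neg hgh]
      obtain ⟨i, hi⟩ := Function.ne_iff.mp hgh
      exact Finset.prod_eq_zero (Finset.mem_univ i) (by simp [hi])
  simp_rw [MultilinearMap.apply_orthonormalBasis_comp e b, Finset.sum_mul_sum]
  rw [Finset.sum_comm]
  refine Finset.sum_congr rfl fun g _ ↦ ?_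
  rw [Finset.sum_comm]
  calc _ = ∑ h : Fin k → ι, (∑ f : Fin k → ι,
        (∏ i, ⟪b (g i), e (f i)⟫_ℝ) * (∏ i, ⟪b (h i), e (f i)⟫_ℝ)) *
          (S (fun i ↦ b (g i)) * T (fun i ↦ b (h i))) := by
        refine Finset.sum_congr rfl fun h _ ↦ ?_
        rw [Finset.sum_mul]
        exact Finset.sum_congr rfl fun f _ ↦ by ring
    _ = _ := by simp [key]

end OrthonormalInvariance

/-! ### Exterior products as alternating maps. -/

section Wedge

variable {V : Type*} [AddCommGroup V] [Module ℝ V]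

/-- The exterior product of alternating maps, as an alternating map. -/
noncomputable def wedgeAlt {p q : ℕ} (a : V [⋀^Fin p]→ₗ[ℝ] ℝ) (b : V [⋀^Fin q]→ₗ[ℝ] ℝ) :
    V [⋀^Fin (p + q)]→ₗ[ℝ] ℝ :=
  ((p.factorial : ℝ) * (q.factorial : ℝ))⁻¹ • MultilinearMap.alternatization
    (((LinearMap.mul' ℝ ℝ).compMultilinearMap
      (a.toMultilinearMap.domCoprod b.toMultilinearMap)).domDomCongr finSumFinEquiv)

theorem coe_wedgeAlt {p q : ℕ} (a : V [⋀^Fin p]→ₗ[ℝ] ℝ) (b : V [⋀^Fin q]→ₗ[ℝ] ℝ) :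
    ⇑(wedgeAlt a b) = wedge ⇑a ⇑b := by
  funext v
  simp only [wedgeAlt, wedge, AlternatingMap.smul_apply, MultilinearMap.alternatization_apply,
    smul_eq_mul]
  congr 1
  refine Finset.sum_congr rfl fun σ _ ↦ ?_
  simp [MultilinearMap.domDomCongr_apply, MultilinearMap.domCoprod_apply, Units.smul_def, mul_assoc]

theorem alternatingMap_comp_perm {n : ℕ} (α : V [⋀^Fin n]→ₗ[ℝ] ℝ) (v : Fin n → V)
    (σ : Equiv.Perm (Fin n)) :
    α (fun i ↦ v (σ i)) = ((Equiv.Perm.sign σ : ℤ) : ℝ) * α v := by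
  have := α.map_perm v σ
  simpa [Function.comp_def, Units.smul_def] using this

/-- A form of degree `k + l` with its last `l` arguments fixed, as a multilinear map. -/
noncomputable def fixLast {k l n : ℕ} (h : k + l = n) (α : V [⋀^Fin n]→ₗ[ℝ] ℝ) (v : Fin l → V) :
    MultilinearMap ℝ (fun _ : Fin k ↦ V) ℝ :=
  MultilinearMap.currySum (ι := Fin l) (ι' := Fin k) (N := fun _ ↦ V)
    (α.toMultilinearMap.domDomCongr
      ((finCongr h.symm).trans (finSumFinEquiv.symm.trans (Equiv.sumComm _ _)))) v

theorem fixLast_apply {k l n : ℕ} (h : k + l = n) (α : V [⋀^Fin n]→ₗ[ℝ] ℝ) (v : Fin l → V)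
    (u : Fin k → V) :
    fixLast h α v u = α (fun m ↦ Fin.append u v (Fin.cast h.symm m)) := by
  subst h
  simp only [fixLast, MultilinearMap.currySum_apply, MultilinearMap.domDomCongr_apply]
  change α _ = α _
  congr 1
  funext m
  refine Fin.addCases (fun i ↦ ?_) (fun i ↦ ?_) m <;> simp

end Wedge

/-! ### Basis independence of the Hodge star and of the scalar product of forms. -/

section HodgeInvariance

variable {V : Type*} [NormedAddCommGroup V] [InnerProductSpace ℝ V]

/-- With `vol` held fixed, the star is a full contraction of `β` with `fixLast`, so the orientation
of the basis plays no role. -/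
theorem hodgeStar_orthonormalBasis_eq (e b : OrthonormalBasis (Fin 6) ℝ V)
    (vol : V [⋀^Fin 6]→ₗ[ℝ] ℝ) {k l : ℕ} (h : k + l = 6)
    (β : MultilinearMap ℝ (fun _ : Fin k ↦ V) ℝ) :
    hodgeStar e vol h β = hodgeStar b vol h β := by
  funext v
  simp only [hodgeStar, ← fixLast_apply h vol v]
  rw [MultilinearMap.sum_orthonormalBasis_eq e b]

theorem formInner_orthonormalBasis_eq (e b : OrthonormalBasis (Fin 6) ℝ V) {k : ℕ}
    (α β : MultilinearMap ℝ (fun _ : Fin k ↦ V) ℝ) :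
    formInner e α β = formInner b α β := by
  simp only [formInner]
  rw [MultilinearMap.sum_orthonormalBasis_eq e b]

end HodgeInvariance

/-! ### Sums over index tuples and the star of an exterior product. -/

section Contraction

/-- A sum over `k`-tuples of a function which is invariant under permutations and vanishes on tuples
that do not enumerate the range of a fixed injective tuple `g₀`. -/
theorem sum_tuple_eq_factorial_mul {k : ℕ} {ι : Type*} [Fintype ι] [DecidableEq ι]
    (F : (Fin k → ι) → ℝ)
    (g₀ : Fin k → ι) (hg₀ : Function.Injective g₀)
    (hperm : ∀ σ : Equiv.Perm (Fin k), F (g₀ ∘ σ) = F g₀)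
    (hzero : ∀ g, (¬ ∃ σ : Equiv.Perm (Fin k), g = g₀ ∘ σ) → F g = 0) :
    ∑ g, F g = (k.factorial : ℝ) * F g₀ := by
  classical
  have hinj : Function.Injective fun σ : Equiv.Perm (Fin k) ↦ g₀ ∘ σ := by
    intro σ τ h
    ext i
    exact congrArg Fin.val (hg₀ (congrFun h i))
  have : ∑ g ∈ Finset.univ.image (fun σ : Equiv.Perm (Fin k) ↦ g₀ ∘ σ), F g = ∑ g, F g := by
    refine Finset.sum_subset (Finset.subset_univ _) fun g _ hg ↦ hzero g ?_
    rintro ⟨σ, rfl⟩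
    exact hg (Finset.mem_image_of_mem _ (Finset.mem_univ σ))
  rw [← this, Finset.sum_image fun _ _ _ _ h ↦ hinj h]
  simp [hperm, Fintype.card_perm]

theorem exists_perm_of_injective {k : ℕ} {ι : Type*} {g g₀ : Fin k → ι}
    (hg : Function.Injective g) (h : ∀ i, g i ∈ Set.range g₀) :
    ∃ σ : Equiv.Perm (Fin k), g = g₀ ∘ σ := by
  choose s hs using h
  have hsi : Function.Injective s := fun i j hij ↦ hg (by rw [← hs i, ← hs j, hij])
  refine ⟨Equiv.ofBijective s (Finite.injective_iff_bijective.mp hsi), ?_⟩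
  funext i
  exact (hs i).symm

variable {V : Type*} [AddCommGroup V] [Module ℝ V]

theorem alternatingMap_append_perm {k l n : ℕ} (h : k + l = n) (α : V [⋀^Fin n]→ₗ[ℝ] ℝ)
    (u : Fin k → V) (v : Fin l → V) (σ : Equiv.Perm (Fin k)) :
    α (fun m ↦ Fin.append (fun i ↦ u (σ i)) v (Fin.cast h.symm m)) =
      ((Equiv.Perm.sign σ : ℤ) : ℝ) * α (fun m ↦ Fin.append u v (Fin.cast h.symm m)) := by
  subst h
  let τ : Equiv.Perm (Fin (k + l)) :=
    finSumFinEquiv.permCongr (Equiv.Perm.sumCongr σ (1 : Equiv.Perm (Fin l)))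
  have hτ : Equiv.Perm.sign τ = Equiv.Perm.sign σ := by
    simp [τ, Equiv.Perm.sign_permCongr, Equiv.Perm.sign_sumCongr]
  rw [← hτ, ← alternatingMap_comp_perm]
  congr 1
  funext m
  refine Fin.addCases (fun i ↦ ?_) (fun i ↦ ?_) m <;> simp [τ, Equiv.permCongr_apply]

/-- The Hodge star of an exterior product, with the antisymmetrisation absorbed. -/
theorem hodgeStar_wedge (e : Fin 6 → V) (vol : V [⋀^Fin 6]→ₗ[ℝ] ℝ) {p q l : ℕ}
    (h : p + q + l = 6) (β : (Fin p → V) → ℝ) (φ : (Fin q → V) → ℝ) (v : Fin l → V) :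
    hodgeStar e vol h (wedge β φ) v = ((p.factorial : ℝ) * (q.factorial : ℝ))⁻¹ *
      ∑ f : Fin (p + q) → Fin 6, β (fun i ↦ e (f (Fin.castAdd q i))) *
        φ (fun j ↦ e (f (Fin.natAdd p j))) *
        vol (fun m ↦ Fin.append (fun i ↦ e (f i)) v (Fin.cast h.symm m)) := by
  simp only [hodgeStar, wedge]
  simp_rw [Finset.mul_sum, Finset.sum_mul, Finset.mul_sum]
  rw [Finset.sum_comm]
  have key : ∀ σ : Equiv.Perm (Fin (p + q)), ∀ f : Fin (p + q) → Fin 6,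
      vol (fun m ↦ Fin.append (fun i ↦ e (f (σ i))) v (Fin.cast h.symm m)) =
        ((Equiv.Perm.sign σ : ℤ) : ℝ) *
          vol (fun m ↦ Fin.append (fun i ↦ e (f i)) v (Fin.cast h.symm m)) := by
    intro σ f
    exact alternatingMap_append_perm h vol (fun i ↦ e (f i)) v σ
  have hs : ∀ σ : Equiv.Perm (Fin (p + q)),
      ((Equiv.Perm.sign σ : ℤ) : ℝ) * ((Equiv.Perm.sign σ : ℤ) : ℝ) = 1 := by
    intro σ
    rcases Int.units_eq_one_or (Equiv.Perm.sign σ) with h | h <;> simp [h]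
  -- Reindexing the tuples by `σ` moves the permutation into `vol`, whose sign cancels the sign in
  -- the wedge. All (p + q)! terms become equal and cancel the factor of the star.
  have h2 : ∀ σ : Equiv.Perm (Fin (p + q)),
      ∑ f : Fin (p + q) → Fin 6, (((p + q).factorial : ℝ))⁻¹ *
        (((p.factorial : ℝ) * (q.factorial : ℝ))⁻¹ * (((Equiv.Perm.sign σ : ℤ) : ℝ) *
          β (fun i ↦ e (f (σ (Fin.castAdd q i)))) * φ (fun j ↦ e (f (σ (Fin.natAdd p j))))) *
        vol (fun m ↦ Fin.append (fun i ↦ e (f i)) v (Fin.cast h.symm m))) =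
      (((p + q).factorial : ℝ))⁻¹ * ∑ f : Fin (p + q) → Fin 6,
        ((p.factorial : ℝ) * (q.factorial : ℝ))⁻¹ * (β (fun i ↦ e (f (Fin.castAdd q i))) *
        φ (fun j ↦ e (f (Fin.natAdd p j))) *
        vol (fun m ↦ Fin.append (fun i ↦ e (f i)) v (Fin.cast h.symm m))) := by
    intro σ
    rw [Finset.mul_sum]
    refine Fintype.sum_equiv (σ.arrowCongr (Equiv.refl _)).symm _ _ fun f ↦ ?_
    have hk := key σ f
    simp only [Equiv.arrowCongr_symm, Equiv.arrowCongr_apply, Equiv.symm_symm, Equiv.refl_symm,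
      Equiv.coe_refl, Function.comp_apply, id] at *
    rw [hk]
    ring
  rw [Finset.sum_congr rfl fun σ _ ↦ h2 σ]
  simp [Fintype.card_perm, Nat.factorial_ne_zero]

end Contraction

/-! ### The double Hodge star on four-forms. -/

section DoubleStar

variable {V : Type*} [AddCommGroup V] [Module ℝ V]

theorem sign_mul_sign_real {α : Type*} [Fintype α] [DecidableEq α] (σ : Equiv.Perm α) :
    ((Equiv.Perm.sign σ : ℤ) : ℝ) * ((Equiv.Perm.sign σ : ℤ) : ℝ) = 1 := by
  rcases Int.units_eq_one_or (Equiv.Perm.sign σ) with h | h <;> simp [h]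

theorem mul_mul_mul_sign (s x y : ℝ) (h : s * s = 1) : s * x * (s * y) = x * y := by
  linear_combination x * y * h

theorem alternatingMap_sum_apply {n : ℕ} {ι : Type*} (s : Finset ι)
    (L : ι → V [⋀^Fin n]→ₗ[ℝ] ℝ) (v : Fin n → V) : (∑ i ∈ s, L i) v = ∑ i ∈ s, L i v := by
  classical
  induction s using Finset.induction_on with
  | empty => simp
  | insert a s ha ih => rw [Finset.sum_insert ha, Finset.sum_insert ha, AlternatingMap.add_apply, ih]

theorem alternatingMap_append_perm_right {k l n : ℕ} (h : k + l = n) (α : V [⋀^Fin n]→ₗ[ℝ] ℝ)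
    (u : Fin k → V) (v : Fin l → V) (σ : Equiv.Perm (Fin l)) :
    α (fun m ↦ Fin.append u (fun i ↦ v (σ i)) (Fin.cast h.symm m)) =
      ((Equiv.Perm.sign σ : ℤ) : ℝ) * α (fun m ↦ Fin.append u v (Fin.cast h.symm m)) := by
  subst h
  let τ : Equiv.Perm (Fin (k + l)) :=
    finSumFinEquiv.permCongr (Equiv.Perm.sumCongr (1 : Equiv.Perm (Fin k)) σ)
  have hτ : Equiv.Perm.sign τ = Equiv.Perm.sign σ := by
    simp [τ, Equiv.Perm.sign_permCongr, Equiv.Perm.sign_sumCongr]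
  rw [← hτ, ← alternatingMap_comp_perm]
  congr 1
  funext m
  refine Fin.addCases (fun i ↦ ?_) (fun i ↦ ?_) m <;> simp [τ, Equiv.permCongr_apply]

theorem alternatingMap_append_eq_zero {k l n : ℕ} (h : k + l = n) (α : V [⋀^Fin n]→ₗ[ℝ] ℝ)
    {ι : Type*} (e : ι → V) (f : Fin k → ι) (g : Fin l → ι)
    (hfg : ¬ (Function.Injective f ∧ ∀ i, f i ∉ Set.range g)) :
    α (fun m ↦ Fin.append (fun i ↦ e (f i)) (fun i ↦ e (g i)) (Fin.cast h.symm m)) = 0 := by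
  subst h
  refine α.map_eq_zero_of_not_injective _ fun hinj ↦ hfg ⟨fun i j hij ↦ ?_, ?_⟩
  · have := @hinj (Fin.castAdd l i) (Fin.castAdd l j) (by simp [hij])
    simpa using this
  · rintro i ⟨j, hj⟩
    have := @hinj (Fin.castAdd l i) (Fin.natAdd k j) (by simp [hj])
    simp [Fin.ext_iff] at this
    omega

theorem append_swap_four_two (α : V [⋀^Fin 6]→ₗ[ℝ] ℝ) (u : Fin 4 → V) (v : Fin 2 → V) :
    α (fun m ↦ Fin.append v u m) = α (fun m ↦ Fin.append u v m) := by
  have h := alternatingMap_comp_perm α (fun m ↦ Fin.append u v m)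
    (⟨![4, 5, 0, 1, 2, 3], ![2, 3, 4, 5, 0, 1], by decide, by decide⟩ : Equiv.Perm (Fin 6))
  have hs : Equiv.Perm.sign
    (⟨![4, 5, 0, 1, 2, 3], ![2, 3, 4, 5, 0, 1], by decide, by decide⟩ : Equiv.Perm (Fin 6)) = 1 := by
    decide +kernel
  rw [hs] at h
  simp only [Units.val_one, Int.cast_one, one_mul] at h
  rw [← h]
  congr 1
  funext m
  fin_cases m <;> rfl

/-- The Hodge star, applied twice to a four-form. -/
theorem sum_hodgeStar_four_mul (e : Module.Basis (Fin 6) ℝ V) (vol : V [⋀^Fin 6]→ₗ[ℝ] ℝ)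
    (hvol : vol e * vol e = 1) (a : V [⋀^Fin 4]→ₗ[ℝ] ℝ) (w : Fin 4 → V) :
    ∑ p : Fin 2 → Fin 6, hodgeStar e vol (k := 4) (l := 2) rfl a (fun i ↦ e (p i)) *
      vol (fun m ↦ Fin.append (fun i ↦ e (p i)) w m) = 2 * a w := by
  classical
  -- The left side is alternating in `w`, so injective tuples `h` of basis vectors suffice. Only
  -- pairs enumerating the two indices missed by `h` survive; their two orderings give the factor 2,
  -- and `vol e` enters squared.
  let L : V [⋀^Fin 4]→ₗ[ℝ] ℝ := ∑ p : Fin 2 → Fin 6,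
    hodgeStar e vol (k := 4) (l := 2) rfl a (fun i ↦ e (p i)) •
      ((vol.curryLeft (e (p 0))).curryLeft (e (p 1)))
  have hL : ∀ w, L w = ∑ p : Fin 2 → Fin 6,
      hodgeStar e vol (k := 4) (l := 2) rfl a (fun i ↦ e (p i)) *
      vol (fun m ↦ Fin.append (fun i ↦ e (p i)) w m) := by
    intro w
    simp only [L, alternatingMap_sum_apply, AlternatingMap.smul_apply, smul_eq_mul,
      AlternatingMap.curryLeft_apply_apply]
    refine Finset.sum_congr rfl fun p _ ↦ ?_
    congr 2
    funext m
    fin_cases m <;> rfl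
  rw [← hL]
  suffices L = (2 : ℝ) • a by rw [this]; rfl
  refine Module.Basis.ext_alternating e fun h hh ↦ ?_
  rw [hL]
  have hcard : (Finset.univ.image h)ᶜ.card = 2 := by
    rw [Finset.card_compl, Finset.card_image_of_injective _ hh]
    simp
  let h' : Fin 2 → Fin 6 := (Finset.univ.image h)ᶜ.orderEmbOfFin hcard
  have hh' : Function.Injective h' := ((Finset.univ.image h)ᶜ.orderEmbOfFin hcard).injective
  have hr : Set.range h' = (Set.range h)ᶜ := by
    simp [h']
  have hmem : ∀ x, x ∉ Set.range h → x ∈ Set.range h' := fun x hx ↦ by rw [hr]; exact hx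
  have hmem' : ∀ x, x ∉ Set.range h' → x ∈ Set.range h := fun x hx ↦ by
    rw [hr] at hx; simpa using hx
  have h4 : ∀ p : Fin 2 → Fin 6, (p = h') →
      hodgeStar e vol (k := 4) (l := 2) rfl a (fun i ↦ e (p i)) =
        a (fun i ↦ e (h i)) * vol (fun m ↦ Fin.append (fun i ↦ e (h i)) (fun i ↦ e (h' i)) m) := by
    rintro p rfl
    simp only [hodgeStar]
    rw [sum_tuple_eq_factorial_mul _ h hh]
    · have : ((Nat.factorial 4 : ℕ) : ℝ) ≠ 0 := by positivity
      rw [inv_mul_cancel_left₀ this]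
      rfl
    · intro σ
      have h1 := alternatingMap_append_perm (k := 4) (l := 2) rfl vol (fun i ↦ e (h i))
        (fun i ↦ e (h' i)) σ
      have h2 := alternatingMap_comp_perm a (fun i ↦ e (h i)) σ
      simp only [Function.comp_apply]
      rw [h1, h2]
      exact mul_mul_mul_sign _ _ _ (sign_mul_sign_real σ)
    · intro g hg
      rw [alternatingMap_append_eq_zero (k := 4) (l := 2) rfl vol e g h', mul_zero]
      rintro ⟨hgi, hgr⟩
      exact hg (exists_perm_of_injective hgi fun i ↦ hmem' _ (hgr i))
  have h2 : ∀ σ : Equiv.Perm (Fin 2),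
      hodgeStar e vol (k := 4) (l := 2) rfl a (fun i ↦ e ((h' ∘ σ) i)) =
      ((Equiv.Perm.sign σ : ℤ) : ℝ) *
        hodgeStar e vol (k := 4) (l := 2) rfl a (fun i ↦ e (h' i)) := by
    intro σ
    simp only [hodgeStar, Finset.mul_sum]
    refine Finset.sum_congr rfl fun g _ ↦ ?_
    have h1 := alternatingMap_append_perm_right (k := 4) (l := 2) rfl vol (fun i ↦ e (g i))
        (fun i ↦ e (h' i)) σ
    simp only [Function.comp_apply]
    rw [h1]
    ring
  rw [sum_tuple_eq_factorial_mul _ h' hh']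
  · rw [h4 _ rfl, append_swap_four_two]
    have hbij : Function.Bijective (fun m : Fin 6 ↦ Fin.append (n := 2) h h' m) := by
      rw [← Finite.injective_iff_bijective]
      change Function.Injective (Fin.append (n := 2) h h')
      rw [Fin.append_injective_iff]
      refine ⟨hh, hh', ?_⟩
      intro i j hij
      have : h' j ∈ (Set.range h)ᶜ := hr ▸ Set.mem_range_self j
      exact this ⟨i, hij⟩
    have hv := alternatingMap_comp_perm vol e (Equiv.ofBijective _ hbij)
    have hv' : (fun m ↦ Fin.append (fun i ↦ e (h i)) (fun i ↦ e (h' i)) m) =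
        fun i ↦ e ((Equiv.ofBijective _ hbij) i) := by
      funext m
      change _ = e (Fin.append (n := 2) h h' m)
      refine Fin.addCases (m := 4) (n := 2) (fun i ↦ ?_) (fun i ↦ ?_) m
      · rw [Fin.append_left, Fin.append_left]
      · rw [Fin.append_right, Fin.append_right]
    rw [hv', hv]
    simp only [AlternatingMap.smul_apply, smul_eq_mul, Nat.factorial]
    push_cast
    linear_combination (2 * a fun i ↦ e (h i)) *
      (sign_mul_sign_real (Equiv.ofBijective _ hbij) * (vol e * vol e) + hvol)
  · intro σ
    have h1 := alternatingMap_append_perm (k := 2) (l := 4) rfl vol (fun i ↦ e (h' i))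
        (fun i ↦ e (h i)) σ
    rw [h2]
    have h3 : (vol fun m ↦ Fin.append (fun i ↦ e ((h' ∘ σ) i)) (fun i ↦ e (h i)) m) = _ := h1
    rw [h3]
    exact mul_mul_mul_sign _ _ _ (sign_mul_sign_real σ)
  · intro g hg
    have h1 := alternatingMap_append_eq_zero (k := 2) (l := 4) rfl vol e g h (by
      rintro ⟨hgi, hgr⟩
      exact hg (exists_perm_of_injective hgi fun i ↦ hmem _ (hgr i)))
    have h3 : (vol fun m ↦ Fin.append (fun i ↦ e (g i)) (fun i ↦ e (h i)) m) = 0 := h1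
    rw [h3, mul_zero]

end DoubleStar

/-! ### The one-form ⋆(⋆a ∧ φ). -/

section StarWedgeStar

variable {V : Type*} [AddCommGroup V] [Module ℝ V]

/-- For a four-form `a` and a three-form `φ`, `⋆(⋆a ∧ φ) = -⟨· ⌟ a, φ⟩`. -/
theorem hodgeStar_wedge_hodgeStar (e : Module.Basis (Fin 6) ℝ V) (vol : V [⋀^Fin 6]→ₗ[ℝ] ℝ)
    (hvol : vol e * vol e = 1) (a : V [⋀^Fin 4]→ₗ[ℝ] ℝ) (φ : (Fin 3 → V) → ℝ) (v : Fin 1 → V) :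
    hodgeStar e vol (k := 5) (l := 1) rfl
      (wedge (hodgeStar e vol (k := 4) (l := 2) rfl a) φ) v =
      -formInner e (intProd (v 0) a) φ := by
  refine (hodgeStar_wedge e vol (p := 2) (q := 3) (l := 1) rfl
    (hodgeStar e vol (k := 4) (l := 2) rfl a) φ v).trans ?_
  rw [← (Fin.appendEquiv 2 3).sum_comp, Fintype.sum_prod_type, Finset.sum_comm]
  have h1 : ∀ u : Fin 3 → Fin 6, ∑ p : Fin 2 → Fin 6,
      hodgeStar e vol (k := 4) (l := 2) rfl a
          (fun i ↦ e ((Fin.appendEquiv 2 3 (p, u)) (Fin.castAdd 3 i))) *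
        φ (fun j ↦ e ((Fin.appendEquiv 2 3 (p, u)) (Fin.natAdd 2 j))) *
        vol (fun m ↦ Fin.append (fun i ↦ e ((Fin.appendEquiv 2 3 (p, u)) i)) v
          (Fin.cast (rfl : 6 = 2 + 3 + 1) m)) =
      -2 * (intProd (v 0) a (fun i ↦ e (u i)) * φ (fun i ↦ e (u i))) := by
    intro u
    have h2 := sum_hodgeStar_four_mul e vol hvol a (Fin.append (fun i ↦ e (u i)) v)
    have h3 : ∀ p : Fin 2 → Fin 6,
        vol (fun m ↦ Fin.append (fun i ↦ e ((Fin.appendEquiv 2 3 (p, u)) i)) v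
          (Fin.cast (rfl : 6 = 2 + 3 + 1) m)) =
        vol (fun m ↦ Fin.append (n := 4) (fun i ↦ e (p i)) (Fin.append (fun i ↦ e (u i)) v) m) := by
      intro p
      congr 1
      funext m
      fin_cases m <;> rfl
    -- Moving the last vector to the front passes three others, whence the minus sign.
    have h4 : a (Fin.append (fun i ↦ e (u i)) v) = -intProd (v 0) a (fun i ↦ e (u i)) := by
      have h5 := alternatingMap_comp_perm a (Fin.cons (v 0) fun i ↦ e (u i)) (finRotate 4)
      rw [sign_finRotate] at h5
      simp only [intProd]
      norm_num at h5
      rw [← h5]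
      congr 1
      funext m
      fin_cases m <;> rfl
    rw [h4] at h2
    calc _ = (∑ p : Fin 2 → Fin 6, hodgeStar e vol (k := 4) (l := 2) rfl a (fun i ↦ e (p i)) *
        vol (fun m ↦ Fin.append (n := 4) (fun i ↦ e (p i)) (Fin.append (fun i ↦ e (u i)) v) m)) *
          φ (fun i ↦ e (u i)) := by
          rw [Finset.sum_mul]
          refine Finset.sum_congr rfl fun p _ ↦ ?_
          rw [h3]
          simp only [Fin.appendEquiv_apply, Fin.append_left, Fin.append_right]
          ring
      _ = _ := by rw [h2]; ring
  rw [Finset.sum_congr rfl fun u _ ↦ h1 u, ← Finset.mul_sum]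
  simp only [formInner, Nat.factorial]
  push_cast
  ring

end StarWedgeStar

/-! ### The normalisation of ω ∧ ω ∧ ω. -/

section KahlerVolume

/-- A permutation of the first `p` indices, as a permutation of all indices. -/
def permLeft {p : ℕ} (q : ℕ) (τ : Equiv.Perm (Fin p)) : Equiv.Perm (Fin (p + q)) :=
  finSumFinEquiv.permCongr (Equiv.Perm.sumCongr τ 1)

theorem sign_permLeft {p : ℕ} (q : ℕ) (τ : Equiv.Perm (Fin p)) :
    Equiv.Perm.sign (permLeft q τ) = Equiv.Perm.sign τ := by
  simp [permLeft, Equiv.Perm.sign_permCongr, Equiv.Perm.sign_sumCongr]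

theorem permLeft_castAdd {p : ℕ} (q : ℕ) (τ : Equiv.Perm (Fin p)) (i : Fin p) :
    permLeft q τ (Fin.castAdd q i) = Fin.castAdd q (τ i) := by
  simp [permLeft, Equiv.permCongr_apply]

theorem permLeft_natAdd {p : ℕ} (q : ℕ) (τ : Equiv.Perm (Fin p)) (i : Fin q) :
    permLeft q τ (Fin.natAdd p i) = Fin.natAdd p i := by
  simp [permLeft, Equiv.permCongr_apply]

theorem sum_perm_permLeft {p q : ℕ} (G : Equiv.Perm (Fin (p + q)) → ℝ) :
    ∑ σ : Equiv.Perm (Fin (p + q)), ∑ τ : Equiv.Perm (Fin p),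
      ((Equiv.Perm.sign σ : ℤ) : ℝ) * (((Equiv.Perm.sign τ : ℤ) : ℝ) * G (σ * permLeft q τ)) =
      (p.factorial : ℝ) * ∑ σ, ((Equiv.Perm.sign σ : ℤ) : ℝ) * G σ := by
  rw [Finset.sum_comm]
  have h : ∀ τ : Equiv.Perm (Fin p), ∑ σ : Equiv.Perm (Fin (p + q)),
      ((Equiv.Perm.sign σ : ℤ) : ℝ) * (((Equiv.Perm.sign τ : ℤ) : ℝ) * G (σ * permLeft q τ)) =
      ∑ σ, ((Equiv.Perm.sign σ : ℤ) : ℝ) * G σ := by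
    intro τ
    refine Fintype.sum_equiv (Equiv.mulRight (permLeft q τ)) _ _ fun σ ↦ ?_
    simp only [Equiv.coe_mulRight, Equiv.Perm.sign_mul, sign_permLeft, Units.val_mul, Int.cast_mul]
    ring
  rw [Finset.sum_congr rfl fun τ _ ↦ h τ]
  simp [Fintype.card_perm]

/-- The inner antisymmetrisation over S₄ is absorbed by the outer one over S₆. The constants combine
to 4!/(4! 2! · 2! 2!) = 1/8. -/
theorem wedge_wedge {V : Type*} (κ : (Fin 2 → V) → ℝ) (v : Fin 6 → V) :
    wedge (wedge κ κ) κ v = (8 : ℝ)⁻¹ * ∑ σ : Equiv.Perm (Fin 6),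
      ((Equiv.Perm.sign σ : ℤ) : ℝ) *
        (κ ![v (σ 0), v (σ 1)] * κ ![v (σ 2), v (σ 3)] * κ ![v (σ 4), v (σ 5)]) := by
  have h := sum_perm_permLeft (p := 4) (q := 2) fun σ ↦
    κ ![v (σ 0), v (σ 1)] * κ ![v (σ 2), v (σ 3)] * κ ![v (σ 4), v (σ 5)]
  have h2 : ∀ (σ : Equiv.Perm (Fin 6)) (τ : Equiv.Perm (Fin 4)),
      κ ![v ((σ * permLeft 2 τ) 0), v ((σ * permLeft 2 τ) 1)] *
        κ ![v ((σ * permLeft 2 τ) 2), v ((σ * permLeft 2 τ) 3)] *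
        κ ![v ((σ * permLeft 2 τ) 4), v ((σ * permLeft 2 τ) 5)] =
      κ (fun i ↦ v (σ (Fin.castAdd 2 (τ (Fin.castAdd 2 i))))) *
        κ (fun i ↦ v (σ (Fin.castAdd 2 (τ (Fin.natAdd 2 i))))) *
        κ (fun i ↦ v (σ (Fin.natAdd 4 i))) := by
    intro σ τ
    have hl := permLeft_castAdd 2 τ
    have hr := permLeft_natAdd 2 τ
    congr 2
    · congr 1
      funext i
      fin_cases i
      · exact congrArg (fun j ↦ v (σ j)) (hl 0)
      · exact congrArg (fun j ↦ v (σ j)) (hl 1)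
    · congr 1
      funext i
      fin_cases i
      · exact congrArg (fun j ↦ v (σ j)) (hl 2)
      · exact congrArg (fun j ↦ v (σ j)) (hl 3)
    · funext i
      fin_cases i
      · exact congrArg (fun j ↦ v (σ j)) (hr 0)
      · exact congrArg (fun j ↦ v (σ j)) (hr 1)
  have h3 : ((Nat.factorial 4 : ℕ) : ℝ) * (∑ σ : Equiv.Perm (Fin 6),
      ((Equiv.Perm.sign σ : ℤ) : ℝ) *
        (κ ![v (σ 0), v (σ 1)] * κ ![v (σ 2), v (σ 3)] * κ ![v (σ 4), v (σ 5)])) =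
      ∑ σ : Equiv.Perm (Fin 6), ∑ τ : Equiv.Perm (Fin 4),
      ((Equiv.Perm.sign σ : ℤ) : ℝ) * (((Equiv.Perm.sign τ : ℤ) : ℝ) *
        (κ (fun i ↦ v (σ (Fin.castAdd 2 (τ (Fin.castAdd 2 i))))) *
        κ (fun i ↦ v (σ (Fin.castAdd 2 (τ (Fin.natAdd 2 i))))) *
        κ (fun i ↦ v (σ (Fin.natAdd 4 i))))) := by
    rw [← h]
    exact Finset.sum_congr rfl fun σ _ ↦ Finset.sum_congr rfl fun τ _ ↦ by rw [h2]
  have h4 : ∀ x y : ℝ, ((Nat.factorial 4 : ℕ) : ℝ) * x = y →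
      (((Nat.factorial 4 : ℕ) : ℝ) * ((Nat.factorial 2 : ℕ) : ℝ))⁻¹ *
        ((((Nat.factorial 2 : ℕ) : ℝ) * ((Nat.factorial 2 : ℕ) : ℝ))⁻¹ * y) = (8 : ℝ)⁻¹ * x := by
    rintro x y rfl
    simp only [Nat.factorial]
    push_cast
    ring
  rw [← h4 _ _ h3]
  simp only [wedge]
  congr 1
  rw [Finset.mul_sum]
  refine Finset.sum_congr rfl fun σ _ ↦ ?_
  rw [Finset.mul_sum, Finset.mul_sum, Finset.mul_sum, Finset.sum_mul]
  exact Finset.sum_congr rfl fun τ _ ↦ by ring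

/-- The components of the Kähler form in a basis `u₀, u₁, u₂, J u₀, J u₁, J u₂`. -/
def kahlerInt (i j : Fin 6) : ℤ :=
  if i.val + 3 = j.val then -1 else if j.val + 3 = i.val then 1 else 0

/-- The nonzero terms are the 2³·3! listings of the three pairs {b_k, J b_k}, and each contributes
+1. With the factors 1/8 and 1/6 this gives an adapted basis volume 1. -/
theorem sum_perm_kahlerInt :
    ∑ σ : Equiv.Perm (Fin 6),
      (if kahlerInt (σ 0) (σ 1) * kahlerInt (σ 2) (σ 3) * kahlerInt (σ 4) (σ 5) = 0 then 0 else
        (Equiv.Perm.sign σ : ℤ) *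
          (kahlerInt (σ 0) (σ 1) * kahlerInt (σ 2) (σ 3) * kahlerInt (σ 4) (σ 5))) = 48 := by
  decide +kernel

theorem wedge_wedge_eq_six {V : Type*} (κ : (Fin 2 → V) → ℝ) (v : Fin 6 → V)
    (h : ∀ i j, κ ![v i, v j] = kahlerInt i j) : wedge (wedge κ κ) κ v = 6 := by
  have h2 : ∑ σ : Equiv.Perm (Fin 6), ((Equiv.Perm.sign σ : ℤ) : ℝ) *
        (κ ![v (σ 0), v (σ 1)] * κ ![v (σ 2), v (σ 3)] * κ ![v (σ 4), v (σ 5)]) = (48 : ℤ) := by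
    rw [← sum_perm_kahlerInt, Int.cast_sum]
    refine Finset.sum_congr rfl fun σ _ ↦ ?_
    rw [h, h, h]
    split_ifs with h3
    · have : (kahlerInt (σ 0) (σ 1) : ℝ) * (kahlerInt (σ 2) (σ 3)) * (kahlerInt (σ 4) (σ 5)) = 0 := by
        exact_mod_cast h3
      rw [this]
      simp
    · push_cast
      rfl
  rw [wedge_wedge, h2]
  norm_num

end KahlerVolume

/-! ### Complex volume forms and adapted bases. -/

section AdaptedBasis

variable {V : Type*} [NormedAddCommGroup V] [InnerProductSpace ℝ V]

/-- An orthogonal complex structure together with a complex multilinear three-form. -/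
structure IsComplexVolume (J : V →L[ℝ] V) (Ψ : V [⋀^Fin 3]→L[ℝ] ℂ) : Prop where
  sq : ∀ v, J (J v) = -v
  orthogonal : ∀ v w, ⟪J v, J w⟫_ℝ = ⟪v, w⟫_ℝ
  complex : ∀ u v w, Ψ ![J u, v, w] = Complex.I * Ψ ![u, v, w]

theorem threeForm_swap₀₁ (Ψ : V [⋀^Fin 3]→L[ℝ] ℂ) (u v w : V) : Ψ ![v, u, w] = -Ψ ![u, v, w] := by
  have h := Ψ.toAlternatingMap.map_swap ![u, v, w] (i := 0) (j := 1) (by decide)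
  have h2 : ![u, v, w] ∘ ⇑(Equiv.swap (0 : Fin 3) 1) = ![v, u, w] := by
    funext i; fin_cases i <;> rfl
  rw [h2] at h
  exact h

theorem threeForm_swap₁₂ (Ψ : V [⋀^Fin 3]→L[ℝ] ℂ) (u v w : V) : Ψ ![u, w, v] = -Ψ ![u, v, w] := by
  have h := Ψ.toAlternatingMap.map_swap ![u, v, w] (i := 1) (j := 2) (by decide)
  have h2 : ![u, v, w] ∘ ⇑(Equiv.swap (1 : Fin 3) 2) = ![u, w, v] := by
    funext i; fin_cases i <;> rfl
  rw [h2] at h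
  exact h

theorem threeForm_self₀₁ (Ψ : V [⋀^Fin 3]→L[ℝ] ℂ) (u w : V) : Ψ ![u, u, w] = 0 := by
  have h := threeForm_swap₀₁ Ψ u u w
  exact self_eq_neg.mp h

theorem threeForm_self₁₂ (Ψ : V [⋀^Fin 3]→L[ℝ] ℂ) (u w : V) : Ψ ![u, w, w] = 0 := by
  have h := threeForm_swap₁₂ Ψ u w w
  exact self_eq_neg.mp h

theorem threeForm_self₀₂ (Ψ : V [⋀^Fin 3]→L[ℝ] ℂ) (u w : V) : Ψ ![u, w, u] = 0 := by
  rw [threeForm_swap₁₂, threeForm_self₀₁, neg_zero]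

theorem update_vec₀ {W : Type*} (u v w x : W) : Function.update ![u, v, w] 0 x = ![x, v, w] := by
  funext i; fin_cases i <;> rfl

theorem threeForm_add₀ (Ψ : V [⋀^Fin 3]→L[ℝ] ℂ) (u u' v w : V) :
    Ψ ![u + u', v, w] = Ψ ![u, v, w] + Ψ ![u', v, w] := by
  have h := Ψ.toAlternatingMap.map_update_add ![u, v, w] 0 u u'
  simp only [update_vec₀] at h
  exact h

theorem threeForm_smul₀ (Ψ : V [⋀^Fin 3]→L[ℝ] ℂ) (c : ℝ) (u v w : V) :
    Ψ ![c • u, v, w] = c * Ψ ![u, v, w] := by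
  have h := Ψ.toAlternatingMap.map_update_smul ![u, v, w] 0 c u
  simp only [update_vec₀, Complex.real_smul] at h
  exact h

namespace IsComplexVolume

variable {J : V →L[ℝ] V} {Ψ : V [⋀^Fin 3]→L[ℝ] ℂ}

theorem complex₁ (h : IsComplexVolume J Ψ) (u v w : V) :
    Ψ ![u, J v, w] = Complex.I * Ψ ![u, v, w] := by
  rw [threeForm_swap₀₁, h.complex, threeForm_swap₀₁]; ring

theorem complex₂ (h : IsComplexVolume J Ψ) (u v w : V) :
    Ψ ![u, v, J w] = Complex.I * Ψ ![u, v, w] := by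
  rw [threeForm_swap₁₂, h.complex₁, threeForm_swap₁₂]; ring

theorem inner_right (h : IsComplexVolume J Ψ) (u v : V) : ⟪u, J v⟫_ℝ = -⟪J u, v⟫_ℝ := by
  rw [← h.orthogonal u (J v), h.sq, inner_neg_right]

theorem inner_self (h : IsComplexVolume J Ψ) (u : V) : ⟪u, J u⟫_ℝ = 0 := by
  have := h.inner_right u u
  rw [real_inner_comm] at this
  linarith [real_inner_comm u (J u)]

end IsComplexVolume

theorem exists_norm_eq_one_orthogonal [FiniteDimensional ℝ V] {n : ℕ}
    (hn : n < Module.finrank ℝ V) (s : Fin n → V) :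
    ∃ u : V, ⟪u, u⟫_ℝ = 1 ∧ ∀ i, ⟪s i, u⟫_ℝ = 0 := by
  let L : V →ₗ[ℝ] (Fin n → ℝ) := LinearMap.pi fun i ↦ (innerSL ℝ (s i)).toLinearMap
  have hL : LinearMap.ker L ≠ ⊥ := LinearMap.ker_ne_bot_of_finrank_lt (by simpa using hn)
  obtain ⟨u, hu, hu0⟩ := (Submodule.ne_bot_iff _).mp hL
  have hnu : ‖u‖ ≠ 0 := norm_ne_zero_iff.mpr hu0
  refine ⟨‖u‖⁻¹ • u, ?_, fun i ↦ ?_⟩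
  · rw [real_inner_smul_left, real_inner_smul_right, real_inner_self_eq_norm_sq]
    field_simp
  · have : ⟪s i, u⟫_ℝ = 0 := congrFun (LinearMap.mem_ker.mp hu) i
    rw [real_inner_smul_right, this, mul_zero]

/-- The index `k'` with `J b_k = ± b_{k'}` in an adapted basis. -/
def jIdx : Fin 6 → Fin 6 := ![3, 4, 5, 0, 1, 2]

/-- The sign in `J b_k = ± b_{k'}` in an adapted basis. -/
def jSgn : Fin 6 → ℤ := ![1, 1, 1, -1, -1, -1]

/-- An orthonormal basis of the form `u₀, u₁, u₂, J u₀, J u₁, J u₂` with `Ψ(u₀, u₁, u₂) = 1`. -/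
structure IsAdaptedBasis (J : V →L[ℝ] V) (Ψ : V [⋀^Fin 3]→L[ℝ] ℂ)
    (b : OrthonormalBasis (Fin 6) ℝ V) : Prop extends IsComplexVolume J Ψ where
  apply_J : ∀ k, J (b k) = (jSgn k : ℝ) • b (jIdx k)
  apply_Ψ : Ψ ![b 0, b 1, b 2] = 1

/-- A unitary triple is chosen greedily, each new vector orthogonal to the complex span of the
earlier ones. The normalisation of Ψ makes its value on the triple a unit complex number, and a
rotation of the first vector in its complex line turns this value into 1. -/
theorem exists_isAdaptedBasis (hV : Module.finrank ℝ V = 6)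
    {J : V →L[ℝ] V} {Ψ : V [⋀^Fin 3]→L[ℝ] ℂ} (h : IsComplexVolume J Ψ)
    (hΨ : ∀ u : Fin 3 → V,
      (∀ i j, ⟪u i, u j⟫_ℝ = if i = j then 1 else 0) → (∀ i j, ⟪u i, J (u j)⟫_ℝ = 0) →
      (1 / 6 : ℂ) * ∑ i, ∑ j, ∑ k,
        Ψ ![u i, u j, u k] * (starRingEnd ℂ) (Ψ ![u i, u j, u k]) = 1) :
    ∃ b : OrthonormalBasis (Fin 6) ℝ V, IsAdaptedBasis J Ψ b := by
  have : FiniteDimensional ℝ V := Module.finite_of_finrank_pos (by omega)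
  obtain ⟨u₀, h00, -⟩ := exists_norm_eq_one_orthogonal (V := V) (n := 0) (by omega) ![]
  obtain ⟨u₁, h11, h1⟩ := exists_norm_eq_one_orthogonal (V := V) (n := 2) (by omega) ![u₀, J u₀]
  obtain ⟨u₂, h22, h2⟩ := exists_norm_eq_one_orthogonal (V := V) (n := 4) (by omega)
    ![u₀, J u₀, u₁, J u₁]
  have h01 : ⟪u₀, u₁⟫_ℝ = 0 := h1 0
  have hJ01 : ⟪J u₀, u₁⟫_ℝ = 0 := h1 1
  have h02 : ⟪u₀, u₂⟫_ℝ = 0 := h2 0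
  have hJ02 : ⟪J u₀, u₂⟫_ℝ = 0 := h2 1
  have h12 : ⟪u₁, u₂⟫_ℝ = 0 := h2 2
  have hJ12 : ⟪J u₁, u₂⟫_ℝ = 0 := h2 3
  have c : ∀ a b : V, ⟪a, b⟫_ℝ = 0 → ⟪b, a⟫_ℝ = 0 := fun a b h ↦ by rw [real_inner_comm]; exact h
  have hJr : ∀ a b : V, ⟪J a, b⟫_ℝ = 0 → ⟪a, J b⟫_ℝ = 0 := fun a b hab ↦ by
    rw [h.inner_right, hab, neg_zero]
  -- The six permutations of the triple contribute equally, which cancels the factor 1/6.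
  have hz : Ψ ![u₀, u₁, u₂] * (starRingEnd ℂ) (Ψ ![u₀, u₁, u₂]) = 1 := by
    have h6 := hΨ ![u₀, u₁, u₂]
      (by
        intro i j
        fin_cases i <;> fin_cases j <;> simp [h00, h11, h22, h01, h02, h12, c _ _ h01, c _ _ h02,
          c _ _ h12, -inner_self_eq_norm_sq_to_K])
      (by
        intro i j
        fin_cases i <;> fin_cases j <;> simp [h.inner_self, hJr _ _ hJ01, hJr _ _ hJ02,
          hJr _ _ hJ12, c _ _ hJ01, c _ _ hJ02, c _ _ hJ12])
    simp only [Fin.sum_univ_three, Matrix.cons_val_zero, Matrix.cons_val_one, Matrix.cons_val,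
      threeForm_self₀₁, threeForm_self₁₂, threeForm_self₀₂] at h6
    rw [threeForm_swap₁₂ Ψ u₀ u₁ u₂, threeForm_swap₀₁ Ψ u₀ u₁ u₂, threeForm_swap₁₂ Ψ u₁ u₀ u₂,
      threeForm_swap₀₁ Ψ u₀ u₂ u₁, threeForm_swap₁₂ Ψ u₂ u₀ u₁, threeForm_swap₀₁ Ψ u₀ u₂ u₁,
      threeForm_swap₁₂ Ψ u₀ u₁ u₂, threeForm_swap₀₁ Ψ u₀ u₁ u₂] at h6
    simp only [map_neg, map_zero] at h6
    linear_combination h6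
  set z := Ψ ![u₀, u₁, u₂] with hzdef
  have hz' : z.re * z.re + z.im * z.im = 1 := by
    have := congrArg Complex.re hz
    simpa using this
  -- This is u₀ multiplied by the conjugate of z, so Ψ(u, u₁, u₂) = |z|² = 1.
  let u : V := z.re • u₀ - z.im • J u₀
  have huJ : J u = z.re • J u₀ + z.im • u₀ := by
    simp only [u, map_sub, map_smul, h.sq, smul_neg, sub_neg_eq_add]
  have hv : Orthonormal ℝ ![u, u₁, u₂, J u, J u₁, J u₂] := by
    have huu : ⟪u, u⟫_ℝ = 1 := by
      simp only [u, inner_sub_left, inner_sub_right, real_inner_smul_left, real_inner_smul_right,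
        h00, h.orthogonal, h.inner_self, c _ _ (h.inner_self u₀)]
      linear_combination hz'
    have hu1 : ⟪u, u₁⟫_ℝ = 0 := by
      simp [u, inner_sub_left, real_inner_smul_left, h01, hJ01]
    have hu2 : ⟪u, u₂⟫_ℝ = 0 := by
      simp [u, inner_sub_left, real_inner_smul_left, h02, hJ02]
    have hJu1 : ⟪J u, u₁⟫_ℝ = 0 := by
      simp [huJ, inner_add_left, real_inner_smul_left, h01, hJ01]
    have hJu2 : ⟪J u, u₂⟫_ℝ = 0 := by
      simp [huJ, inner_add_left, real_inner_smul_left, h02, hJ02]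
    rw [orthonormal_iff_ite]
    intro i j
    fin_cases i <;> fin_cases j <;>
      simp [h.orthogonal, huu, h11, h22, hu1, hu2, h12, hJu1, hJu2, hJ12, c _ _ hu1, c _ _ hu2,
        c _ _ h12, c _ _ hJu1, c _ _ hJu2, c _ _ hJ12, hJr _ _ hJu1, hJr _ _ hJu2, hJr _ _ hJ12,
        c _ _ (hJr _ _ hJu1), c _ _ (hJr _ _ hJu2), c _ _ (hJr _ _ hJ12), h.inner_self,
        c _ _ (h.inner_self _), -inner_self_eq_norm_sq_to_K]
  have hli := hv.linearIndependent
  have hspan : ⊤ ≤ Submodule.span ℝ (Set.range ![u, u₁, u₂, J u, J u₁, J u₂]) := by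
    rw [hli.span_eq_top_of_card_eq_finrank (by simp [hV])]
  refine ⟨OrthonormalBasis.mk hv hspan, ⟨h, ?_, ?_⟩⟩
  · intro k
    simp only [OrthonormalBasis.coe_mk]
    fin_cases k <;> simp [jSgn, jIdx, h.sq]
  · simp only [OrthonormalBasis.coe_mk]
    change Ψ ![u, u₁, u₂] = 1
    have : u = z.re • u₀ + (-z.im) • J u₀ := by simp [u, sub_eq_add_neg]
    rw [this, threeForm_add₀, threeForm_smul₀, threeForm_smul₀, h.complex, ← hzdef]
    apply Complex.ext
    · simp
      linear_combination hz'
    · simp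
      ring

end AdaptedBasis

/-! ### The derivation action of endomorphisms on forms and its antisymmetrisation. -/

section DerivationAction

variable {V : Type*} [AddCommGroup V] [Module ℝ V]

/-- The action `(A α)(v₁, …, vₖ) = ∑ᵢ α(v₁, …, A vᵢ, …, vₖ)` of an endomorphism on a form. -/
noncomputable def derAlt {k : ℕ} (α : V [⋀^Fin k]→ₗ[ℝ] ℝ) (A : V →ₗ[ℝ] V) : V [⋀^Fin k]→ₗ[ℝ] ℝ where
  toMultilinearMap := ∑ i : Fin k,
    α.toMultilinearMap.compLinearMap (Function.update (fun _ ↦ LinearMap.id) i A)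
  map_eq_zero_of_eq' := by
    intro v i j hvij hij
    have hf : ∀ l, (fun m ↦ (Function.update (fun _ ↦ LinearMap.id) l A : Fin k → V →ₗ[ℝ] V) m (v m))
        = Function.update v l (A (v l)) := by
      intro l
      funext m
      by_cases h : m = l
      · subst h; simp
      · simp [h]
    simp only [AlternatingMap.coe_multilinearMap, sum_apply,
      MultilinearMap.compLinearMap_apply, hf, MultilinearMap.toFun_eq_coe]
    rw [Fintype.sum_eq_add i j hij]
    · have h2 : Function.update v j (A (v j)) =
          Function.update v i (A (v i)) ∘ Equiv.swap i j := by
        funext m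
        by_cases hmi : m = i
        · subst hmi; simp [hij, hij.symm, hvij]
        · by_cases hmj : m = j
          · subst hmj; simp [hvij]
          · simp [hmi, hmj, Equiv.swap_apply_of_ne_of_ne hmi hmj]
      rw [h2, α.map_swap _ hij, add_neg_cancel]
    · intro l ⟨hli, hlj⟩
      exact α.map_eq_zero_of_eq _ (by simp [Function.update_of_ne hli.symm,
        Function.update_of_ne hlj.symm, hvij]) hij

theorem derAlt_apply {k : ℕ} (α : V [⋀^Fin k]→ₗ[ℝ] ℝ) (A : V →ₗ[ℝ] V) (v : Fin k → V) :
    derAlt α A v = ∑ i, α (Function.update v i (A (v i))) := by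
  change (∑ i : Fin k, α.toMultilinearMap.compLinearMap
    (Function.update (fun _ ↦ LinearMap.id) i A)) v = _
  simp only [sum_apply, MultilinearMap.compLinearMap_apply,
    AlternatingMap.coe_multilinearMap]
  refine Finset.sum_congr rfl fun l _ ↦ congrArg α ?_
  funext m
  by_cases h : m = l
  · subst h; simp
  · simp [h]

/-- The action of a linear family of endomorphisms on a form. -/
noncomputable def derAltFamily {k : ℕ} (α : V [⋀^Fin k]→ₗ[ℝ] ℝ) (A : V →ₗ[ℝ] V →ₗ[ℝ] V) :
    V →ₗ[ℝ] V [⋀^Fin k]→ₗ[ℝ] ℝ where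
  toFun x := derAlt α (A x)
  map_add' x y := by
    ext v
    simp [derAlt_apply, Finset.sum_add_distrib]
  map_smul' c x := by
    ext v
    simp [derAlt_apply, Finset.mul_sum]

/-- The antisymmetrised action of a linear family of endomorphisms on a form. -/
noncomputable def extAlt {k : ℕ} (α : V [⋀^Fin k]→ₗ[ℝ] ℝ) (A : V →ₗ[ℝ] V →ₗ[ℝ] V) :
    V [⋀^Fin (k + 1)]→ₗ[ℝ] ℝ :=
  AlternatingMap.alternatizeUncurryFin (derAltFamily α A)

theorem extAlt_apply {k : ℕ} (α : V [⋀^Fin k]→ₗ[ℝ] ℝ) (A : V →ₗ[ℝ] V →ₗ[ℝ] V)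
    (v : Fin (k + 1) → V) :
    extAlt α A v = ∑ i : Fin (k + 1), (-1 : ℝ) ^ (i : ℕ) * derAlt α (A (v i)) (i.removeNth v) := by
  rw [extAlt, AlternatingMap.alternatizeUncurryFin_apply]
  refine Finset.sum_congr rfl fun i _ ↦ ?_
  rw [zsmul_eq_mul]
  push_cast
  rfl

end DerivationAction

/-! ### Components of ω, ψ₊ and ψ₋ in an adapted basis. -/

section Forms

variable {V : Type*} [NormedAddCommGroup V] [InnerProductSpace ℝ V]

/-- The Kähler form as an alternating map. -/
noncomputable def omegaAlt {J : V →L[ℝ] V} {Ψ : V [⋀^Fin 3]→L[ℝ] ℂ} (h : IsComplexVolume J Ψ) :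
    V [⋀^Fin 2]→ₗ[ℝ] ℝ where
  toFun v := ⟪v 0, J (v 1)⟫_ℝ
  map_update_add' := by
    intro inst m i x y
    obtain rfl := Subsingleton.elim inst (instDecidableEqFin 2)
    fin_cases i <;> simp [inner_add_left, inner_add_right]
  map_update_smul' := by
    intro inst m i c x
    obtain rfl := Subsingleton.elim inst (instDecidableEqFin 2)
    fin_cases i <;> simp [real_inner_smul_left, real_inner_smul_right]
  map_eq_zero_of_eq' := by
    intro v i j hv hij
    have : v 0 = v 1 := by
      fin_cases i <;> fin_cases j <;> simp_all
    rw [this, h.inner_self]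

@[simp]
theorem omegaAlt_apply {J : V →L[ℝ] V} {Ψ : V [⋀^Fin 3]→L[ℝ] ℂ} (h : IsComplexVolume J Ψ)
    (v : Fin 2 → V) : omegaAlt h v = ⟪v 0, J (v 1)⟫_ℝ := rfl

/-- The real part of a complex form. -/
noncomputable def reAlt {k : ℕ} (Ψ : V [⋀^Fin k]→L[ℝ] ℂ) : V [⋀^Fin k]→ₗ[ℝ] ℝ :=
  Complex.reLm.compAlternatingMap Ψ.toAlternatingMap

/-- The imaginary part of a complex form. -/
noncomputable def imAlt {k : ℕ} (Ψ : V [⋀^Fin k]→L[ℝ] ℂ) : V [⋀^Fin k]→ₗ[ℝ] ℝ :=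
  Complex.imLm.compAlternatingMap Ψ.toAlternatingMap

theorem reAlt_apply {k : ℕ} (Ψ : V [⋀^Fin k]→L[ℝ] ℂ) (v : Fin k → V) : reAlt Ψ v = (Ψ v).re := rfl

theorem imAlt_apply {k : ℕ} (Ψ : V [⋀^Fin k]→L[ℝ] ℂ) (v : Fin k → V) : imAlt Ψ v = (Ψ v).im := rfl

/-- The index of the complex coordinate direction of the `i`-th vector of an adapted basis. -/
def zIdx : Fin 6 → Fin 3 := ![0, 1, 2, 0, 1, 2]

/-- The `i`-th vector of an adapted basis is `J ^ zPow i` applied to a vector of the complex basis. -/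
def zPow : Fin 6 → ℕ := ![0, 0, 0, 1, 1, 1]

/-- The Levi-Civita symbol. -/
def leviCivita₃ (i j k : Fin 3) : ℤ := ((j : ℤ) - i) * ((k : ℤ) - i) * ((k : ℤ) - j) / 2

/-- The components of `ψ₊` in an adapted basis. -/
def psiReInt (i j k : Fin 6) : ℤ :=
  leviCivita₃ (zIdx i) (zIdx j) (zIdx k) *
    (if zPow i + zPow j + zPow k = 0 then 1 else if zPow i + zPow j + zPow k = 2 then -1 else 0)

/-- The components of `ψ₋` in an adapted basis. -/
def psiImInt (i j k : Fin 6) : ℤ :=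
  leviCivita₃ (zIdx i) (zIdx j) (zIdx k) *
    (if zPow i + zPow j + zPow k = 1 then 1 else if zPow i + zPow j + zPow k = 3 then -1 else 0)

namespace IsAdaptedBasis

variable {J : V →L[ℝ] V} {Ψ : V [⋀^Fin 3]→L[ℝ] ℂ} {b : OrthonormalBasis (Fin 6) ℝ V}

theorem inner_J (h : IsAdaptedBasis J Ψ b) (i j : Fin 6) : ⟪b i, J (b j)⟫_ℝ = kahlerInt i j := by
  rw [h.apply_J, real_inner_smul_right, b.inner_eq_ite]
  fin_cases i <;> fin_cases j <;> simp [kahlerInt, jSgn, jIdx]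

/-- Complex linearity in each slot pulls a factor i out of `b 3`, `b 4` and `b 5`, so every
component of Ψ reduces to its values on `b 0`, `b 1`, `b 2`. -/
theorem zIdx_zPow (h : IsAdaptedBasis J Ψ b) (v w : V) (i : Fin 6) :
    Ψ ![b i, v, w] = Complex.I ^ zPow i * Ψ ![b (Fin.castAdd 3 (zIdx i)), v, w] ∧
    Ψ ![v, b i, w] = Complex.I ^ zPow i * Ψ ![v, b (Fin.castAdd 3 (zIdx i)), w] ∧
    Ψ ![v, w, b i] = Complex.I ^ zPow i * Ψ ![v, w, b (Fin.castAdd 3 (zIdx i))] := by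
  have h3 : b 3 = J (b 0) := by simp [h.apply_J, jSgn, jIdx]
  have h4 : b 4 = J (b 1) := by simp [h.apply_J, jSgn, jIdx]
  have h5 : b 5 = J (b 2) := by simp [h.apply_J, jSgn, jIdx]
  have e0 : Fin.castAdd 3 (0 : Fin 3) = 0 := rfl
  have e1 : Fin.castAdd 3 (1 : Fin 3) = 1 := rfl
  have e2 : Fin.castAdd 3 (2 : Fin 3) = 2 := rfl
  fin_cases i <;>
    simp [zIdx, zPow, h3, h4, h5, h.complex, h.complex₁, h.complex₂, e0, e1, e2]

theorem Ψ_castAdd (h : IsAdaptedBasis J Ψ b) (i j k : Fin 3) :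
    Ψ ![b (Fin.castAdd 3 i), b (Fin.castAdd 3 j), b (Fin.castAdd 3 k)] = leviCivita₃ i j k := by
  have e0 : Fin.castAdd 3 (0 : Fin 3) = 0 := rfl
  have e1 : Fin.castAdd 3 (1 : Fin 3) = 1 := rfl
  have e2 : Fin.castAdd 3 (2 : Fin 3) = 2 := rfl
  have h0 := h.apply_Ψ
  have h1 : Ψ ![b 1, b 0, b 2] = -1 := by rw [threeForm_swap₀₁, h0]
  have h2 : Ψ ![b 0, b 2, b 1] = -1 := by rw [threeForm_swap₁₂, h0]
  have h3 : Ψ ![b 1, b 2, b 0] = 1 := by rw [threeForm_swap₁₂, h1, neg_neg]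
  have h4 : Ψ ![b 2, b 0, b 1] = 1 := by rw [threeForm_swap₀₁, h2, neg_neg]
  have h5 : Ψ ![b 2, b 1, b 0] = -1 := by rw [threeForm_swap₁₂, h4]
  fin_cases i <;> fin_cases j <;> fin_cases k <;>
    simp [e0, e1, e2, h0, h1, h2, h3, h4, h5, threeForm_self₀₁, threeForm_self₁₂, threeForm_self₀₂,
      leviCivita₃]

theorem Ψ_apply (h : IsAdaptedBasis J Ψ b) (i j k : Fin 6) :
    Ψ ![b i, b j, b k] = psiReInt i j k + psiImInt i j k * Complex.I := by
  rw [(h.zIdx_zPow _ _ i).1, (h.zIdx_zPow _ _ j).2.1, (h.zIdx_zPow _ _ k).2.2, h.Ψ_castAdd]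
  have key : ∀ n : ℕ, n < 4 → Complex.I ^ n =
      ((if n = 0 then 1 else if n = 2 then -1 else 0 : ℤ) : ℂ) +
      ((if n = 1 then 1 else if n = 3 then -1 else 0 : ℤ) : ℂ) * Complex.I := by
    intro n hn
    interval_cases n
    · simp
    · simp
    · simp [Complex.I_sq]
    · rw [Complex.I_pow_three]; simp
  have hz : ∀ i, zPow i ≤ 1 := by decide
  have := key (zPow i + zPow j + zPow k) (by have := hz i; have := hz j; have := hz k; omega)
  simp only [psiReInt, psiImInt, Int.cast_mul]
  rw [pow_add, pow_add] at this
  linear_combination (leviCivita₃ (zIdx i) (zIdx j) (zIdx k) : ℂ) * this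

theorem re_apply (h : IsAdaptedBasis J Ψ b) (i j k : Fin 6) :
    (Ψ ![b i, b j, b k]).re = psiReInt i j k := by
  rw [h.Ψ_apply]; simp

theorem im_apply (h : IsAdaptedBasis J Ψ b) (i j k : Fin 6) :
    (Ψ ![b i, b j, b k]).im = psiImInt i j k := by
  rw [h.Ψ_apply]; simp

end IsAdaptedBasis

end Forms

/-! ### Coordinates on u(3)^⊥. -/

section AntiHermitian

/-- The matrix of the endomorphism `y ↦ ∑ₗ ψ₊(e_p, e_l, y) J e_l` in an adapted basis. -/
def xiInt (p m y : Fin 6) : ℤ := ∑ l, psiReInt p l y * kahlerInt m l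

/-- A skew-symmetric matrix anticommuting with `J` is a combination of the contractions of `ψ₊`. -/
theorem exists_coeff_of_antiHermitian (c : Fin 6 → Fin 6 → ℝ) (hs : ∀ m y, c m y = -c y m)
    (ha : ∀ m y, (jSgn y : ℝ) * c m (jIdx y) = jSgn m * c (jIdx m) y) :
    ∃ ρ : Fin 6 → ℝ, ∀ m y, c m y = -(1 / 2) * ∑ p, ρ p * (xiInt p m y : ℝ) := by
  -- Each coordinate is read off from one matrix entry: for instance `xiInt p 1 5` vanishes unless p
  -- = 0, where it is 1, so c₁₅ = −ρ₀/2. The remaining entries follow from skewness and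
  -- anticommutation with J.
  refine ⟨![-2 * c 1 5, 2 * c 0 5, -2 * c 0 4, -2 * c 1 2, 2 * c 0 2, -2 * c 0 1], ?_⟩
  have hd : ∀ m, c m m = 0 := fun m ↦ by linarith [hs m m]
  have a03 := ha 0 0
  have a13 := ha 1 0
  have a14 := ha 1 1
  have a23 := ha 2 0
  have a24 := ha 2 1
  have a25 := ha 2 2
  have a34 := ha 3 1
  have a35 := ha 3 2
  have a45 := ha 4 2
  simp [jSgn, jIdx] at a03 a13 a14 a23 a24 a25 a34 a35 a45
  intro m y
  fin_cases m <;> fin_cases y <;>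
    simp [Fin.sum_univ_six, xiInt, psiReInt, kahlerInt, leviCivita₃, zIdx, zPow] <;>
    linarith [hd 0, hd 1, hd 2, hd 3, hd 4, hd 5, hs 0 1, hs 0 2, hs 0 3, hs 0 4, hs 0 5, hs 1 2,
      hs 1 3, hs 1 4, hs 1 5, hs 2 3, hs 2 4, hs 2 5, hs 3 4, hs 3 5, hs 4 5]

end AntiHermitian

/-! ### Component identities for ∇ω, ∇ψ₊, ∇ψ₋ and for r(ω). -/

section Components

/-- This is ⟨p ⌟ ψ₊, q ⌟ ψ₊⟩ = 2δ without the factor 1/2! of two-forms. It is what makes the factor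
½ in r(ω) the right one for recovering ρ. -/
theorem sum_psiReInt_mul : ∀ p q, ∑ i, ∑ j, psiReInt p i j * psiReInt q i j =
    if p = q then 4 else 0 := by
  decide +kernel

/-- Since ξ_X carries the coefficient −½, this says that ξ_X acts on ω as ρ ⌟ ψ₊. -/
theorem sum_xiInt_kahler : ∀ p i j, ∑ m, (xiInt p m i * kahlerInt m j + xiInt p m j * kahlerInt i m)
    = -2 * psiReInt p i j := by
  decide +kernel

/-- With the coefficient −½, this identity and `sum_xiInt_psiIm` express the action of ξ_X on ψ₊ as
−ρ ∧ ω and on ψ₋ as (ρ∘J) ∧ ω. -/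
theorem sum_xiInt_psiRe : ∀ p i j k,
    ∑ m, (xiInt p m i * psiReInt m j k + xiInt p m j * psiReInt i m k +
      xiInt p m k * psiReInt i j m) =
    2 * ((if p = i then kahlerInt j k else 0) + (if p = j then kahlerInt k i else 0) +
      (if p = k then kahlerInt i j else 0)) := by
  decide +kernel

theorem sum_xiInt_psiIm : ∀ p i j k,
    ∑ m, (xiInt p m i * psiImInt m j k + xiInt p m j * psiImInt i m k +
      xiInt p m k * psiImInt i j m) =
    -2 * (kahlerInt p i * kahlerInt j k + kahlerInt p j * kahlerInt k i +
      kahlerInt p k * kahlerInt i j) := by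
  decide +kernel

/-- The components of `∇_X ω = r(X) ⌟ ψ₊`. -/
def nablaOmega (ρ : Fin 6 → ℝ) : Fin 6 → Fin 6 → ℝ :=
  ![![0, ρ 2, -ρ 1, 0, -ρ 5, ρ 4], ![-ρ 2, 0, ρ 0, ρ 5, 0, -ρ 3], ![ρ 1, -ρ 0, 0, -ρ 4, ρ 3, 0],
    ![0, -ρ 5, ρ 4, 0, -ρ 2, ρ 1], ![ρ 5, 0, -ρ 3, ρ 2, 0, -ρ 0], ![-ρ 4, ρ 3, 0, -ρ 1, ρ 0, 0]]

theorem sum_mul_psiReInt (ρ : Fin 6 → ℝ) (i j : Fin 6) :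
    ∑ p, ρ p * (psiReInt p i j : ℝ) = nablaOmega ρ i j := by
  fin_cases i <;> fin_cases j <;>
    simp [Fin.sum_univ_six, psiReInt, leviCivita₃, zIdx, zPow, nablaOmega] <;> norm_num

theorem sum_sum_kahlerInt (F : Fin 6 → Fin 6 → ℝ) : ∑ i, ∑ j, F i j * (kahlerInt i j : ℝ) =
    F 3 0 - F 0 3 + (F 4 1 - F 1 4) + (F 5 2 - F 2 5) := by
  simp [Fin.sum_univ_six, kahlerInt]
  ring

/-- The components of `J r(X)`. -/
def jVec (ρ : Fin 6 → ℝ) : Fin 6 → ℝ := ![ρ 3, ρ 4, ρ 5, -ρ 0, -ρ 1, -ρ 2]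

theorem sum_mul_kahlerInt (ρ : Fin 6 → ℝ) (i : Fin 6) :
    ∑ p, ρ p * (kahlerInt p i : ℝ) = jVec ρ i := by
  fin_cases i <;> simp [Fin.sum_univ_six, kahlerInt, jVec]

/-- The components of `∇_X ψ₊`. -/
def nablaPsiRe (ρ : Fin 6 → ℝ) (N : ℝ) (i j k : Fin 6) : ℝ :=
  -(ρ i * kahlerInt j k + ρ j * kahlerInt k i + ρ k * kahlerInt i j) - 3 * N * psiImInt i j k

/-- The components of `∇_X ψ₋`. -/
def nablaPsiIm (ρ : Fin 6 → ℝ) (N : ℝ) (i j k : Fin 6) : ℝ :=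
  (jVec ρ i * kahlerInt j k + jVec ρ j * kahlerInt k i + jVec ρ k * kahlerInt i j) +
    3 * N * psiReInt i j k

theorem sum_sum_psiImInt (F : Fin 6 → Fin 6 → ℝ) (y : Fin 6) :
    ∑ i, ∑ j, F i j * (psiImInt y i j : ℝ) =
      ![F 1 5 - F 5 1 + (F 4 2 - F 2 4), F 2 3 - F 3 2 + (F 5 0 - F 0 5),
        F 0 4 - F 4 0 + (F 3 1 - F 1 3), F 1 2 - F 2 1 - (F 4 5 - F 5 4),
        F 2 0 - F 0 2 - (F 5 3 - F 3 5), F 0 1 - F 1 0 - (F 3 4 - F 4 3)] y := by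
  fin_cases y <;> simp [Fin.sum_univ_six, psiImInt, leviCivita₃, zIdx, zPow] <;> ring

-- For each pair (x, y) this is a linear identity in the entries of ρ and η. The η-terms drop out: η
-- contributes 3(η∘J) ∧ ψ₋ to dψ₊ and −3(η∘J) ∧ ψ₊ to dψ₋, and as Ψ has type (3,0) these equal −3η ∧
-- ψ₊ and −3η ∧ ψ₋, which the twist 3η ∧ ψ± cancels. The pair `jSgn x`, `jIdx x` stands for J b_x.
set_option maxHeartbeats 2000000 in
theorem two_mul_coeff_eq (ρ : Fin 6 → Fin 6 → ℝ) (η : Fin 6 → ℝ) (x y : Fin 6) :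
    2 * ρ x y =
      (1 / 2) * (∑ j, ∑ k, (jSgn x : ℝ) * (nablaOmega (ρ (jIdx x)) j k -
        nablaOmega (ρ j) (jIdx x) k + nablaOmega (ρ k) (jIdx x) j) * (psiImInt y j k : ℝ))
      - (1 / 2) * (∑ j, ∑ k, (nablaPsiRe (ρ x) (-jVec η x) y j k -
        nablaPsiRe (ρ y) (-jVec η y) x j k + nablaPsiRe (ρ j) (-jVec η j) x y k -
        nablaPsiRe (ρ k) (-jVec η k) x y j + 3 * (η x * psiReInt y j k - η y * psiReInt x j k +
        η j * psiReInt x y k - η k * psiReInt x y j)) * (kahlerInt j k : ℝ))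
      + (1 / 2) * (∑ j, ∑ k, (jSgn x : ℝ) * (nablaPsiIm (ρ (jIdx x)) (-jVec η (jIdx x)) y j k -
        nablaPsiIm (ρ y) (-jVec η y) (jIdx x) j k + nablaPsiIm (ρ j) (-jVec η j) (jIdx x) y k -
        nablaPsiIm (ρ k) (-jVec η k) (jIdx x) y j + 3 * (η (jIdx x) * psiImInt y j k -
        η y * psiImInt (jIdx x) j k + η j * psiImInt (jIdx x) y k -
        η k * psiImInt (jIdx x) y j)) * (kahlerInt j k : ℝ)) := by
  rw [sum_sum_psiImInt, sum_sum_kahlerInt, sum_sum_kahlerInt]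
  fin_cases x <;> fin_cases y <;>
    simp [nablaPsiRe, nablaPsiIm, nablaOmega, jVec, jSgn, jIdx, kahlerInt, psiReInt, psiImInt,
      leviCivita₃, zIdx, zPow] <;>
    ring

end Components

/-! ### Component identities for d^*ω and for the contractions of dψ±. -/

section FormComponents

/-- The components of `d^*ω`. -/
def codiffComp (ρ : Fin 6 → Fin 6 → ℝ) (v : Fin 6) : ℝ := -∑ i, nablaOmega (ρ i) i v

/-- The components of `dψ₊`. -/
def dPsiRe (ρ : Fin 6 → Fin 6 → ℝ) (η : Fin 6 → ℝ) (x y j k : Fin 6) : ℝ :=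
  nablaPsiRe (ρ x) (-jVec η x) y j k - nablaPsiRe (ρ y) (-jVec η y) x j k +
    nablaPsiRe (ρ j) (-jVec η j) x y k - nablaPsiRe (ρ k) (-jVec η k) x y j

/-- The components of `dψ₋`. -/
def dPsiIm (ρ : Fin 6 → Fin 6 → ℝ) (η : Fin 6 → ℝ) (x y j k : Fin 6) : ℝ :=
  nablaPsiIm (ρ x) (-jVec η x) y j k - nablaPsiIm (ρ y) (-jVec η y) x j k +
    nablaPsiIm (ρ j) (-jVec η j) x y k - nablaPsiIm (ρ k) (-jVec η k) x y j

/-- The components of `dω`. -/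
def dOmega (ρ : Fin 6 → Fin 6 → ℝ) (x j k : Fin 6) : ℝ :=
  nablaOmega (ρ x) j k - nablaOmega (ρ j) x k + nablaOmega (ρ k) x j

/-- The contraction of a three-form with `ψ₊`. -/
def contrRe (F : Fin 6 → Fin 6 → Fin 6 → ℝ) : ℝ := F 0 1 2 - F 0 4 5 - F 3 1 5 - F 3 4 2

/-- The contraction of a three-form with `ψ₋`. -/
def contrIm (F : Fin 6 → Fin 6 → Fin 6 → ℝ) : ℝ := F 3 1 2 + F 0 4 2 + F 0 1 5 - F 3 4 5

/-- The η-part of dψ₊ is −3η ∧ ψ₊, and ⟨v ⌟ (η ∧ ψ₊), ψ₊⟩ = (|ψ₊|² − 2)η(v) = (4 − 2)η(v), whence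
the coefficient 6. The ρ-part yields I d^*ω, which is −d^*ω∘J. -/
theorem six_mul_add_eq_contrRe (ρ : Fin 6 → Fin 6 → ℝ) (η : Fin 6 → ℝ) (v : Fin 6) :
    6 * η v - (jSgn v : ℝ) * codiffComp ρ (jIdx v) = -contrRe (dPsiRe ρ η v) := by
  fin_cases v <;>
    simp [codiffComp, contrRe, dPsiRe, nablaPsiRe, nablaOmega, jVec, jSgn, jIdx, kahlerInt,
      psiImInt, leviCivita₃, zIdx, zPow, Fin.sum_univ_six] <;>
    ring

theorem six_mul_add_eq_contrIm (ρ : Fin 6 → Fin 6 → ℝ) (η : Fin 6 → ℝ) (v : Fin 6) :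
    6 * η v - (jSgn v : ℝ) * codiffComp ρ (jIdx v) = -contrIm (dPsiIm ρ η v) := by
  fin_cases v <;>
    simp [codiffComp, contrIm, dPsiIm, nablaPsiIm, nablaOmega, jVec, jSgn, jIdx, kahlerInt,
      psiReInt, leviCivita₃, zIdx, zPow, Fin.sum_univ_six] <;>
    ring

theorem six_mul_add_eq_contrIm_dPsiRe (ρ : Fin 6 → Fin 6 → ℝ) (η : Fin 6 → ℝ) (v : Fin 6) :
    6 * η v - (jSgn v : ℝ) * codiffComp ρ (jIdx v) =
      -(jSgn v : ℝ) * contrIm (dPsiRe ρ η (jIdx v)) := by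
  fin_cases v <;>
    simp [codiffComp, contrIm, dPsiRe, nablaPsiRe, nablaOmega, jVec, jSgn, jIdx, kahlerInt,
      psiImInt, leviCivita₃, zIdx, zPow, Fin.sum_univ_six] <;>
    ring

theorem six_mul_add_eq_contrRe_dPsiIm (ρ : Fin 6 → Fin 6 → ℝ) (η : Fin 6 → ℝ) (v : Fin 6) :
    6 * η v - (jSgn v : ℝ) * codiffComp ρ (jIdx v) =
      (jSgn v : ℝ) * contrRe (dPsiIm ρ η (jIdx v)) := by
  fin_cases v <;>
    simp [codiffComp, contrRe, dPsiIm, nablaPsiIm, nablaOmega, jVec, jSgn, jIdx, kahlerInt,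
      psiReInt, leviCivita₃, zIdx, zPow, Fin.sum_univ_six] <;>
    ring

/-- Each ∇_X ω is J-anti-invariant. Hence its own contraction with ω vanishes, and in the
contraction of dω with ω the two remaining terms are equal traces, each half of the result. -/
theorem codiffComp_eq (ρ : Fin 6 → Fin 6 → ℝ) (v : Fin 6) :
    codiffComp ρ v = -((1 / 2) * ∑ l, ∑ m, (jSgn v : ℝ) * dOmega ρ (jIdx v) l m *
      (kahlerInt l m : ℝ)) := by
  rw [sum_sum_kahlerInt (fun l m ↦ (jSgn v : ℝ) * dOmega ρ (jIdx v) l m)]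
  fin_cases v <;>
    simp [codiffComp, dOmega, nablaOmega, jSgn, jIdx, Fin.sum_univ_six] <;>
    ring

/-- The full contraction of an alternating function with the components of `ψ₊`. -/
theorem sum_mul_psiReInt_of_alternating (F : Fin 6 → Fin 6 → Fin 6 → ℝ)
    (h₀₁ : ∀ i j k, F j i k = -F i j k) (h₁₂ : ∀ i j k, F i k j = -F i j k) :
    ∑ i, ∑ j, ∑ k, F i j k * (psiReInt i j k : ℝ) = 6 * contrRe F := by
  simp [Fin.sum_univ_six, psiReInt, leviCivita₃, zIdx, zPow, contrRe]
  linarith [h₀₁ 0 1 2, h₁₂ 0 1 2, h₀₁ 0 2 1, h₁₂ 1 0 2, h₁₂ 2 0 1,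
    h₀₁ 0 4 5, h₁₂ 0 4 5, h₀₁ 0 5 4, h₁₂ 4 0 5, h₁₂ 5 0 4,
    h₀₁ 3 1 5, h₁₂ 3 1 5, h₀₁ 3 5 1, h₁₂ 1 3 5, h₁₂ 5 3 1,
    h₀₁ 3 4 2, h₁₂ 3 4 2, h₀₁ 3 2 4, h₁₂ 4 3 2, h₁₂ 2 3 4]

/-- The full contraction of an alternating function with the components of `ψ₋`. -/
theorem sum_mul_psiImInt_of_alternating (F : Fin 6 → Fin 6 → Fin 6 → ℝ)
    (h₀₁ : ∀ i j k, F j i k = -F i j k) (h₁₂ : ∀ i j k, F i k j = -F i j k) :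
    ∑ i, ∑ j, ∑ k, F i j k * (psiImInt i j k : ℝ) = 6 * contrIm F := by
  simp [Fin.sum_univ_six, psiImInt, leviCivita₃, zIdx, zPow, contrIm]
  linarith [h₀₁ 3 1 2, h₁₂ 3 1 2, h₀₁ 3 2 1, h₁₂ 1 3 2, h₁₂ 2 3 1,
    h₀₁ 0 4 2, h₁₂ 0 4 2, h₀₁ 0 2 4, h₁₂ 4 0 2, h₁₂ 2 0 4,
    h₀₁ 0 1 5, h₁₂ 0 1 5, h₀₁ 0 5 1, h₁₂ 1 0 5, h₁₂ 5 0 1,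
    h₀₁ 3 4 5, h₁₂ 3 4 5, h₀₁ 3 5 4, h₁₂ 4 3 5, h₁₂ 5 3 4]

end FormComponents

/-! ### Sums over pairs and triples of indices. -/

section TupleSums

theorem sum_fin_two_tuple {ι : Type*} [Fintype ι] (G : (Fin 2 → ι) → ℝ) :
    ∑ f, G f = ∑ i, ∑ j, G ![i, j] := by
  rw [← (finTwoArrowEquiv ι).symm.sum_comp, Fintype.sum_prod_type]
  rfl

theorem sum_fin_three_tuple {ι : Type*} [Fintype ι] (G : (Fin 3 → ι) → ℝ) :
    ∑ f, G f = ∑ i, ∑ j, ∑ k, G ![i, j, k] := by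
  rw [← (Fin.consEquiv (n := 2) fun _ ↦ ι).sum_comp, Fintype.sum_prod_type]
  refine Finset.sum_congr rfl fun i _ ↦ ?_
  rw [sum_fin_two_tuple]
  rfl

end TupleSums

/-! ### The star of δ ∧ ω for a three-form δ. -/

section StarWedgeKahler

/-- The inverse of a permutation of `Fin 6` given by its values. -/
def tupleInv (f : Fin 6 → Fin 6) (j : Fin 6) : Fin 6 :=
  if f 0 = j then 0 else if f 1 = j then 1 else if f 2 = j then 2 else if f 3 = j then 3
  else if f 4 = j then 4 else 5

variable {V : Type*} [NormedAddCommGroup V] [InnerProductSpace ℝ V]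

theorem alternatingMap_tuple_eq (e : Fin 6 → V) (vol : V [⋀^Fin 6]→ₗ[ℝ] ℝ) (f : Fin 6 → Fin 6)
    (h₁ : Function.LeftInverse (tupleInv f) f) (h₂ : Function.RightInverse (tupleInv f) f)
    (hs : Equiv.Perm.sign (⟨f, tupleInv f, h₁, h₂⟩ : Equiv.Perm (Fin 6)) = 1) :
    vol (fun i ↦ e (f i)) = vol e := by
  have := alternatingMap_comp_perm vol e ⟨f, tupleInv f, h₁, h₂⟩
  rw [hs] at this
  simpa using this

/-- Once `w` is fixed, `vol` sees only the 3! orderings of the complementary triple `g`. The signs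
from `δ` and `vol` cancel, and the evenness of `g` followed by `w` fixes the overall sign. -/
theorem sum_append_tuple (e : Fin 6 → V) (vol : V [⋀^Fin 6]→ₗ[ℝ] ℝ) (δ : V [⋀^Fin 3]→ₗ[ℝ] ℝ)
    (g w : Fin 3 → Fin 6)
    (h₁ : Function.LeftInverse (tupleInv (Fin.append (n := 3) g w)) (Fin.append (n := 3) g w))
    (h₂ : Function.RightInverse (tupleInv (Fin.append (n := 3) g w)) (Fin.append (n := 3) g w))
    (hs : Equiv.Perm.sign
      (⟨Fin.append (n := 3) g w, tupleInv (Fin.append (n := 3) g w), h₁, h₂⟩ :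
        Equiv.Perm (Fin 6)) = 1) :
    ∑ u : Fin 3 → Fin 6, δ (fun i ↦ e (u i)) *
      vol (fun m ↦ Fin.append (n := 3) (fun i ↦ e (u i)) (fun i ↦ e (w i)) m) =
      6 * (δ (fun i ↦ e (g i)) * vol e) := by
  have hinj : Function.Injective (Fin.append (n := 3) g w) := h₁.injective
  obtain ⟨hg, hw, hgw⟩ := Fin.append_injective_iff.mp hinj
  have hsurj : Function.Surjective (Fin.append (n := 3) g w) := h₂.surjective
  rw [sum_tuple_eq_factorial_mul _ g hg]
  · have := alternatingMap_tuple_eq e vol _ h₁ h₂ hs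
    have h3 : (fun m ↦ Fin.append (n := 3) (fun i ↦ e (g i)) (fun i ↦ e (w i)) m) =
        fun i ↦ e (Fin.append (n := 3) g w i) := by
      funext m
      refine Fin.addCases (m := 3) (n := 3) (fun i ↦ ?_) (fun i ↦ ?_) m
      · rw [Fin.append_left, Fin.append_left]
      · rw [Fin.append_right, Fin.append_right]
    rw [h3, this]
    simp [Nat.factorial]
  · intro σ
    have h4 := alternatingMap_append_perm (k := 3) (l := 3) rfl vol (fun i ↦ e (g i))
      (fun i ↦ e (w i)) σ
    have h5 := alternatingMap_comp_perm δ (fun i ↦ e (g i)) σ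
    have h6 : (vol fun m ↦ Fin.append (n := 3) (fun i ↦ e ((g ∘ σ) i)) (fun i ↦ e (w i)) m) = _ := h4
    have h7 : (δ fun i ↦ e ((g ∘ σ) i)) = _ := h5
    rw [h6, h7]
    exact mul_mul_mul_sign _ _ _ (sign_mul_sign_real σ)
  · intro u hu
    have h8 := alternatingMap_append_eq_zero (k := 3) (l := 3) rfl vol e u w (by
      rintro ⟨hui, hur⟩
      refine hu (exists_perm_of_injective hui fun i ↦ ?_)
      obtain ⟨m, hm⟩ := hsurj (u i)
      revert hm
      refine Fin.addCases (m := 3) (n := 3) (fun j ↦ ?_) (fun j ↦ ?_) m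
      · rw [Fin.append_left]
        exact fun h ↦ ⟨j, h⟩
      · rw [Fin.append_right]
        exact fun h ↦ absurd ⟨j, h⟩ (hur i))
    have h9 : (vol fun m ↦ Fin.append (n := 3) (fun i ↦ e (u i)) (fun i ↦ e (w i)) m) = 0 := h8
    rw [h9, mul_zero]

theorem sum_append_tuple_eq_zero (e : Fin 6 → V) (vol : V [⋀^Fin 6]→ₗ[ℝ] ℝ)
    (δ : V [⋀^Fin 3]→ₗ[ℝ] ℝ) (w : Fin 3 → Fin 6) (hw : ¬ Function.Injective w) :
    ∑ u : Fin 3 → Fin 6, δ (fun i ↦ e (u i)) *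
      vol (fun m ↦ Fin.append (n := 3) (fun i ↦ e (u i)) (fun i ↦ e (w i)) m) = 0 := by
  refine Finset.sum_eq_zero fun u _ ↦ ?_
  rw [vol.map_eq_zero_of_not_injective, mul_zero]
  intro hinj
  refine hw fun i j hij ↦ ?_
  have := @hinj (Fin.natAdd 3 i) (Fin.natAdd 3 j) (by
    change Fin.append (n := 3) _ _ (Fin.natAdd 3 i) = Fin.append (n := 3) _ _ (Fin.natAdd 3 j)
    rw [Fin.append_right, Fin.append_right, hij])
  simpa [Fin.ext_iff] using this

/-- For a three-form `δ`, `⋆(δ ∧ ω) = ⟨J · ⌟ δ, ω⟩` on an adapted basis. -/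
theorem hodgeStar_wedge_kahler {J : V →L[ℝ] V} {Ψ : V [⋀^Fin 3]→L[ℝ] ℂ}
    {b : OrthonormalBasis (Fin 6) ℝ V} (h : IsAdaptedBasis J Ψ b) (vol : V [⋀^Fin 6]→ₗ[ℝ] ℝ)
    (hvol : vol b = 1) (δ : V [⋀^Fin 3]→ₗ[ℝ] ℝ) (m : Fin 6) (v : Fin 1 → V) (hv : v 0 = b m) :
    hodgeStar b vol (k := 5) (l := 1) rfl (wedge δ (omegaAlt h.toIsComplexVolume)) v =
      (1 / 2) * ∑ i, ∑ j, (jSgn m : ℝ) * δ ![b (jIdx m), b i, b j] * (kahlerInt i j : ℝ) := by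
  refine (hodgeStar_wedge b vol (p := 3) (q := 2) (l := 1) rfl δ _ v).trans ?_
  rw [← (Fin.appendEquiv 3 2).sum_comp, Fintype.sum_prod_type, Finset.sum_comm]
  have h1 : ∀ p : Fin 2 → Fin 6, ∑ u : Fin 3 → Fin 6,
      δ (fun i ↦ b ((Fin.appendEquiv 3 2 (u, p)) (Fin.castAdd 2 i))) *
        omegaAlt h.toIsComplexVolume (fun j ↦ b ((Fin.appendEquiv 3 2 (u, p)) (Fin.natAdd 3 j))) *
        vol (fun m ↦ Fin.append (fun i ↦ b ((Fin.appendEquiv 3 2 (u, p)) i)) v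
          (Fin.cast (rfl : 6 = 3 + 2 + 1) m)) =
      (∑ u : Fin 3 → Fin 6, δ (fun i ↦ b (u i)) *
        vol (fun n ↦ Fin.append (n := 3) (fun i ↦ b (u i))
          (fun i ↦ b ((![p 0, p 1, m] : Fin 3 → Fin 6) i)) n)) * (kahlerInt (p 0) (p 1) : ℝ) := by
    intro p
    rw [Finset.sum_mul]
    refine Finset.sum_congr rfl fun u _ ↦ ?_
    have h3 : vol (fun m ↦ Fin.append (fun i ↦ b ((Fin.appendEquiv 3 2 (u, p)) i)) v
          (Fin.cast (rfl : 6 = 3 + 2 + 1) m)) =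
        vol (fun n ↦ Fin.append (n := 3) (fun i ↦ b (u i))
          (fun i ↦ b ((![p 0, p 1, m] : Fin 3 → Fin 6) i)) n) := by
      congr 1
      funext n
      fin_cases n <;> first | rfl | exact hv
    rw [h3]
    simp only [Fin.appendEquiv_apply, Fin.append_left, Fin.append_right, omegaAlt_apply, h.inner_J]
    ring
  rw [Finset.sum_congr rfl fun p _ ↦ h1 p, sum_fin_two_tuple]
  simp only [Matrix.cons_val_zero, Matrix.cons_val_one]
  rw [sum_sum_kahlerInt (fun i j ↦ ∑ u : Fin 3 → Fin 6, δ (fun i ↦ b (u i)) *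
        vol (fun n ↦ Fin.append (n := 3) (fun i ↦ b (u i))
          (fun l ↦ b ((![i, j, m] : Fin 3 → Fin 6) l)) n)),
    sum_sum_kahlerInt (fun i j ↦ (jSgn m : ℝ) * δ ![b (jIdx m), b i, b j])]
  have key : ∀ g w : Fin 3 → Fin 6, ∀ h₁ h₂,
      Equiv.Perm.sign (⟨Fin.append (n := 3) g w, tupleInv (Fin.append (n := 3) g w), h₁, h₂⟩ :
        Equiv.Perm (Fin 6)) = 1 →
      ∑ u : Fin 3 → Fin 6, δ (fun i ↦ b (u i)) *
        vol (fun m ↦ Fin.append (n := 3) (fun i ↦ b (u i)) (fun i ↦ b (w i)) m) =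
      6 * δ ![b (g 0), b (g 1), b (g 2)] := by
    intro g w h₁ h₂ hs
    rw [sum_append_tuple b vol δ g w h₁ h₂ hs, hvol, mul_one]
    congr 2
    funext i
    fin_cases i <;> rfl
  have hswap : ∀ i j : Fin 6, ∑ u : Fin 3 → Fin 6, δ (fun i ↦ b (u i)) *
        vol (fun n ↦ Fin.append (n := 3) (fun i ↦ b (u i))
          (fun l ↦ b ((![i, j, m] : Fin 3 → Fin 6) l)) n) =
      -∑ u : Fin 3 → Fin 6, δ (fun i ↦ b (u i)) *
        vol (fun n ↦ Fin.append (n := 3) (fun i ↦ b (u i))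
          (fun l ↦ b ((![j, i, m] : Fin 3 → Fin 6) l)) n) := by
    intro i j
    rw [← Finset.sum_neg_distrib]
    refine Finset.sum_congr rfl fun u _ ↦ ?_
    have h3 := alternatingMap_append_perm_right (k := 3) (l := 3) rfl vol (fun i ↦ b (u i))
      (fun l ↦ b ((![j, i, m] : Fin 3 → Fin 6) l)) (Equiv.swap 0 1)
    have h4 : (fun l ↦ b ((![j, i, m] : Fin 3 → Fin 6) (Equiv.swap (0 : Fin 3) 1 l))) =
        fun l ↦ b ((![i, j, m] : Fin 3 → Fin 6) l) := by
      funext l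
      fin_cases l <;> rfl
    rw [h4, Equiv.Perm.sign_swap (by decide)] at h3
    simp only [Fin.cast_eq_self] at h3
    rw [h3]
    simp
  have hδ : ∀ x y z : V, δ ![x, z, y] = -δ ![x, y, z] := by
    intro x y z
    have h5 := δ.map_swap ![x, y, z] (i := 1) (j := 2) (by decide)
    have h6 : ![x, y, z] ∘ ⇑(Equiv.swap (1 : Fin 3) 2) = ![x, z, y] := by
      funext i; fin_cases i <;> rfl
    rwa [h6] at h5
  have hδ' : ∀ x y z : V, δ ![y, x, z] = -δ ![x, y, z] := by
    intro x y z
    have h5 := δ.map_swap ![x, y, z] (i := 0) (j := 1) (by decide)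
    have h6 : ![x, y, z] ∘ ⇑(Equiv.swap (0 : Fin 3) 1) = ![y, x, z] := by
      funext i; fin_cases i <;> rfl
    rwa [h6] at h5
  have hz : ∀ x y : V, δ ![x, x, y] = 0 := fun x y ↦ self_eq_neg.mp (hδ' x x y)
  have hz' : ∀ x y : V, δ ![x, y, x] = 0 := fun x y ↦ by rw [hδ, hz, neg_zero]
  have cyc : ∀ x y z : V, δ ![x, y, z] = δ ![z, x, y] := fun x y z ↦ by
    rw [hδ, hδ', neg_neg, hδ, hδ, neg_neg]
  rw [hswap 3 0, hswap 4 1, hswap 5 2, hδ _ (b 0) (b 3), hδ _ (b 1) (b 4), hδ _ (b 2) (b 5)]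
  simp only [Nat.factorial]
  -- The J-pair containing m repeats an argument of `vol` and drops out. Each of the other two pairs
  -- leaves one complementary triple, listed in an order that makes the whole permutation even.
  fin_cases m <;> simp only [Fin.reduceFinMk, Fin.zero_eta, Fin.mk_one, jSgn, jIdx, Matrix.cons_val]
  · rw [key ![2, 5, 3] ![1, 4, 0] (by decide) (by decide) (by decide +kernel),
      key ![1, 4, 3] ![2, 5, 0] (by decide) (by decide) (by decide +kernel),
      sum_append_tuple_eq_zero b vol δ ![0, 3, 0] (by decide)]
    simp only [Matrix.cons_val]
    rw [cyc (b 2), cyc (b 1), hz']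
    push_cast
    ring
  · rw [key ![2, 5, 4] ![0, 3, 1] (by decide) (by decide) (by decide +kernel),
      key ![0, 3, 4] ![2, 5, 1] (by decide) (by decide) (by decide +kernel),
      sum_append_tuple_eq_zero b vol δ ![1, 4, 1] (by decide)]
    simp only [Matrix.cons_val]
    rw [cyc (b 2), cyc (b 0), hz']
    push_cast
    ring
  · rw [key ![1, 4, 5] ![0, 3, 2] (by decide) (by decide) (by decide +kernel),
      key ![0, 3, 5] ![1, 4, 2] (by decide) (by decide) (by decide +kernel),
      sum_append_tuple_eq_zero b vol δ ![2, 5, 2] (by decide)]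
    simp only [Matrix.cons_val]
    rw [cyc (b 1), cyc (b 0), hz']
    push_cast
    ring
  · rw [key ![5, 2, 0] ![1, 4, 3] (by decide) (by decide) (by decide +kernel),
      key ![4, 1, 0] ![2, 5, 3] (by decide) (by decide) (by decide +kernel),
      sum_append_tuple_eq_zero b vol δ ![0, 3, 3] (by decide)]
    simp only [Matrix.cons_val]
    rw [cyc (b 5), cyc (b 4), hz]
    push_cast
    rw [hδ _ (b 2) (b 5), hδ _ (b 1) (b 4)]
    ring
  · rw [key ![5, 2, 1] ![0, 3, 4] (by decide) (by decide) (by decide +kernel),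
      key ![3, 0, 1] ![2, 5, 4] (by decide) (by decide) (by decide +kernel),
      sum_append_tuple_eq_zero b vol δ ![1, 4, 4] (by decide)]
    simp only [Matrix.cons_val]
    rw [cyc (b 5), cyc (b 3), hz]
    push_cast
    rw [hδ _ (b 2) (b 5), hδ _ (b 0) (b 3)]
    ring
  · rw [key ![4, 1, 2] ![0, 3, 5] (by decide) (by decide) (by decide +kernel),
      key ![3, 0, 2] ![1, 4, 5] (by decide) (by decide) (by decide +kernel),
      sum_append_tuple_eq_zero b vol δ ![2, 5, 5] (by decide)]
    simp only [Matrix.cons_val]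
    rw [cyc (b 4), cyc (b 3), hz]
    push_cast
    rw [hδ _ (b 1) (b 4), hδ _ (b 0) (b 3)]
    ring

end StarWedgeKahler

/-! ### The exterior product of a one-form and a three-form. -/

section WedgeOneThree

/-- A permutation of four indices is split into its value p at 0, which selects the argument of `η`,
and a permutation of the rest. The latter is absorbed by `α`, and its 3! choices cancel the
normalisation. -/
theorem wedge_one_three {V : Type*} [AddCommGroup V] [Module ℝ V] (η : (Fin 1 → V) → ℝ)
    (α : V [⋀^Fin 3]→ₗ[ℝ] ℝ) (x y z w : V) :
    wedge η α ![x, y, z, w] = η ![x] * α ![y, z, w] - η ![y] * α ![x, z, w] +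
      η ![z] * α ![x, y, w] - η ![w] * α ![x, y, z] := by
  have key : ∀ p : Fin 4, ∑ τ : Equiv.Perm (Fin 3),
      ((Equiv.Perm.sign (Equiv.Perm.decomposeFin.symm (p, τ)) : ℤ) : ℝ) *
        η (fun _ ↦ ![x, y, z, w] p) *
        α (fun j ↦ ![x, y, z, w] (Equiv.swap 0 p (τ j).succ)) =
      6 * ((if p = 0 then 1 else -1) * η (fun _ ↦ ![x, y, z, w] p) *
        α (fun j ↦ ![x, y, z, w] (Equiv.swap 0 p j.succ))) := by
    intro p
    have h1 : ∀ τ : Equiv.Perm (Fin 3),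
      ((Equiv.Perm.sign (Equiv.Perm.decomposeFin.symm (p, τ)) : ℤ) : ℝ) *
        η (fun _ ↦ ![x, y, z, w] p) *
        α (fun j ↦ ![x, y, z, w] (Equiv.swap 0 p (τ j).succ)) =
      (if p = 0 then 1 else -1) * η (fun _ ↦ ![x, y, z, w] p) *
        α (fun j ↦ ![x, y, z, w] (Equiv.swap 0 p j.succ)) := by
      intro τ
      rw [alternatingMap_comp_perm α (fun j ↦ ![x, y, z, w] (Equiv.swap 0 p j.succ)) τ,
        Equiv.Perm.decomposeFin.symm_sign]
      have := sign_mul_sign_real τ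
      generalize η (fun _ ↦ ![x, y, z, w] p) = a
      generalize α (fun j ↦ ![x, y, z, w] (Equiv.swap 0 p j.succ)) = c
      split_ifs
      · push_cast
        linear_combination a * c * this
      · push_cast
        linear_combination -a * c * this
    rw [Finset.sum_congr rfl fun τ _ ↦ h1 τ]
    simp [Fintype.card_perm, Nat.factorial]
  have h2 : ∑ σ : Equiv.Perm (Fin 4), ((Equiv.Perm.sign σ : ℤ) : ℝ) *
      η (fun i ↦ ![x, y, z, w] (σ (Fin.castAdd 3 i))) *
      α (fun j ↦ ![x, y, z, w] (σ (Fin.natAdd 1 j))) =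
      ∑ p : Fin 4, ∑ τ : Equiv.Perm (Fin 3),
      ((Equiv.Perm.sign (Equiv.Perm.decomposeFin.symm (p, τ)) : ℤ) : ℝ) *
        η (fun _ ↦ ![x, y, z, w] p) *
        α (fun j ↦ ![x, y, z, w] (Equiv.swap 0 p (τ j).succ)) := by
    rw [← (Equiv.Perm.decomposeFin (n := 3)).symm.sum_comp, Fintype.sum_prod_type]
    refine Finset.sum_congr rfl fun p _ ↦ Finset.sum_congr rfl fun τ _ ↦ ?_
    have h3 : ∀ i : Fin 1, Equiv.Perm.decomposeFin.symm (p, τ) (Fin.castAdd 3 i) = p := by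
      intro i
      have : Fin.castAdd 3 i = (0 : Fin 4) := by fin_cases i; rfl
      rw [this, Equiv.Perm.decomposeFin_symm_apply_zero]
    have h4 : ∀ j : Fin 3, Equiv.Perm.decomposeFin.symm (p, τ) (Fin.natAdd 1 j) =
        Equiv.swap 0 p (τ j).succ := by
      intro j
      have : Fin.natAdd 1 j = j.succ := by fin_cases j <;> rfl
      rw [this, Equiv.Perm.decomposeFin_symm_apply_succ]
    simp only [h3, h4]
  have ev : ∀ p : Fin 4, (fun j : Fin 3 ↦ ![x, y, z, w] (Equiv.swap 0 p j.succ)) =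
      ![![x, y, z, w] (Equiv.swap 0 p 1), ![x, y, z, w] (Equiv.swap 0 p 2),
        ![x, y, z, w] (Equiv.swap 0 p 3)] := by
    intro p
    funext j
    fin_cases j <;> rfl
  have eη : ∀ u : V, (fun _ : Fin 1 ↦ u) = ![u] := fun u ↦ by
    funext j; fin_cases j; rfl
  have hα : ∀ x y z : V, α ![x, z, y] = -α ![x, y, z] := by
    intro x y z
    have h5 := α.map_swap ![x, y, z] (i := 1) (j := 2) (by decide)
    have h6 : ![x, y, z] ∘ ⇑(Equiv.swap (1 : Fin 3) 2) = ![x, z, y] := by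
      funext i; fin_cases i <;> rfl
    rwa [h6] at h5
  have hα' : ∀ x y z : V, α ![y, x, z] = -α ![x, y, z] := by
    intro x y z
    have h5 := α.map_swap ![x, y, z] (i := 0) (j := 1) (by decide)
    have h6 : ![x, y, z] ∘ ⇑(Equiv.swap (0 : Fin 3) 1) = ![y, x, z] := by
      funext i; fin_cases i <;> rfl
    rwa [h6] at h5
  -- For p > 0 the transposition puts x in the p-th place; bringing it to the front costs p − 1
  -- transpositions, which turns the uniform sign −1 into the alternating one.
  have s1 : α (fun j ↦ ![x, y, z, w] (Equiv.swap 0 0 j.succ)) = α ![y, z, w] := by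
    rw [ev]; rfl
  have s2 : α (fun j ↦ ![x, y, z, w] (Equiv.swap 0 1 j.succ)) = α ![x, z, w] := by
    rw [ev]; rfl
  have s3 : α (fun j ↦ ![x, y, z, w] (Equiv.swap 0 2 j.succ)) = -α ![x, y, w] := by
    rw [ev, ← hα']; rfl
  have s4 : α (fun j ↦ ![x, y, z, w] (Equiv.swap 0 3 j.succ)) = α ![x, y, z] := by
    have : α ![x, y, z] = α ![y, z, x] := by rw [hα y x z, hα' x y z, neg_neg]
    rw [ev, this]; rfl
  simp only [wedge]
  rw [h2, Finset.sum_congr rfl fun p _ ↦ key p, ← Finset.mul_sum]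
  rw [Fin.sum_univ_four, s1, s2, s3, s4]
  simp [eη, Nat.factorial]
  ring

end WedgeOneThree

/-! ### The action of N·J + ξ on ω and Ψ in components. -/

section TorsionComponents

variable {V : Type*} [NormedAddCommGroup V] [InnerProductSpace ℝ V]

theorem threeForm_sum₀ {ι : Type*} (s : Finset ι) (Ψ : V [⋀^Fin 3]→L[ℝ] ℂ) (c : ι → ℝ) (u : ι → V)
    (v w : V) : Ψ ![∑ m ∈ s, c m • u m, v, w] = ∑ m ∈ s, c m * Ψ ![u m, v, w] := by
  let L : V →ₗ[ℝ] ℂ :=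
    { toFun := fun x ↦ Ψ ![x, v, w]
      map_add' := fun x y ↦ threeForm_add₀ Ψ x y v w
      map_smul' := fun c x ↦ by rw [threeForm_smul₀]; rfl }
  have : L (∑ m ∈ s, c m • u m) = ∑ m ∈ s, c m • L (u m) := by simp
  simp only [Complex.real_smul] at this
  exact this

theorem threeForm_sum₁ {ι : Type*} (s : Finset ι) (Ψ : V [⋀^Fin 3]→L[ℝ] ℂ) (c : ι → ℝ) (u : ι → V)
    (v w : V) : Ψ ![v, ∑ m ∈ s, c m • u m, w] = ∑ m ∈ s, c m * Ψ ![v, u m, w] := by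
  rw [threeForm_swap₀₁, threeForm_sum₀, ← Finset.sum_neg_distrib]
  exact Finset.sum_congr rfl fun m _ ↦ by rw [threeForm_swap₀₁ Ψ v]; ring

theorem threeForm_sum₂ {ι : Type*} (s : Finset ι) (Ψ : V [⋀^Fin 3]→L[ℝ] ℂ) (c : ι → ℝ) (u : ι → V)
    (v w : V) : Ψ ![v, w, ∑ m ∈ s, c m • u m] = ∑ m ∈ s, c m * Ψ ![v, w, u m] := by
  rw [threeForm_swap₁₂, threeForm_sum₁, ← Finset.sum_neg_distrib]
  exact Finset.sum_congr rfl fun m _ ↦ by rw [threeForm_swap₁₂ Ψ v w]; ring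

theorem threeForm_add₁ (Ψ : V [⋀^Fin 3]→L[ℝ] ℂ) (u u' v w : V) :
    Ψ ![v, u + u', w] = Ψ ![v, u, w] + Ψ ![v, u', w] := by
  rw [threeForm_swap₀₁, threeForm_add₀, threeForm_swap₀₁ Ψ v, threeForm_swap₀₁ Ψ v]; ring

theorem threeForm_add₂ (Ψ : V [⋀^Fin 3]→L[ℝ] ℂ) (u u' v w : V) :
    Ψ ![v, w, u + u'] = Ψ ![v, w, u] + Ψ ![v, w, u'] := by
  rw [threeForm_swap₁₂, threeForm_add₁, threeForm_swap₁₂ Ψ v w, threeForm_swap₁₂ Ψ v w]; ring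

theorem threeForm_smul₁ (Ψ : V [⋀^Fin 3]→L[ℝ] ℂ) (c : ℝ) (u v w : V) :
    Ψ ![v, c • u, w] = c * Ψ ![v, u, w] := by
  rw [threeForm_swap₀₁, threeForm_smul₀, threeForm_swap₀₁ Ψ v]; ring

theorem threeForm_smul₂ (Ψ : V [⋀^Fin 3]→L[ℝ] ℂ) (c : ℝ) (u v w : V) :
    Ψ ![v, w, c • u] = c * Ψ ![v, w, u] := by
  rw [threeForm_swap₁₂, threeForm_smul₁, threeForm_swap₁₂ Ψ v w]; ring

theorem derAlt_two (α : V [⋀^Fin 2]→ₗ[ℝ] ℝ) (A : V →ₗ[ℝ] V) (u v : V) :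
    derAlt α A ![u, v] = α ![A u, v] + α ![u, A v] := by
  rw [derAlt_apply, Fin.sum_univ_two]
  congr 2 <;> (funext i; fin_cases i <;> rfl)

theorem derAlt_three (α : V [⋀^Fin 3]→ₗ[ℝ] ℝ) (A : V →ₗ[ℝ] V) (u v w : V) :
    derAlt α A ![u, v, w] = α ![A u, v, w] + α ![u, A v, w] + α ![u, v, A w] := by
  have h0 : Function.update ![u, v, w] 0 (A u) = ![A u, v, w] := by funext i; fin_cases i <;> rfl
  have h1 : Function.update ![u, v, w] 1 (A v) = ![u, A v, w] := by funext i; fin_cases i <;> rfl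
  have h2 : Function.update ![u, v, w] 2 (A w) = ![u, v, A w] := by funext i; fin_cases i <;> rfl
  rw [derAlt_apply, Fin.sum_univ_three, ← h0, ← h1, ← h2]
  rfl

theorem extAlt_two (α : V [⋀^Fin 2]→ₗ[ℝ] ℝ) (A : V →ₗ[ℝ] V →ₗ[ℝ] V) (u v w : V) :
    extAlt α A ![u, v, w] = derAlt α (A u) ![v, w] - derAlt α (A v) ![u, w] +
      derAlt α (A w) ![u, v] := by
  rw [extAlt_apply, Fin.sum_univ_three]
  have h0 : Fin.removeNth 0 ![u, v, w] = ![v, w] := by funext i; fin_cases i <;> rfl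
  have h1 : Fin.removeNth 1 ![u, v, w] = ![u, w] := by funext i; fin_cases i <;> rfl
  have h2 : Fin.removeNth 2 ![u, v, w] = ![u, v] := by funext i; fin_cases i <;> rfl
  rw [h0, h1, h2]
  simp
  ring

theorem extAlt_three (α : V [⋀^Fin 3]→ₗ[ℝ] ℝ) (A : V →ₗ[ℝ] V →ₗ[ℝ] V) (u v w z : V) :
    extAlt α A ![u, v, w, z] = derAlt α (A u) ![v, w, z] - derAlt α (A v) ![u, w, z] +
      derAlt α (A w) ![u, v, z] - derAlt α (A z) ![u, v, w] := by
  rw [extAlt_apply, Fin.sum_univ_four]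
  have h0 : Fin.removeNth 0 ![u, v, w, z] = ![v, w, z] := by funext i; fin_cases i <;> rfl
  have h1 : Fin.removeNth 1 ![u, v, w, z] = ![u, w, z] := by funext i; fin_cases i <;> rfl
  have h2 : Fin.removeNth 2 ![u, v, w, z] = ![u, v, z] := by funext i; fin_cases i <;> rfl
  have h3 : Fin.removeNth 3 ![u, v, w, z] = ![u, v, w] := by funext i; fin_cases i <;> rfl
  rw [h0, h1, h2, h3]
  have e2 : ((-1 : ℝ)) ^ ((2 : Fin 4) : ℕ) = 1 := by norm_num
  have e3 : ((-1 : ℝ)) ^ ((3 : Fin 4) : ℕ) = -1 := by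
    rw [show ((3 : Fin 4) : ℕ) = 3 from rfl]; norm_num
  rw [e2, e3]
  simp
  ring

/-- Skew-symmetric endomorphisms anticommuting with `J`. -/
structure IsAntiHermitian (J : V →L[ℝ] V) (ξ : V →ₗ[ℝ] V) : Prop where
  skew : ∀ v w, ⟪ξ v, w⟫_ℝ = -⟪v, ξ w⟫_ℝ
  anti : ∀ v, ξ (J v) = -J (ξ v)

variable {J : V →L[ℝ] V} {Ψ : V [⋀^Fin 3]→L[ℝ] ℂ} {b : OrthonormalBasis (Fin 6) ℝ V}

theorem IsAdaptedBasis.exists_coeff (h : IsAdaptedBasis J Ψ b) {ξ : V →ₗ[ℝ] V}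
    (hξ : IsAntiHermitian J ξ) :
    ∃ ρ : Fin 6 → ℝ, ∀ m y, ⟪b m, ξ (b y)⟫_ℝ = -(1 / 2) * ∑ p, ρ p * (xiInt p m y : ℝ) := by
  refine exists_coeff_of_antiHermitian (fun m y ↦ ⟪b m, ξ (b y)⟫_ℝ) (fun m y ↦ ?_) fun m y ↦ ?_
  · rw [real_inner_comm, hξ.skew]
  · have h1 : ⟪b m, ξ (J (b y))⟫_ℝ = ⟪J (b m), ξ (b y)⟫_ℝ := by
      rw [hξ.anti, inner_neg_right, h.inner_right, neg_neg]
    rw [h.apply_J, h.apply_J, map_smul, real_inner_smul_left, real_inner_smul_right] at h1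
    exact h1

variable {ξ : V →ₗ[ℝ] V} {ρ : Fin 6 → ℝ}

theorem derAlt_omega_adapted (h : IsAdaptedBasis J Ψ b)
    (hρ : ∀ m y, ⟪b m, ξ (b y)⟫_ℝ = -(1 / 2) * ∑ p, ρ p * (xiInt p m y : ℝ)) (N : ℝ) (i j : Fin 6) :
    derAlt (omegaAlt h.toIsComplexVolume) (N • (J : V →ₗ[ℝ] V) + ξ) ![b i, b j] =
      nablaOmega ρ i j := by
  have hb : ∀ y, ξ (b y) = ∑ m, ⟪b m, ξ (b y)⟫_ℝ • b m := fun y ↦ (b.sum_repr' _).symm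
  rw [derAlt_two]
  simp only [omegaAlt_apply, Matrix.cons_val_zero, Matrix.cons_val_one, LinearMap.add_apply,
    LinearMap.smul_apply, ContinuousLinearMap.coe_coe, map_add, map_smul, inner_add_left,
    inner_add_right, real_inner_smul_left, real_inner_smul_right, h.orthogonal, h.sq,
    inner_neg_right]
  have h1 : ⟪ξ (b i), J (b j)⟫_ℝ = ∑ m, ⟪b m, ξ (b i)⟫_ℝ * kahlerInt m j := by
    conv_lhs => rw [hb i]
    rw [sum_inner]
    exact Finset.sum_congr rfl fun m _ ↦ by rw [real_inner_smul_left, h.inner_J]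
  have h2 : ⟪b i, J (ξ (b j))⟫_ℝ = ∑ m, ⟪b m, ξ (b j)⟫_ℝ * kahlerInt i m := by
    conv_lhs => rw [hb j]
    rw [map_sum, inner_sum]
    exact Finset.sum_congr rfl fun m _ ↦ by rw [map_smul, real_inner_smul_right, h.inner_J]
  rw [h1, h2, ← sum_mul_psiReInt]
  simp only [hρ]
  have h3 : ∀ p, (psiReInt p i j : ℝ) = -(1 / 2) * ∑ m, ((xiInt p m i : ℝ) * kahlerInt m j +
      xiInt p m j * kahlerInt i m) := by
    intro p
    have := congrArg (Int.cast : ℤ → ℝ) (sum_xiInt_kahler p i j)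
    push_cast at this
    rw [this]; ring
  simp only [h3, Finset.mul_sum, Finset.sum_mul, Finset.sum_add_distrib, mul_add]
  rw [Finset.sum_comm (f := fun p m ↦ ρ p * (-(1 / 2) * ((xiInt p m i : ℝ) * kahlerInt m j))),
    Finset.sum_comm (f := fun p m ↦ ρ p * (-(1 / 2) * ((xiInt p m j : ℝ) * kahlerInt i m)))]
  -- J annihilates ω, so the N-part contributes nothing.
  have h4 : N * ⟪b i, b j⟫_ℝ + N * -⟪b i, b j⟫_ℝ = 0 := by ring
  have e1 : ∀ x m, -(1 / 2) * (ρ x * (xiInt x m i : ℝ)) * kahlerInt m j =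
      ρ x * (-(1 / 2) * ((xiInt x m i : ℝ) * kahlerInt m j)) := fun x m ↦ by ring
  have e2 : ∀ x m, -(1 / 2) * (ρ x * (xiInt x m j : ℝ)) * kahlerInt i m =
      ρ x * (-(1 / 2) * ((xiInt x m j : ℝ) * kahlerInt i m)) := fun x m ↦ by ring
  simp only [e1, e2]
  linear_combination h4

/-- J acts on Ψ as 3i, one factor i per slot; this is the source of the 3N in `nablaPsiRe` and
`nablaPsiIm`. -/
theorem sum_Ψ_adapted (h : IsAdaptedBasis J Ψ b) (N : ℝ) (i j k : Fin 6) :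
    Ψ ![(N • (J : V →ₗ[ℝ] V) + ξ) (b i), b j, b k] +
      Ψ ![b i, (N • (J : V →ₗ[ℝ] V) + ξ) (b j), b k] +
      Ψ ![b i, b j, (N • (J : V →ₗ[ℝ] V) + ξ) (b k)] =
    3 * N * Complex.I * (psiReInt i j k + psiImInt i j k * Complex.I) +
      ∑ m, ((⟪b m, ξ (b i)⟫_ℝ : ℂ) * (psiReInt m j k + psiImInt m j k * Complex.I) +
        (⟪b m, ξ (b j)⟫_ℝ : ℂ) * (psiReInt i m k + psiImInt i m k * Complex.I) +
        (⟪b m, ξ (b k)⟫_ℝ : ℂ) * (psiReInt i j m + psiImInt i j m * Complex.I)) := by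
  have hb : ∀ y, ξ (b y) = ∑ m, ⟪b m, ξ (b y)⟫_ℝ • b m := fun y ↦ (b.sum_repr' _).symm
  have hA : ∀ v, (N • (J : V →ₗ[ℝ] V) + ξ) v = N • J v + ξ v := fun v ↦ rfl
  have h0 : Ψ ![ξ (b i), b j, b k] =
      ∑ m, (⟪b m, ξ (b i)⟫_ℝ : ℂ) * (psiReInt m j k + psiImInt m j k * Complex.I) := by
    conv_lhs => rw [hb i]
    rw [threeForm_sum₀]
    simp only [h.Ψ_apply]
  have h1 : Ψ ![b i, ξ (b j), b k] =
      ∑ m, (⟪b m, ξ (b j)⟫_ℝ : ℂ) * (psiReInt i m k + psiImInt i m k * Complex.I) := by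
    conv_lhs => rw [hb j]
    rw [threeForm_sum₁]
    simp only [h.Ψ_apply]
  have h2 : Ψ ![b i, b j, ξ (b k)] =
      ∑ m, (⟪b m, ξ (b k)⟫_ℝ : ℂ) * (psiReInt i j m + psiImInt i j m * Complex.I) := by
    conv_lhs => rw [hb k]
    rw [threeForm_sum₂]
    simp only [h.Ψ_apply]
  rw [hA, hA, hA, threeForm_add₀, threeForm_add₁, threeForm_add₂, threeForm_smul₀, threeForm_smul₁,
    threeForm_smul₂, h.complex, h.complex₁, h.complex₂, h.Ψ_apply, h0, h1, h2,
    Finset.sum_add_distrib, Finset.sum_add_distrib]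
  ring

theorem derAlt_psiRe_adapted (h : IsAdaptedBasis J Ψ b)
    (hρ : ∀ m y, ⟪b m, ξ (b y)⟫_ℝ = -(1 / 2) * ∑ p, ρ p * (xiInt p m y : ℝ)) (N : ℝ)
    (i j k : Fin 6) :
    derAlt (reAlt Ψ) (N • (J : V →ₗ[ℝ] V) + ξ) ![b i, b j, b k] = nablaPsiRe ρ N i j k := by
  rw [derAlt_three]
  simp only [reAlt_apply]
  rw [← Complex.add_re, ← Complex.add_re, sum_Ψ_adapted h]
  have h1 : ∀ p, ((if p = i then (kahlerInt j k : ℝ) else 0) + (if p = j then (kahlerInt k i : ℝ)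
      else 0) + (if p = k then (kahlerInt i j : ℝ) else 0)) = (1 / 2) *
      ∑ m, ((xiInt p m i : ℝ) * psiReInt m j k + xiInt p m j * psiReInt i m k +
      xiInt p m k * psiReInt i j m) := by
    intro p
    have := congrArg (Int.cast : ℤ → ℝ) (sum_xiInt_psiRe p i j k)
    push_cast at this
    rw [this]; ring
  have h2 : ∑ m, (⟪b m, ξ (b i)⟫_ℝ * (psiReInt m j k : ℝ) + ⟪b m, ξ (b j)⟫_ℝ * psiReInt i m k +
      ⟪b m, ξ (b k)⟫_ℝ * psiReInt i j m) =
      -(ρ i * kahlerInt j k + ρ j * kahlerInt k i + ρ k * kahlerInt i j) := by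
    calc _ = ∑ m, ∑ p, -(1 / 2) * ρ p * ((xiInt p m i : ℝ) * psiReInt m j k +
          xiInt p m j * psiReInt i m k + xiInt p m k * psiReInt i j m) := by
          refine Finset.sum_congr rfl fun m _ ↦ ?_
          simp only [hρ, Finset.mul_sum, Finset.sum_mul, ← Finset.sum_add_distrib]
          exact Finset.sum_congr rfl fun p _ ↦ by ring
      _ = ∑ p, -ρ p * ((if p = i then (kahlerInt j k : ℝ) else 0) +
            (if p = j then (kahlerInt k i : ℝ) else 0) +
            (if p = k then (kahlerInt i j : ℝ) else 0)) := by
          rw [Finset.sum_comm]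
          refine Finset.sum_congr rfl fun p _ ↦ ?_
          rw [h1, ← Finset.mul_sum]
          ring
      _ = _ := by
          simp only [mul_add, mul_ite, mul_zero, Finset.sum_add_distrib, Finset.sum_ite_eq',
            Finset.mem_univ, if_true]
          ring
  simp only [Complex.add_re, Complex.re_sum, Complex.mul_re, Complex.mul_im, Complex.ofReal_re,
    Complex.ofReal_im, Complex.intCast_re, Complex.intCast_im, Complex.I_re, Complex.I_im,
    Complex.add_im, Complex.re_ofNat, Complex.im_ofNat]
  rw [nablaPsiRe, ← h2]
  ring_nf

theorem derAlt_psiIm_adapted (h : IsAdaptedBasis J Ψ b)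
    (hρ : ∀ m y, ⟪b m, ξ (b y)⟫_ℝ = -(1 / 2) * ∑ p, ρ p * (xiInt p m y : ℝ)) (N : ℝ)
    (i j k : Fin 6) :
    derAlt (imAlt Ψ) (N • (J : V →ₗ[ℝ] V) + ξ) ![b i, b j, b k] = nablaPsiIm ρ N i j k := by
  rw [derAlt_three]
  simp only [imAlt_apply]
  rw [← Complex.add_im, ← Complex.add_im, sum_Ψ_adapted h]
  have h1 : ∀ p, ((kahlerInt p i : ℝ) * kahlerInt j k + kahlerInt p j * kahlerInt k i +
      kahlerInt p k * kahlerInt i j) = -(1 / 2) *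
      ∑ m, ((xiInt p m i : ℝ) * psiImInt m j k + xiInt p m j * psiImInt i m k +
      xiInt p m k * psiImInt i j m) := by
    intro p
    have := congrArg (Int.cast : ℤ → ℝ) (sum_xiInt_psiIm p i j k)
    push_cast at this
    rw [this]; ring
  have h2 : ∑ m, (⟪b m, ξ (b i)⟫_ℝ * (psiImInt m j k : ℝ) + ⟪b m, ξ (b j)⟫_ℝ * psiImInt i m k +
      ⟪b m, ξ (b k)⟫_ℝ * psiImInt i j m) =
      jVec ρ i * kahlerInt j k + jVec ρ j * kahlerInt k i + jVec ρ k * kahlerInt i j := by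
    calc _ = ∑ m, ∑ p, -(1 / 2) * ρ p * ((xiInt p m i : ℝ) * psiImInt m j k +
          xiInt p m j * psiImInt i m k + xiInt p m k * psiImInt i j m) := by
          refine Finset.sum_congr rfl fun m _ ↦ ?_
          simp only [hρ, Finset.mul_sum, Finset.sum_mul, ← Finset.sum_add_distrib]
          exact Finset.sum_congr rfl fun p _ ↦ by ring
      _ = ∑ p, ρ p * ((kahlerInt p i : ℝ) * kahlerInt j k + kahlerInt p j * kahlerInt k i +
            kahlerInt p k * kahlerInt i j) := by
          rw [Finset.sum_comm]
          refine Finset.sum_congr rfl fun p _ ↦ ?_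
          rw [h1, ← Finset.mul_sum]
          ring
      _ = _ := by
          simp only [← sum_mul_kahlerInt, Finset.sum_mul, ← Finset.sum_add_distrib]
          exact Finset.sum_congr rfl fun p _ ↦ by ring
  simp only [Complex.add_im, Complex.im_sum, Complex.mul_re, Complex.mul_im, Complex.ofReal_re,
    Complex.ofReal_im, Complex.intCast_re, Complex.intCast_im, Complex.I_re, Complex.I_im,
    Complex.add_re, Complex.re_ofNat, Complex.im_ofNat]
  rw [nablaPsiIm, ← h2]
  ring_nf

end TorsionComponents

/-! ### Scalar products of two-forms and three-forms as index sums. -/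

section FormInner

variable {V : Type*}

theorem formInner_two (e : Fin 6 → V) (α β : (Fin 2 → V) → ℝ) :
    formInner e α β = (1 / 2) * ∑ i, ∑ j, α ![e i, e j] * β ![e i, e j] := by
  rw [formInner, sum_fin_two_tuple]
  have h : ∀ i j : Fin 6, (fun l ↦ e (![i, j] l)) = ![e i, e j] := by
    intro i j; funext l; fin_cases l <;> rfl
  simp only [h]
  norm_num [Nat.factorial]

theorem formInner_three (e : Fin 6 → V) (α β : (Fin 3 → V) → ℝ) :
    formInner e α β = (1 / 6) * ∑ i, ∑ j, ∑ k, α ![e i, e j, e k] * β ![e i, e j, e k] := by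
  rw [formInner, sum_fin_three_tuple]
  have h : ∀ i j k : Fin 6, (fun l ↦ e (![i, j, k] l)) = ![e i, e j, e k] := by
    intro i j k; funext l; fin_cases l <;> rfl
  simp only [h]
  norm_num [Nat.factorial]

theorem formInner_comm {k : ℕ} (e : Fin 6 → V) (α β : (Fin k → V) → ℝ) :
    formInner e α β = formInner e β α := by
  simp only [formInner, mul_comm]

end FormInner

/-! ### Linearity and basis independence of the contractions in the theorem. -/

section Linearity

variable {V : Type*} [NormedAddCommGroup V] [InnerProductSpace ℝ V]

theorem OrthonormalBasis.sum_smul_eq {ι W : Type*} [Fintype ι] [AddCommGroup W] [Module ℝ W]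
    (e b : OrthonormalBasis ι ℝ V) (f : V →ₗ[ℝ] ℝ) (g : V →ₗ[ℝ] W) :
    ∑ i, f (e i) • g (e i) = ∑ i, f (b i) • g (b i) := by
  have h : ∀ i, f (e i) = ∑ j, ⟪b j, e i⟫_ℝ * f (b j) := fun i ↦ by
    conv_lhs => rw [← b.sum_repr' (e i)]
    simp
  simp only [h, Finset.sum_smul]
  rw [Finset.sum_comm]
  refine Finset.sum_congr rfl fun j _ ↦ ?_
  conv_rhs => arg 2; rw [← e.sum_repr' (b j)]
  rw [map_sum, Finset.smul_sum]
  refine Finset.sum_congr rfl fun i _ ↦ ?_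
  rw [map_smul, smul_smul, real_inner_comm, mul_comm]

/-- `x ↦ ⟨x ⌟ α, β⟩`. -/
noncomputable def formInnerIntProd {k : ℕ} (e : Fin 6 → V) (α : V [⋀^Fin (k + 1)]→ₗ[ℝ] ℝ)
    (β : (Fin k → V) → ℝ) : V →ₗ[ℝ] ℝ where
  toFun x := formInner e (intProd x α) β
  map_add' x y := by
    have h1 : ∀ x v, intProd x α v = α.curryLeft x v := fun x v ↦ rfl
    simp only [formInner, h1, map_add, AlternatingMap.add_apply, add_mul, Finset.sum_add_distrib,
      mul_add]
  map_smul' c x := by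
    have h1 : ∀ x v, intProd x α v = α.curryLeft x v := fun x v ↦ rfl
    simp only [formInner, h1, map_smul, AlternatingMap.smul_apply, smul_eq_mul, Finset.mul_sum,
      RingHom.id_apply]
    exact Finset.sum_congr rfl fun _ _ ↦ by ring

theorem formInnerIntProd_apply {k : ℕ} (e : Fin 6 → V) (α : V [⋀^Fin (k + 1)]→ₗ[ℝ] ℝ)
    (β : (Fin k → V) → ℝ) (x : V) : formInnerIntProd e α β x = formInner e (intProd x α) β := rfl

/-- `x ↦ ⟨(x ∧ y) ⌟ α, β⟩`. -/
noncomputable def formInnerIntProdTwo {k : ℕ} (e : Fin 6 → V) (α : V [⋀^Fin (k + 2)]→ₗ[ℝ] ℝ)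
    (β : (Fin k → V) → ℝ) (y : V) : V →ₗ[ℝ] ℝ where
  toFun x := formInner e (intProd y (intProd x α)) β
  map_add' x z := by
    have h1 : ∀ x v, intProd y (intProd x α) v = (α.curryLeft x).curryLeft y v := fun x v ↦ rfl
    simp only [formInner, h1, map_add, AlternatingMap.curryLeft_add, LinearMap.add_apply,
      AlternatingMap.add_apply, add_mul, Finset.sum_add_distrib, mul_add]
  map_smul' c x := by
    have h1 : ∀ x v, intProd y (intProd x α) v = (α.curryLeft x).curryLeft y v := fun x v ↦ rfl
    simp only [formInner, h1, map_smul, AlternatingMap.curryLeft_smul, LinearMap.smul_apply,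
      AlternatingMap.smul_apply, smul_eq_mul, Finset.mul_sum, RingHom.id_apply]
    exact Finset.sum_congr rfl fun _ _ ↦ by ring

theorem OrthonormalBasis.sum_bilin_eq {ι : Type*} [Fintype ι] (e b : OrthonormalBasis ι ℝ V)
    (B : V →ₗ[ℝ] V →ₗ[ℝ] ℝ) : ∑ i, B (e i) (e i) = ∑ i, B (b i) (b i) := by
  have h : ∀ i, B (e i) (e i) = ∑ j, ⟪b j, e i⟫_ℝ * B (e i) (b j) := fun i ↦ by
    conv_lhs => arg 2; rw [← b.sum_repr' (e i)]
    simp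
  simp only [h]
  rw [Finset.sum_comm]
  refine Finset.sum_congr rfl fun j _ ↦ ?_
  have h2 : B (b j) = ∑ i, ⟪b j, e i⟫_ℝ • B (e i) := by
    conv_lhs => rw [← e.sum_repr' (b j)]
    simp [real_inner_comm]
  rw [h2]
  simp

/-- An arbitrary orthonormal basis may have either orientation, so only the square of its volume is
determined. The square is all that the double star needs. -/
theorem OrthonormalBasis.alternatingMap_mul_self_eq_one (e b : OrthonormalBasis (Fin 6) ℝ V)
    (vol : V [⋀^Fin 6]→ₗ[ℝ] ℝ) (h : vol b = 1) : vol e * vol e = 1 := by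
  have h1 : vol e = b.toBasis.det e := by
    have := AlternatingMap.eq_smul_basis_det b.toBasis vol
    rw [b.coe_toBasis, h, one_smul] at this
    rw [this]
  rw [h1]
  rcases b.det_to_matrix_orthonormalBasis_real e with h2 | h2
  · rw [h2]; norm_num
  · rw [h2]; norm_num

theorem isLinearMap_hodgeStar_five (e : Fin 6 → V) (vol : V [⋀^Fin 6]→ₗ[ℝ] ℝ)
    (β : (Fin 5 → V) → ℝ) :
    IsLinearMap ℝ fun x ↦ hodgeStar e vol (k := 5) (l := 1) rfl β ![x] := by
  have h1 : ∀ (u : Fin 5 → V) (x : V), (fun m : Fin 6 ↦ Fin.append u ![x] (Fin.cast rfl m)) =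
      Function.update (Fin.append (n := 1) u ![0]) (Fin.natAdd 5 0) x := by
    intro u x
    funext m
    refine Fin.addCases (m := 5) (n := 1) (fun i ↦ ?_) (fun i ↦ ?_) m
    · rw [Function.update_of_ne]
      · simp
      · intro h
        have := congrArg Fin.val h
        simp at this
        omega
    · obtain rfl : i = 0 := Subsingleton.elim _ _
      rw [Function.update_self]
      exact Fin.append_right (n := 1) u ![x] 0
  constructor
  · intro x y
    simp only [hodgeStar]
    simp only [h1, AlternatingMap.map_update_add, mul_add, Finset.sum_add_distrib]
  · intro c x
    simp only [hodgeStar]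
    simp only [h1, AlternatingMap.map_update_smul, smul_eq_mul, Finset.mul_sum]
    exact Finset.sum_congr rfl fun _ _ ↦ by ring

end Linearity

/-! ### Recovering ρ and ξ from ∇ω on one tangent space. -/

section PointwiseIdentities

variable {V : Type*} [NormedAddCommGroup V] [InnerProductSpace ℝ V]
  {J : V →L[ℝ] V} {Ψ : V [⋀^Fin 3]→L[ℝ] ℂ} {b : OrthonormalBasis (Fin 6) ℝ V}

/-- The family of endomorphisms `η_X + ξ_X` with `η_X = -η(J X) J`. -/
noncomputable def torsionFamily (J : V →L[ℝ] V) (η : V →ₗ[ℝ] ℝ) (ξ : V →ₗ[ℝ] V →ₗ[ℝ] V) :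
    V →ₗ[ℝ] V →ₗ[ℝ] V :=
  LinearMap.smulRight (-(η ∘ₗ (J : V →ₗ[ℝ] V))) (J : V →ₗ[ℝ] V) + ξ

theorem torsionFamily_apply (η : V →ₗ[ℝ] ℝ) (ξ : V →ₗ[ℝ] V →ₗ[ℝ] V) (X : V) :
    torsionFamily J η ξ X = (-η (J X)) • (J : V →ₗ[ℝ] V) + ξ X := rfl

/-- A one-form as an alternating map. -/
noncomputable def oneAlt (η : V →ₗ[ℝ] ℝ) : V [⋀^Fin 1]→ₗ[ℝ] ℝ :=
  AlternatingMap.ofSubsingleton ℝ V ℝ 0 η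

/-- The form `dα + 3 η ∧ α`. -/
noncomputable def extAltTwist (η : V →ₗ[ℝ] ℝ) (A : V →ₗ[ℝ] V →ₗ[ℝ] V) (α : V [⋀^Fin 3]→ₗ[ℝ] ℝ) :
    V [⋀^Fin 4]→ₗ[ℝ] ℝ :=
  extAlt α A + (3 : ℝ) • (wedgeAlt (p := 1) (q := 3) (oneAlt η) α : V [⋀^Fin 4]→ₗ[ℝ] ℝ)

theorem extAltTwist_apply (η : V →ₗ[ℝ] ℝ) (A : V →ₗ[ℝ] V →ₗ[ℝ] V) (α : V [⋀^Fin 3]→ₗ[ℝ] ℝ)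
    (v : Fin 4 → V) :
    extAltTwist η A α v = extAlt α A v + 3 * wedge (p := 1) (q := 3) (oneAlt η) α v := by
  rw [← coe_wedgeAlt]
  rfl

theorem extAltTwist_vec (η : V →ₗ[ℝ] ℝ) (A : V →ₗ[ℝ] V →ₗ[ℝ] V) (α : V [⋀^Fin 3]→ₗ[ℝ] ℝ)
    (x y z w : V) :
    extAltTwist η A α ![x, y, z, w] = derAlt α (A x) ![y, z, w] - derAlt α (A y) ![x, z, w] +
      derAlt α (A z) ![x, y, w] - derAlt α (A w) ![x, y, z] + 3 * (η x * α ![y, z, w] -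
      η y * α ![x, z, w] + η z * α ![x, y, w] - η w * α ![x, y, z]) := by
  rw [extAltTwist_apply, extAlt_three, wedge_one_three]
  rfl

variable {η : V →ₗ[ℝ] ℝ} {ξ : V →ₗ[ℝ] V →ₗ[ℝ] V}

/-- As ∇_X ω = ρ ⌟ ψ₊, the factors ½ (from r), ½ (from two-forms) and 4 (from `sum_psiReInt_mul`)
multiply to 1. Thus r(ω)(X, ·) is ρ itself, whatever N is. -/
theorem IsAdaptedBasis.half_formInner (h : IsAdaptedBasis J Ψ b) {ξ : V →ₗ[ℝ] V} {ρ : Fin 6 → ℝ}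
    (hρ : ∀ m y, ⟪b m, ξ (b y)⟫_ℝ = -(1 / 2) * ∑ p, ρ p * (xiInt p m y : ℝ)) (N : ℝ) (p : Fin 6) :
    (1 / 2) * formInner b (derAlt (omegaAlt h.toIsComplexVolume) (N • (J : V →ₗ[ℝ] V) + ξ))
      (intProd (b p) (reAlt Ψ)) = ρ p := by
  rw [formInner_two]
  have h1 : ∀ i j, intProd (b p) (reAlt Ψ) ![b i, b j] = psiReInt p i j := fun i j ↦
    (h.re_apply p i j)
  simp only [derAlt_omega_adapted h hρ, h1, ← sum_mul_psiReInt]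
  have h2 : ∀ q, ∑ i, ∑ j, (psiReInt q i j : ℝ) * psiReInt p i j = if q = p then 4 else 0 := by
    intro q
    have := congrArg (Int.cast : ℤ → ℝ) (sum_psiReInt_mul q p)
    push_cast at this
    exact this
  calc _ = (1 / 2) * ((1 / 2) * ∑ q, ρ q * ∑ i, ∑ j, (psiReInt q i j : ℝ) * psiReInt p i j) := by
        congr 2
        simp only [Finset.sum_mul, Finset.mul_sum]
        rw [Finset.sum_comm_cycle]
        simp only [mul_assoc]
    _ = _ := by simp [h2]; ring

theorem alternatingMap_three_swap₀₁ (α : V [⋀^Fin 3]→ₗ[ℝ] ℝ) (u v w : V) :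
    α ![v, u, w] = -α ![u, v, w] := by
  have h5 := α.map_swap ![u, v, w] (i := 0) (j := 1) (by decide)
  have h6 : ![u, v, w] ∘ ⇑(Equiv.swap (0 : Fin 3) 1) = ![v, u, w] := by
    funext i; fin_cases i <;> rfl
  rwa [h6] at h5

theorem alternatingMap_three_swap₁₂ (α : V [⋀^Fin 3]→ₗ[ℝ] ℝ) (u v w : V) :
    α ![u, w, v] = -α ![u, v, w] := by
  have h5 := α.map_swap ![u, v, w] (i := 1) (j := 2) (by decide)
  have h6 : ![u, v, w] ∘ ⇑(Equiv.swap (1 : Fin 3) 2) = ![u, w, v] := by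
    funext i; fin_cases i <;> rfl
  rwa [h6] at h5

theorem IsAdaptedBasis.apply_J_cons (h : IsAdaptedBasis J Ψ b) {k : ℕ}
    (α : V [⋀^Fin (k + 1)]→ₗ[ℝ] ℝ) (m : Fin 6) (v : Fin k → V) :
    α (Matrix.vecCons (J (b m)) v) = jSgn m * α (Matrix.vecCons (b (jIdx m)) v) := by
  rw [h.apply_J, AlternatingMap.map_vecCons_smul, smul_eq_mul]

/-- The components of the forms and of their derivatives in an adapted basis. -/
theorem IsAdaptedBasis.exists_components (h : IsAdaptedBasis J Ψ b) (η : V →ₗ[ℝ] ℝ)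
    (hξ : ∀ X, IsAntiHermitian J (ξ X)) : ∃ ρ : Fin 6 → Fin 6 → ℝ,
    (∀ k i j, derAlt (omegaAlt h.toIsComplexVolume) (torsionFamily J η ξ (b k)) ![b i, b j] =
      nablaOmega (ρ k) i j) ∧
    (∀ n i j k, derAlt (reAlt Ψ) (torsionFamily J η ξ (b n)) ![b i, b j, b k] =
      nablaPsiRe (ρ n) (-jVec (fun p ↦ η (b p)) n) i j k) ∧
    (∀ n i j k, derAlt (imAlt Ψ) (torsionFamily J η ξ (b n)) ![b i, b j, b k] =
      nablaPsiIm (ρ n) (-jVec (fun p ↦ η (b p)) n) i j k) ∧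
    (∀ n p, (1 / 2) * formInner b (derAlt (omegaAlt h.toIsComplexVolume)
      (torsionFamily J η ξ (b n))) (intProd (b p) (reAlt Ψ)) = ρ n p) := by
  choose ρ hρ using fun k ↦ h.exists_coeff (hξ (b k))
  have hN : ∀ k, -η (J (b k)) = -jVec (fun p ↦ η (b p)) k := by
    intro k
    rw [h.apply_J]
    fin_cases k <;> simp [jVec, jSgn, jIdx]
  refine ⟨ρ, fun k i j ↦ ?_, fun n i j k ↦ ?_, fun n i j k ↦ ?_, fun n p ↦ ?_⟩
  · rw [torsionFamily_apply, derAlt_omega_adapted h (hρ k)]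
  · rw [torsionFamily_apply, derAlt_psiRe_adapted h (hρ n), hN]
  · rw [torsionFamily_apply, derAlt_psiIm_adapted h (hρ n), hN]
  · rw [torsionFamily_apply, h.half_formInner (hρ n)]

/-- The right side is a full contraction over `e`, so it may be evaluated in the adapted basis.
There r(ω) has coefficients ρ, and the matrix entries become the expansion of ξ_X through `xiInt`.
-/
theorem IsAdaptedBasis.torsion_apply_eq (h : IsAdaptedBasis J Ψ b)
    (e : OrthonormalBasis (Fin 6) ℝ V) (η : V →ₗ[ℝ] ℝ) (hξ : ∀ X, IsAntiHermitian J (ξ X))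
    (X Y : V) :
    ξ X Y = -(1 / 2 : ℝ) • ∑ i, ∑ j, ((1 / 2) * formInner e
      (derAlt (omegaAlt h.toIsComplexVolume) (torsionFamily J η ξ X))
      (intProd (e i) (reAlt Ψ)) * (reAlt Ψ) ![e i, e j, Y]) • J (e j) := by
  obtain ⟨ρ, hρ⟩ := h.exists_coeff (hξ X)
  set α := derAlt (omegaAlt h.toIsComplexVolume) (torsionFamily J η ξ X) with hα
  -- Viewing r(ω)(X, ·) as a linear functional allows both summations over `e` to be moved to `b`,
  -- one index at a time.
  let f : V →ₗ[ℝ] ℝ := (1 / 2 : ℝ) • formInnerIntProd b (reAlt Ψ) α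
  have hf : ∀ x, (1 / 2) * formInner e α (intProd x (reAlt Ψ)) = f x := by
    intro x
    change _ = (1 / 2) * formInner b (intProd x (reAlt Ψ)) α
    rw [formInner_comm b]
    exact congrArg _ (formInner_orthonormalBasis_eq e b α.toMultilinearMap
      ((reAlt Ψ).curryLeft x).toMultilinearMap)
  have hfb : ∀ p, f (b p) = ρ p := by
    intro p
    rw [← h.half_formInner hρ (-η (J X)) p]
    change (1 / 2) * formInner b (intProd (b p) (reAlt Ψ)) α = _
    rw [formInner_comm b]
    rfl
  let φ : V → V →ₗ[ℝ] V →ₗ[ℝ] ℝ := fun y ↦ LinearMap.mk₂ ℝ (fun u v ↦ reAlt Ψ ![u, v, y])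
    (fun u u' v ↦ by simp [reAlt_apply, threeForm_add₀])
    (fun c u v ↦ by simp [reAlt_apply, threeForm_smul₀])
    (fun u v v' ↦ by simp [reAlt_apply, threeForm_add₁])
    (fun c u v ↦ by simp [reAlt_apply, threeForm_smul₁])
  have hG : ∀ (e' : OrthonormalBasis (Fin 6) ℝ V) (y : V),
      ∑ i, ∑ j, (f (e' i) * (reAlt Ψ) ![e' i, e' j, y]) • J (e' j) =
      ∑ i, f (e' i) • (∑ j, LinearMap.smulRight ((φ y).flip (b j)) (J (b j)) : V →ₗ[ℝ] V) (e' i) := by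
    intro e' y
    refine Finset.sum_congr rfl fun i _ ↦ ?_
    rw [LinearMap.sum_apply, Finset.smul_sum]
    have := e'.sum_smul_eq b (φ y (e' i)) (J : V →ₗ[ℝ] V)
    have h3 := congrArg (fun z ↦ f (e' i) • z) this
    simp only [Finset.smul_sum, smul_smul] at h3
    refine h3.trans (Finset.sum_congr rfl fun j _ ↦ ?_)
    rw [mul_smul]
    rfl
  simp only [hf]
  rw [hG, e.sum_smul_eq b, ← hG]
  simp only [hfb]
  let R : V →ₗ[ℝ] V := -(1 / 2 : ℝ) • ∑ i, ∑ j, (ρ i) •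
    LinearMap.smulRight ((reAlt Ψ).toMultilinearMap.toLinearMap ![b i, b j, 0] 2) (J (b j))
  have hup : ∀ u v y : V, Function.update ![u, v, 0] 2 y = ![u, v, y] := by
    intro u v y; funext i; fin_cases i <;> rfl
  have hR : ∀ y, R y = -(1 / 2 : ℝ) • ∑ i, ∑ j, (ρ i * (reAlt Ψ) ![b i, b j, y]) • J (b j) := by
    intro y
    simp [R, hup, mul_smul]
  rw [← hR]
  suffices ξ X = R by rw [this]
  refine b.toBasis.ext fun y ↦ InnerProductSpace.ext_inner_left_basis b.toBasis fun m ↦ ?_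
  rw [b.coe_toBasis, hρ, hR]
  simp only [inner_smul_right, inner_sum, h.inner_J, reAlt_apply, h.re_apply, xiInt]
  push_cast
  congr 1
  refine Finset.sum_congr rfl fun p _ ↦ ?_
  rw [Finset.mul_sum]
  exact Finset.sum_congr rfl fun l _ ↦ by ring

end PointwiseIdentities

/-! ### Items 2 and 3 on one tangent space. -/

section ExteriorIdentities

variable {V : Type*} [NormedAddCommGroup V] [InnerProductSpace ℝ V]
  {J : V →L[ℝ] V} {Ψ : V [⋀^Fin 3]→L[ℝ] ℂ} {b : OrthonormalBasis (Fin 6) ℝ V}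
  {ξ : V →ₗ[ℝ] V →ₗ[ℝ] V}

/-- Each scalar product is basis independent and both sides are bilinear in (X, Y), so everything
reduces to `two_mul_coeff_eq` on pairs of adapted basis vectors. -/
theorem IsAdaptedBasis.two_mul_half_formInner (h : IsAdaptedBasis J Ψ b)
    (e : OrthonormalBasis (Fin 6) ℝ V) (η : V →ₗ[ℝ] ℝ) (hξ : ∀ X, IsAntiHermitian J (ξ X))
    (X Y : V) :
    2 * ((1 / 2) * formInner e (derAlt (omegaAlt h.toIsComplexVolume) (torsionFamily J η ξ X))
        (intProd Y (reAlt Ψ))) =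
      formInner e (intProd (J X) (extAlt (omegaAlt h.toIsComplexVolume) (torsionFamily J η ξ)))
        (intProd Y (imAlt Ψ)) -
      formInner e (intProd Y (intProd X (extAltTwist η (torsionFamily J η ξ) (reAlt Ψ))))
        (omegaAlt h.toIsComplexVolume) +
      formInner e (intProd Y (intProd (J X) (extAltTwist η (torsionFamily J η ξ) (imAlt Ψ))))
        (omegaAlt h.toIsComplexVolume) := by
  set κ := omegaAlt h.toIsComplexVolume with hκ
  set A := torsionFamily J η ξ with hA
  have c0 := formInner_orthonormalBasis_eq e b (derAlt κ (A X)).toMultilinearMap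
    ((reAlt Ψ).curryLeft Y).toMultilinearMap
  have c1 := formInner_orthonormalBasis_eq e b ((extAlt κ A).curryLeft (J X)).toMultilinearMap
    ((imAlt Ψ).curryLeft Y).toMultilinearMap
  have c2 := formInner_orthonormalBasis_eq e b
    (((extAltTwist η A (reAlt Ψ)).curryLeft X).curryLeft Y).toMultilinearMap κ.toMultilinearMap
  have c3 := formInner_orthonormalBasis_eq e b
    (((extAltTwist η A (imAlt Ψ)).curryLeft (J X)).curryLeft Y).toMultilinearMap κ.toMultilinearMap
  refine Eq.trans (congrArg (fun t ↦ 2 * (1 / 2 * t)) c0) (Eq.trans ?_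
    (congrArg₂ (· + ·) (congrArg₂ (· - ·) c1.symm c2.symm) c3.symm))
  change 2 * ((1 / 2) * formInner b (derAlt κ (A X)) (intProd Y (reAlt Ψ))) =
    formInner b (intProd (J X) (extAlt κ A)) (intProd Y (imAlt Ψ)) -
      formInner b (intProd Y (intProd X (extAltTwist η A (reAlt Ψ)))) κ +
      formInner b (intProd Y (intProd (J X) (extAltTwist η A (imAlt Ψ)))) κ
  obtain ⟨ρ, hω, hre, him, hr⟩ := h.exists_components η hξ
  have hbasis : ∀ x y, 2 * ((1 / 2) * formInner b (derAlt κ (A (b x))) (intProd (b y) (reAlt Ψ))) =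
      formInner b (intProd (J (b x)) (extAlt κ A)) (intProd (b y) (imAlt Ψ)) -
      formInner b (intProd (b y) (intProd (b x) (extAltTwist η A (reAlt Ψ)))) κ +
      formInner b (intProd (b y) (intProd (J (b x)) (extAltTwist η A (imAlt Ψ)))) κ := by
    intro x y
    rw [hr, two_mul_coeff_eq ρ (fun p ↦ η (b p)) x y, formInner_two, formInner_two, formInner_two]
    have k0 : ∀ i j, κ ![b i, b j] = kahlerInt i j := fun i j ↦ h.inner_J i j
    have k1 : ∀ i j k, imAlt Ψ ![b i, b j, b k] = psiImInt i j k := h.im_apply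
    have k2 : ∀ i j k, reAlt Ψ ![b i, b j, b k] = psiReInt i j k := h.re_apply
    have t0 : ∀ i j, intProd (J (b x)) (extAlt κ A) ![b i, b j] =
        jSgn x * (nablaOmega (ρ (jIdx x)) i j - nablaOmega (ρ i) (jIdx x) j +
          nablaOmega (ρ j) (jIdx x) i) := by
      intro i j
      refine (h.apply_J_cons (extAlt κ A) x ![b i, b j]).trans ?_
      rw [extAlt_two, hω, hω, hω]
    have t1 : ∀ i j, intProd (b y) (imAlt Ψ) ![b i, b j] = psiImInt y i j := fun i j ↦ k1 y i j
    have t2 : ∀ j k, intProd (b y) (intProd (b x) (extAltTwist η A (reAlt Ψ))) ![b j, b k] =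
        nablaPsiRe (ρ x) (-jVec (fun p ↦ η (b p)) x) y j k -
        nablaPsiRe (ρ y) (-jVec (fun p ↦ η (b p)) y) x j k +
        nablaPsiRe (ρ j) (-jVec (fun p ↦ η (b p)) j) x y k -
        nablaPsiRe (ρ k) (-jVec (fun p ↦ η (b p)) k) x y j +
        3 * (η (b x) * psiReInt y j k - η (b y) * psiReInt x j k +
        η (b j) * psiReInt x y k - η (b k) * psiReInt x y j) := by
      intro j k
      refine (extAltTwist_vec η A (reAlt Ψ) (b x) (b y) (b j) (b k)).trans ?_
      simp only [hA, hre, k2]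
    have t3 : ∀ j k, intProd (b y) (intProd (J (b x)) (extAltTwist η A (imAlt Ψ))) ![b j, b k] =
        jSgn x * (nablaPsiIm (ρ (jIdx x)) (-jVec (fun p ↦ η (b p)) (jIdx x)) y j k -
        nablaPsiIm (ρ y) (-jVec (fun p ↦ η (b p)) y) (jIdx x) j k +
        nablaPsiIm (ρ j) (-jVec (fun p ↦ η (b p)) j) (jIdx x) y k -
        nablaPsiIm (ρ k) (-jVec (fun p ↦ η (b p)) k) (jIdx x) y j +
        3 * (η (b (jIdx x)) * psiImInt y j k - η (b y) * psiImInt (jIdx x) j k +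
        η (b j) * psiImInt (jIdx x) y k - η (b k) * psiImInt (jIdx x) y j)) := by
      intro j k
      refine (h.apply_J_cons (extAltTwist η A (imAlt Ψ)) x ![b y, b j, b k]).trans ?_
      rw [extAltTwist_vec]
      simp only [hA, him, k1]
    simp only [t0, t1, t2, t3, k0]
  let L₁ : V →ₗ[ℝ] V →ₗ[ℝ] ℝ := LinearMap.mk₂ ℝ
    (fun x y ↦ 2 * ((1 / 2) * formInner b (derAltFamily κ (A) x) (intProd y (reAlt Ψ))))
    (fun x x' y ↦ by
      simp only [formInner, map_add, AlternatingMap.add_apply, add_mul, Finset.sum_add_distrib]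
      ring)
    (fun c x y ↦ by
      simp only [formInner, map_smul, AlternatingMap.smul_apply, smul_eq_mul, mul_assoc,
        ← Finset.mul_sum]
      ring)
    (fun x y y' ↦ by
      have := (formInnerIntProd b (reAlt Ψ) (derAltFamily κ A x)).map_add y y'
      simp only [formInnerIntProd_apply, formInner_comm b (intProd _ (reAlt Ψ))] at this
      rw [this]; ring)
    (fun c x y ↦ by
      have := (formInnerIntProd b (reAlt Ψ) (derAltFamily κ A x)).map_smul c y
      simp only [formInnerIntProd_apply, formInner_comm b (intProd _ (reAlt Ψ))] at this
      rw [this]; simp only [smul_eq_mul]; ring)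
  have two : ∀ D : V [⋀^Fin 4]→ₗ[ℝ] ℝ, ∃ L : V →ₗ[ℝ] V →ₗ[ℝ] ℝ, ∀ x y,
      L x y = formInner b (intProd y (intProd x D)) κ := by
    intro D
    refine ⟨LinearMap.mk₂ ℝ (fun x y ↦ formInner b (intProd y (intProd x D)) κ)
      (fun x x' y ↦ (formInnerIntProdTwo b D κ y).map_add x x')
      (fun c x y ↦ (formInnerIntProdTwo b D κ y).map_smul c x)
      (fun x y y' ↦ (formInnerIntProd b (D.curryLeft x) κ).map_add y y')
      (fun c x y ↦ (formInnerIntProd b (D.curryLeft x) κ).map_smul c y), fun x y ↦ rfl⟩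
  obtain ⟨L₂, hL₂⟩ : ∃ L : V →ₗ[ℝ] V →ₗ[ℝ] ℝ, ∀ x y,
      L x y = formInner b (intProd x (extAlt κ A)) (intProd y (imAlt Ψ)) :=
    ⟨LinearMap.mk₂ ℝ (fun x y ↦ formInner b (intProd x (extAlt κ A)) (intProd y (imAlt Ψ)))
      (fun x x' y ↦ (formInnerIntProd b (extAlt κ A) (intProd y (imAlt Ψ))).map_add x x')
      (fun c x y ↦ (formInnerIntProd b (extAlt κ A) (intProd y (imAlt Ψ))).map_smul c x)
      (fun x y y' ↦ by
        have := (formInnerIntProd b (imAlt Ψ) (intProd x (extAlt κ A))).map_add y y'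
        simpa only [formInnerIntProd_apply, formInner_comm b (intProd _ (imAlt Ψ))] using this)
      (fun c x y ↦ by
        have := (formInnerIntProd b (imAlt Ψ) (intProd x (extAlt κ A))).map_smul c y
        simpa only [formInnerIntProd_apply, formInner_comm b (intProd _ (imAlt Ψ))] using this),
      fun x y ↦ rfl⟩
  obtain ⟨L₃, hL₃⟩ := two (extAltTwist η A (reAlt Ψ))
  obtain ⟨L₄, hL₄⟩ := two (extAltTwist η A (imAlt Ψ))
  have hL : L₁ = L₂ ∘ₗ (J : V →ₗ[ℝ] V) - L₃ + L₄ ∘ₗ (J : V →ₗ[ℝ] V) := by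
    refine LinearMap.ext_basis b.toBasis b.toBasis fun x y ↦ ?_
    rw [b.coe_toBasis]
    simp only [LinearMap.add_apply, LinearMap.sub_apply, LinearMap.comp_apply,
      ContinuousLinearMap.coe_coe, hL₂, hL₃, hL₄]
    exact hbasis x y
  have h2 := congrArg (fun L : V →ₗ[ℝ] V →ₗ[ℝ] ℝ ↦ L X Y) hL
  simp only [LinearMap.add_apply, LinearMap.sub_apply, LinearMap.comp_apply,
    ContinuousLinearMap.coe_coe, hL₂, hL₃, hL₄] at h2
  exact h2

/-- The coderivative of the Kähler form. -/
noncomputable def codiffAlt (κ : V [⋀^Fin 2]→ₗ[ℝ] ℝ) (A : V →ₗ[ℝ] V →ₗ[ℝ] V)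
    (e : OrthonormalBasis (Fin 6) ℝ V) : V →ₗ[ℝ] ℝ :=
  -∑ i, (derAlt κ (A (e i))).toMultilinearMap.toLinearMap ![e i, 0] 1

theorem codiffAlt_apply (κ : V [⋀^Fin 2]→ₗ[ℝ] ℝ) (A : V →ₗ[ℝ] V →ₗ[ℝ] V)
    (e : OrthonormalBasis (Fin 6) ℝ V) (v : V) :
    codiffAlt κ A e v = -∑ i, derAlt κ (A (e i)) ![e i, v] := by
  have : ∀ u, Function.update ![u, 0] 1 v = ![u, v] := by
    intro u; funext i; fin_cases i <;> rfl
  simp [codiffAlt, this]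

theorem codiffAlt_eq (κ : V [⋀^Fin 2]→ₗ[ℝ] ℝ) (A : V →ₗ[ℝ] V →ₗ[ℝ] V)
    (e b : OrthonormalBasis (Fin 6) ℝ V) : codiffAlt κ A e = codiffAlt κ A b := by
  ext v
  rw [codiffAlt_apply, codiffAlt_apply]
  let B : V →ₗ[ℝ] V →ₗ[ℝ] ℝ := LinearMap.mk₂ ℝ (fun x y ↦ derAltFamily κ A x ![y, v])
    (fun x x' y ↦ by simp)
    (fun c x y ↦ by simp)
    (fun x y y' ↦ AlternatingMap.map_vecCons_add _ _ _ _)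
    (fun c x y ↦ AlternatingMap.map_vecCons_smul _ _ _ _)
  exact congrArg _ (e.sum_bilin_eq b B)

/-- Both sides are linear in x, so the component identities suffice. The right sides are the forms
that `hodgeStar_wedge_hodgeStar` gives to the double stars. -/
theorem IsAdaptedBasis.six_mul_add_eq (h : IsAdaptedBasis J Ψ b)
    (e : OrthonormalBasis (Fin 6) ℝ V) (η : V →ₗ[ℝ] ℝ) (hξ : ∀ X, IsAntiHermitian J (ξ X)) (x : V) :
    let κ := omegaAlt h.toIsComplexVolume
    let A := torsionFamily J η ξ
    6 * η x - codiffAlt κ A e (J x) = -formInner e (intProd x (extAlt (reAlt Ψ) A)) (reAlt Ψ) ∧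
    6 * η x - codiffAlt κ A e (J x) = -formInner e (intProd x (extAlt (imAlt Ψ) A)) (imAlt Ψ) ∧
    6 * η x - codiffAlt κ A e (J x) =
      -formInner e (intProd (J x) (extAlt (reAlt Ψ) A)) (imAlt Ψ) ∧
    6 * η x - codiffAlt κ A e (J x) =
      formInner e (intProd (J x) (extAlt (imAlt Ψ) A)) (reAlt Ψ) := by
  intro κ A
  obtain ⟨ρ, hω, hre, him, -⟩ := h.exists_components η hξ
  have c : ∀ (α : V [⋀^Fin 4]→ₗ[ℝ] ℝ) (β : V [⋀^Fin 3]→ₗ[ℝ] ℝ) (x : V),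
      formInner e (intProd x α) β = formInner b (intProd x α) β := fun α β x ↦
    formInner_orthonormalBasis_eq e b (α.curryLeft x).toMultilinearMap β.toMultilinearMap
  simp only [c]
  rw [codiffAlt_eq κ A e b]
  have k1 : ∀ i j k, imAlt Ψ ![b i, b j, b k] = psiImInt i j k := h.im_apply
  have k2 : ∀ i j k, reAlt Ψ ![b i, b j, b k] = psiReInt i j k := h.re_apply
  have dre : ∀ n i j k, extAlt (reAlt Ψ) A ![b n, b i, b j, b k] =
      dPsiRe ρ (fun p ↦ η (b p)) n i j k := by
    intro n i j k
    rw [extAlt_three, dPsiRe]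
    simp only [A, hre]
  have dim : ∀ n i j k, extAlt (imAlt Ψ) A ![b n, b i, b j, b k] =
      dPsiIm ρ (fun p ↦ η (b p)) n i j k := by
    intro n i j k
    rw [extAlt_three, dPsiIm]
    simp only [A, him]
  have hcod : ∀ v, codiffAlt κ A b (b v) = codiffComp ρ v := by
    intro v
    rw [codiffAlt_apply, codiffComp]
    simp only [A, κ, hω]
  have hcodJ : ∀ v, codiffAlt κ A b (J (b v)) = jSgn v * codiffComp ρ (jIdx v) := by
    intro v
    rw [h.apply_J, map_smul, hcod, smul_eq_mul]
  have cr : ∀ (α : V [⋀^Fin 4]→ₗ[ℝ] ℝ) (u : V), formInner b (intProd u α) (reAlt Ψ) =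
      contrRe (fun i j k ↦ α ![u, b i, b j, b k]) := by
    intro α u
    rw [formInner_three]
    simp only [k2]
    have := sum_mul_psiReInt_of_alternating (fun i j k ↦ α.curryLeft u ![b i, b j, b k])
      (fun i j k ↦ alternatingMap_three_swap₀₁ _ _ _ _)
      (fun i j k ↦ alternatingMap_three_swap₁₂ _ _ _ _)
    refine (congrArg (fun t ↦ 1 / 6 * t) this).trans ?_
    rw [← mul_assoc]; norm_num
  have ci : ∀ (α : V [⋀^Fin 4]→ₗ[ℝ] ℝ) (u : V), formInner b (intProd u α) (imAlt Ψ) =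
      contrIm (fun i j k ↦ α ![u, b i, b j, b k]) := by
    intro α u
    rw [formInner_three]
    simp only [k1]
    have := sum_mul_psiImInt_of_alternating (fun i j k ↦ α.curryLeft u ![b i, b j, b k])
      (fun i j k ↦ alternatingMap_three_swap₀₁ _ _ _ _)
      (fun i j k ↦ alternatingMap_three_swap₁₂ _ _ _ _)
    refine (congrArg (fun t ↦ 1 / 6 * t) this).trans ?_
    rw [← mul_assoc]; norm_num
  have ext : ∀ L : V →ₗ[ℝ] ℝ, (∀ v, 6 * η (b v) - codiffAlt κ A b (J (b v)) = L (b v)) →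
      6 * η x - codiffAlt κ A b (J x) = L x := by
    intro L hL
    have : (6 : ℝ) • η - codiffAlt κ A b ∘ₗ (J : V →ₗ[ℝ] V) = L := by
      refine b.toBasis.ext fun v ↦ ?_
      rw [b.coe_toBasis]
      exact hL v
    exact congrArg (fun L : V →ₗ[ℝ] ℝ ↦ L x) this
  have sJ : ∀ (α : V [⋀^Fin 4]→ₗ[ℝ] ℝ) (β : (Fin 3 → V) → ℝ) v,
      formInner b (intProd (J (b v)) α) β = jSgn v * formInner b (intProd (b (jIdx v)) α) β := by
    intro α β v
    rw [h.apply_J]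
    exact (formInnerIntProd b α β).map_smul _ _
  refine ⟨?_, ?_, ?_, ?_⟩
  · refine ext (-formInnerIntProd b (extAlt (reAlt Ψ) A) (reAlt Ψ)) fun v ↦ ?_
    change _ = -formInner b (intProd (b v) (extAlt (reAlt Ψ) A)) (reAlt Ψ)
    rw [hcodJ, cr]
    simp only [dre]
    exact six_mul_add_eq_contrRe ρ (fun p ↦ η (b p)) v
  · refine ext (-formInnerIntProd b (extAlt (imAlt Ψ) A) (imAlt Ψ)) fun v ↦ ?_
    change _ = -formInner b (intProd (b v) (extAlt (imAlt Ψ) A)) (imAlt Ψ)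
    rw [hcodJ, ci]
    simp only [dim]
    exact six_mul_add_eq_contrIm ρ (fun p ↦ η (b p)) v
  · refine ext (-formInnerIntProd b (extAlt (reAlt Ψ) A) (imAlt Ψ) ∘ₗ (J : V →ₗ[ℝ] V)) fun v ↦ ?_
    change _ = -formInner b (intProd (J (b v)) (extAlt (reAlt Ψ) A)) (imAlt Ψ)
    rw [hcodJ, sJ, ci]
    simp only [dre]
    rw [six_mul_add_eq_contrIm_dPsiRe ρ (fun p ↦ η (b p)) v, neg_mul]
  · refine ext (formInnerIntProd b (extAlt (imAlt Ψ) A) (reAlt Ψ) ∘ₗ (J : V →ₗ[ℝ] V)) fun v ↦ ?_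
    change _ = formInner b (intProd (J (b v)) (extAlt (imAlt Ψ) A)) (reAlt Ψ)
    rw [hcodJ, sJ, cr]
    simp only [dim]
    exact six_mul_add_eq_contrRe_dPsiIm ρ (fun p ↦ η (b p)) v

/-- The volume form as an alternating map. -/
noncomputable def volAlt (κ : V [⋀^Fin 2]→ₗ[ℝ] ℝ) : V [⋀^Fin 6]→ₗ[ℝ] ℝ :=
  (1 / 6 : ℝ) • (wedgeAlt (wedgeAlt κ κ) κ)

theorem volAlt_apply (κ : V [⋀^Fin 2]→ₗ[ℝ] ℝ) (v : Fin 6 → V) :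
    volAlt κ v = (1 / 6) * wedge (wedge κ κ) κ v := by
  have : wedgeAlt (wedgeAlt κ κ) κ v = wedge (wedge κ κ) κ v := by
    rw [coe_wedgeAlt, coe_wedgeAlt]
  rw [← this]
  rfl

attribute [irreducible] volAlt

theorem IsAdaptedBasis.volAlt_eq_one (h : IsAdaptedBasis J Ψ b) :
    volAlt (omegaAlt h.toIsComplexVolume) b = 1 := by
  rw [volAlt_apply, wedge_wedge_eq_six _ _ fun i j ↦ h.inner_J i j]
  norm_num

theorem IsAdaptedBasis.hodgeStar_wedge_hodgeStar_eq (h : IsAdaptedBasis J Ψ b)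
    (e : OrthonormalBasis (Fin 6) ℝ V) (a : V [⋀^Fin 4]→ₗ[ℝ] ℝ) (φ : (Fin 3 → V) → ℝ)
    (v : Fin 1 → V) :
    hodgeStar e (volAlt (omegaAlt h.toIsComplexVolume)) (k := 5) (l := 1) rfl
      (wedge (hodgeStar e (volAlt (omegaAlt h.toIsComplexVolume)) (k := 4) (l := 2) rfl a) φ) v =
      -formInner e (intProd (v 0) a) φ := by
  generalize hvol : volAlt (omegaAlt h.toIsComplexVolume) = vol
  have := e.alternatingMap_mul_self_eq_one b vol (hvol ▸ h.volAlt_eq_one)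
  rw [← e.coe_toBasis] at this ⊢
  exact hodgeStar_wedge_hodgeStar e.toBasis vol this a φ v

theorem IsAdaptedBasis.codiffAlt_eq_hodgeStar (h : IsAdaptedBasis J Ψ b)
    (e : OrthonormalBasis (Fin 6) ℝ V) (η : V →ₗ[ℝ] ℝ) (hξ : ∀ X, IsAntiHermitian J (ξ X)) (x : V) :
    let κ := omegaAlt h.toIsComplexVolume
    let A := torsionFamily J η ξ
    codiffAlt κ A e x =
      -hodgeStar e (volAlt κ) (k := 5) (l := 1) rfl (wedge (extAlt κ A) κ) ![x] := by
  intro κ A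
  obtain ⟨ρ, hω, -, -, -⟩ := h.exists_components η hξ
  have c : hodgeStar e (volAlt κ) (k := 5) (l := 1) rfl (wedge (extAlt κ A) κ) =
      hodgeStar b (volAlt κ) (k := 5) (l := 1) rfl (wedge (extAlt κ A) κ) := by
    rw [← coe_wedgeAlt]
    exact hodgeStar_orthonormalBasis_eq e b (volAlt κ) (k := 5) (l := 1) rfl
      (wedgeAlt (extAlt κ A) κ).toMultilinearMap
  rw [c, codiffAlt_eq κ A e b]
  have hl := isLinearMap_hodgeStar_five b (volAlt κ) (wedge (extAlt κ A) κ)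
  have : codiffAlt κ A b = -hl.mk' _ := by
    refine b.toBasis.ext fun v ↦ ?_
    rw [b.coe_toBasis, codiffAlt_apply]
    change _ = -hodgeStar b (volAlt κ) (k := 5) (l := 1) rfl (wedge (extAlt κ A) κ) ![b v]
    generalize hvol : volAlt κ = vol
    have hv : vol b = 1 := by
      have hκ : κ = omegaAlt h.toIsComplexVolume := rfl
      rw [← hvol, hκ, h.volAlt_eq_one]
    rw [hodgeStar_wedge_kahler h vol hv (extAlt κ A) v ![b v] rfl]
    have h2 := codiffComp_eq ρ v
    rw [codiffComp] at h2
    simp only [A, κ, hω, extAlt_two]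
    exact h2
  exact congrArg (fun L : V →ₗ[ℝ] ℝ ↦ L x) this

end ExteriorIdentities

/-! ### Orthogonal complements of u(3) and su(3). -/

section OrthogonalComplements

variable {V : Type*} [NormedAddCommGroup V] [InnerProductSpace ℝ V]
  {J : V →L[ℝ] V} {Ψ : V [⋀^Fin 3]→L[ℝ] ℂ} {b : OrthonormalBasis (Fin 6) ℝ V}

/-- The commutation rules give CB = J(CB)J, and cyclicity of the trace with J² = −1 turns tr(CB)
into its negative. -/
theorem IsComplexVolume.trace_anti_comp (h : IsComplexVolume J Ψ) {C B : V →ₗ[ℝ] V}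
    (hC : ∀ v, C (J v) = -J (C v)) (hB : ∀ v, B (J v) = J (B v)) :
    LinearMap.trace ℝ V (C ∘ₗ B) = 0 := by
  have h1 : C ∘ₗ B = ((J : V →ₗ[ℝ] V) ∘ₗ (C ∘ₗ B)) ∘ₗ (J : V →ₗ[ℝ] V) := by
    ext v
    simp [hC, hB, h.sq]
  have h2 : ((J : V →ₗ[ℝ] V) ∘ₗ (J : V →ₗ[ℝ] V) ∘ₗ (C ∘ₗ B)) = -(C ∘ₗ B) := by
    ext v
    simp [h.sq]
  have h3 : LinearMap.trace ℝ V (C ∘ₗ B) = -LinearMap.trace ℝ V (C ∘ₗ B) := by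
    conv_lhs => rw [h1, ← Module.End.mul_eq_comp, LinearMap.trace_mul_comm, Module.End.mul_eq_comp,
      h2, map_neg]
  linarith

/-- For skew B, −tr(B²) is the sum of the squared lengths of the B b_i: the trace form is definite.
-/
theorem eq_zero_of_trace_comp_self {ι : Type*} [Fintype ι] (b : OrthonormalBasis ι ℝ V)
    {B : V →ₗ[ℝ] V} (hB : B ∈ soAlg V) (h : LinearMap.trace ℝ V (B ∘ₗ B) = 0) : B = 0 := by
  rw [LinearMap.trace_eq_sum_inner _ b] at h
  have h1 : ∀ i, ⟪b i, (B ∘ₗ B) (b i)⟫_ℝ = -‖B (b i)‖ ^ 2 := by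
    intro i
    have := hB (b i) (B (b i))
    rw [LinearMap.comp_apply, ← real_inner_self_eq_norm_sq, this, neg_neg]
  simp only [h1, Finset.sum_neg_distrib, neg_eq_zero] at h
  rw [Finset.sum_eq_zero_iff_of_nonneg fun i _ ↦ sq_nonneg _] at h
  refine b.toBasis.ext fun i ↦ ?_
  have := h i (Finset.mem_univ i)
  simpa using this

theorem IsComplexVolume.skew_J (h : IsComplexVolume J Ψ) (v w : V) : ⟪J v, w⟫_ℝ = -⟪v, J w⟫_ℝ := by
  rw [h.inner_right, neg_neg]

/-- Write 2ξ = B + C with B = ξ − JξJ commuting with J and C = ξ + JξJ anticommuting. Since ξ and C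
are both trace-orthogonal to B, so is B itself, and definiteness gives B = 0. -/
theorem IsComplexVolume.isAntiHermitian_of_mem (h : IsComplexVolume J Ψ)
    {ι : Type*} [Fintype ι] (b : OrthonormalBasis ι ℝ V) {ξ : V →ₗ[ℝ] V}
    (hξ : ξ ∈ soPerp (uAlg J)) : IsAntiHermitian J ξ := by
  set J' : V →ₗ[ℝ] V := (J : V →ₗ[ℝ] V) with hJ'
  let B : V →ₗ[ℝ] V := ξ - J' ∘ₗ ξ ∘ₗ J'
  let C : V →ₗ[ℝ] V := ξ + J' ∘ₗ ξ ∘ₗ J'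
  have hBs : B ∈ soAlg V := by
    intro v w
    simp only [B, LinearMap.sub_apply, LinearMap.comp_apply, inner_sub_left, inner_sub_right, hJ',
      ContinuousLinearMap.coe_coe]
    rw [hξ.1, h.skew_J, hξ.1, h.skew_J, neg_neg]
    ring
  have hBu : B ∈ uAlg J := by
    refine ⟨hBs, fun v ↦ ?_⟩
    simp [B, hJ', h.sq]
    abel
  have hC : ∀ v, C (J v) = -J (C v) := by
    intro v
    simp [C, hJ', h.sq]
  have h1 := hξ.2 B hBu
  have h2 := h.trace_anti_comp hC hBu.2
  have h3 : ξ ∘ₗ B = (1 / 2 : ℝ) • (B ∘ₗ B + C ∘ₗ B) := by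
    ext v
    simp [B, C]
    module
  rw [h3, map_smul, map_add, h2, add_zero, smul_eq_zero] at h1
  have h4 := eq_zero_of_trace_comp_self b hBs (h1.resolve_left (by norm_num))
  refine ⟨hξ.1, fun v ↦ ?_⟩
  have h5 : C = (2 : ℝ) • ξ := by
    have : C = (2 : ℝ) • ξ - B := by simp only [B, C]; module
    rw [this, h4, sub_zero]
  have h6 := hC v
  rw [h5] at h6
  simp only [LinearMap.smul_apply, map_smul] at h6
  rw [← smul_neg] at h6
  exact smul_right_injective V (two_ne_zero (α := ℝ)) h6

theorem IsAntiHermitian.mem_soPerp (h : IsComplexVolume J Ψ) {ξ : V →ₗ[ℝ] V}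
    (hξ : IsAntiHermitian J ξ) : ξ ∈ soPerp (uAlg J) :=
  ⟨hξ.skew, fun _ hB ↦ h.trace_anti_comp hξ.anti hB.2⟩

theorem soPerp_uAlg_subset (J : V → V) (Ψ : (Fin 3 → V) → ℂ) :
    soPerp (uAlg J) ⊆ soPerp (suAlg J Ψ) :=
  fun _ hA ↦ ⟨hA.1, fun B hB ↦ hA.2 B hB.1⟩

theorem soPerp_add {g : Set (V →ₗ[ℝ] V)} {A B : V →ₗ[ℝ] V} (hA : A ∈ soPerp g)
    (hB : B ∈ soPerp g) : A + B ∈ soPerp g := by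
  refine ⟨fun v w ↦ ?_, fun C hC ↦ ?_⟩
  · rw [LinearMap.add_apply, LinearMap.add_apply, inner_add_left, inner_add_right, hA.1, hB.1]
    ring
  · rw [LinearMap.add_comp, map_add, hA.2 C hC, hB.2 C hC, add_zero]

theorem soPerp_smul {g : Set (V →ₗ[ℝ] V)} {A : V →ₗ[ℝ] V} (c : ℝ) (hA : A ∈ soPerp g) :
    c • A ∈ soPerp g := by
  refine ⟨fun v w ↦ ?_, fun C hC ↦ ?_⟩
  · rw [LinearMap.smul_apply, LinearMap.smul_apply, real_inner_smul_left, real_inner_smul_right,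
      hA.1]
    ring
  · rw [LinearMap.smul_comp, map_smul, hA.2 C hC, smul_zero]

/-- Invariance of Ψ under B, evaluated at `b 0`, `b 1`, `b 2`, says that the complex trace of B
vanishes. Its imaginary part is, up to a factor, tr(JB). -/
theorem IsAdaptedBasis.J_mem_soPerp (h : IsAdaptedBasis J Ψ b) :
    (J : V →ₗ[ℝ] V) ∈ soPerp (suAlg J Ψ) := by
  refine ⟨h.skew_J, fun B hB ↦ ?_⟩
  have h1 := hB.2 (b 0) (b 1) (b 2)
  have hb : ∀ y, B (b y) = ∑ m, ⟪b m, B (b y)⟫_ℝ • b m := fun y ↦ (b.sum_repr' _).symm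
  rw [hb 0, hb 1, hb 2, threeForm_sum₀, threeForm_sum₁, threeForm_sum₂] at h1
  simp only [h.Ψ_apply] at h1
  have h2 := congrArg Complex.im h1
  simp [Fin.sum_univ_six, psiReInt, psiImInt, leviCivita₃, zIdx, zPow] at h2
  rw [LinearMap.trace_eq_sum_inner _ b, Fin.sum_univ_six]
  simp only [LinearMap.comp_apply, ContinuousLinearMap.coe_coe]
  simp only [h.inner_right, h.apply_J, real_inner_smul_left]
  have h3 : ∀ i j, ⟪b i, B (b j)⟫_ℝ = -⟪b j, B (b i)⟫_ℝ := by
    intro i j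
    rw [real_inner_comm, hB.1.1]
  simp [jSgn, jIdx]
  rw [h3 0 3, h3 1 4, h3 2 5]
  linarith

theorem derAlt_sub {k : ℕ} (α : V [⋀^Fin k]→ₗ[ℝ] ℝ) (A B : V →ₗ[ℝ] V) :
    derAlt α (A - B) = derAlt α A - derAlt α B := by
  ext v
  rw [AlternatingMap.sub_apply, derAlt_apply, derAlt_apply, derAlt_apply, ← Finset.sum_sub_distrib]
  exact Finset.sum_congr rfl fun i _ ↦ by rw [LinearMap.sub_apply, AlternatingMap.map_update_sub]

theorem IsComplexVolume.mem_suAlg (h : IsComplexVolume J Ψ) {B : V →ₗ[ℝ] V} (hB : B ∈ soAlg V)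
    (h₀ : derAlt (omegaAlt h) B = 0) (h₁ : derAlt (reAlt Ψ) B = 0) (h₂ : derAlt (imAlt Ψ) B = 0) :
    B ∈ suAlg J Ψ := by
  refine ⟨⟨hB, fun v ↦ ?_⟩, fun u v w ↦ ?_⟩
  · refine ext_inner_left ℝ fun u ↦ ?_
    have := congrArg (fun α : V [⋀^Fin 2]→ₗ[ℝ] ℝ ↦ α ![u, v]) h₀
    simp only [derAlt_two, omegaAlt_apply, Matrix.cons_val_zero, Matrix.cons_val_one,
      AlternatingMap.zero_apply] at this
    rw [hB u (J v)] at this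
    linarith
  · apply Complex.ext
    · have := congrArg (fun α : V [⋀^Fin 3]→ₗ[ℝ] ℝ ↦ α ![u, v, w]) h₁
      simpa [derAlt_three, reAlt_apply] using this
    · have := congrArg (fun α : V [⋀^Fin 3]→ₗ[ℝ] ℝ ↦ α ![u, v, w]) h₂
      simpa [derAlt_three, imAlt_apply] using this

theorem eq_zero_of_mem_of_mem_soPerp {ι : Type*} [Fintype ι] (b : OrthonormalBasis ι ℝ V)
    {g : Set (V →ₗ[ℝ] V)} {B : V →ₗ[ℝ] V} (hB : B ∈ g) (hB' : B ∈ soPerp g) : B = 0 :=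
  eq_zero_of_trace_comp_self b hB'.1 (hB'.2 B hB)

/-- An element of `su(3)^⊥` is determined by its action on `ω`, `ψ₊` and `ψ₋`. -/
theorem IsComplexVolume.eq_of_derAlt_eq (h : IsComplexVolume J Ψ) {ι : Type*} [Fintype ι]
    (b : OrthonormalBasis ι ℝ V) {A B : V →ₗ[ℝ] V}
    (hA : A ∈ soPerp (suAlg J Ψ)) (hB : B ∈ soPerp (suAlg J Ψ))
    (h₀ : derAlt (omegaAlt h) A = derAlt (omegaAlt h) B)
    (h₁ : derAlt (reAlt Ψ) A = derAlt (reAlt Ψ) B)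
    (h₂ : derAlt (imAlt Ψ) A = derAlt (imAlt Ψ) B) : A = B := by
  have hAB : A - B ∈ soPerp (suAlg J Ψ) := by
    have := soPerp_add hA (soPerp_smul (-1) hB)
    rwa [neg_one_smul, ← sub_eq_add_neg] at this
  refine sub_eq_zero.mp (eq_zero_of_mem_of_mem_soPerp b (h.mem_suAlg hAB.1 ?_ ?_ ?_) hAB)
  · rw [derAlt_sub, h₀, sub_self]
  · rw [derAlt_sub, h₁, sub_self]
  · rw [derAlt_sub, h₂, sub_self]

/-- For L = N·J + ξ, the sum LJ + JL equals −2N: the anticommuting part drops out, so N is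
determined first. -/
theorem IsComplexVolume.smul_J_add_eq (h : IsComplexVolume J Ψ) [Nontrivial V] {N N' : ℝ}
    {ξ ξ' : V →ₗ[ℝ] V} (hξ : IsAntiHermitian J ξ) (hξ' : IsAntiHermitian J ξ')
    (heq : N • (J : V →ₗ[ℝ] V) + ξ = N' • (J : V →ₗ[ℝ] V) + ξ') : N = N' ∧ ξ = ξ' := by
  have hN : N = N' := by
    obtain ⟨v, hv⟩ := exists_ne (0 : V)
    have h1 := congrArg (fun L : V →ₗ[ℝ] V ↦ L (J v)) heq
    have h2 := congrArg (fun L : V →ₗ[ℝ] V ↦ J (L v)) heq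
    simp only [LinearMap.add_apply, LinearMap.smul_apply, ContinuousLinearMap.coe_coe, h.sq,
      hξ.anti, hξ'.anti, map_add, map_smul] at h1 h2
    have h3 : (2 * (N - N')) • v = 0 := by
      have := congrArg₂ (· + ·) h1 h2
      have h4 : (N • -v + -J (ξ v) + (N • -v + J (ξ v))) - (N' • -v + -J (ξ' v) +
        (N' • -v + J (ξ' v))) = 0 := sub_eq_zero.mpr this
      rw [← neg_eq_zero, ← h4]
      module
    rcases smul_eq_zero.mp h3 with h4 | h4
    · linarith
    · exact absurd h4 hv
  refine ⟨hN, ?_⟩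
  rw [hN] at heq
  exact add_left_cancel heq

end OrthogonalComplements

/-! ### The combinatorics behind d as an antisymmetrised ∇. -/

section RemoveNth

/-- Each unordered pair of removed indices arises twice, according to which vector differentiates
the other. The two terms have opposite signs and form the difference that torsion-freeness turns
into a Lie bracket. -/
theorem sum_update_removeNth {W : Type*} [AddCommGroup W] [Module ℝ W] {k : ℕ}
    (a : W [⋀^Fin (k + 1)]→ₗ[ℝ] ℝ) (v : Fin (k + 2) → W) (n : Fin (k + 2) → Fin (k + 2) → W) :
    ∑ i : Fin (k + 2), (-1 : ℝ) ^ (i : ℕ) *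
      ∑ j, a (Function.update (i.removeNth v) j (n i (i.succAbove j))) =
    ∑ i : Fin (k + 1), ∑ j ∈ Finset.Ici i, (-1 : ℝ) ^ ((i : ℕ) + (j : ℕ)) *
      a (Fin.cons (n i.castSucc j.succ - n j.succ i.castSucc)
        (j.removeNth (i.castSucc.removeNth v))) := by
  simp only [Finset.mul_sum]
  rw [Fin.sum_sum_eq_sum_triangle_add]
  refine Fintype.sum_congr _ _ fun i ↦ Finset.sum_congr rfl fun j hj ↦ ?_
  rw [Finset.mem_Ici] at hj
  have hu : ∀ (i : Fin (k + 2)) (j : Fin (k + 1)) (y : W),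
      a (Function.update (i.removeNth v) j y) =
        (-1 : ℝ) ^ (j : ℕ) * a (Fin.cons y (j.removeNth (i.removeNth v))) := by
    intro i j y
    rw [← Fin.insertNth_removeNth, a.map_insertNth, zsmul_eq_mul]
    push_cast
    rfl
  have hs : ∀ (y z : W) (w : Fin k → W), a (Fin.cons (y - z) w) =
      a (Fin.cons y w) - a (Fin.cons z w) := by
    intro y z w
    have := a.curryLeft.map_sub y z
    exact congrArg (fun β : W [⋀^Fin k]→ₗ[ℝ] ℝ ↦ β w) this
  simp only [hu, hs]
  rw [Fin.removeNth_removeNth_eq_swap]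
  have H₁ : i.castSucc.succAbove j = j.succ := by simp [Fin.succAbove_of_le_castSucc, hj]
  have H₂ : j.predAbove i.castSucc = i := by simp [Fin.predAbove_of_le_castSucc, hj]
  have H₃ : j.succ.succAbove i = i.castSucc := by simp [Fin.succAbove_of_castSucc_lt, hj]
  simp only [H₁, H₂, H₃, Fin.val_succ, Fin.val_castSucc, pow_add, pow_one]
  ring

end RemoveNth

/-! ### Exterior and covariant derivatives under a change of connection. -/

section CovariantDerivatives

variable {M : Type*} [TopologicalSpace M] [ChartedSpace E6 M] [IsManifold (𝓡 6) ∞ M]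

theorem mlieBracket_extend (nabla : CovariantDerivative (𝓡 6) E6 (fun x : M ↦ T6 x))
    (h : nabla.torsion = 0) {x : M} (u v : T6 x) :
    VectorField.mlieBracket (𝓡 6) (extend E6 u) (extend E6 v) x =
      nabla (extend E6 v) x u - nabla (extend E6 u) x v := by
  have := nabla.torsion_eq_zero_iff.mp h (X := extend E6 u) (Y := extend E6 v) (x := x)
    (mdifferentiableAt_extend ..) (mdifferentiableAt_extend ..)
  rw [← this, extend_apply_self, extend_apply_self]

/-- The exterior derivative through a torsion-free connection. -/
theorem extDer_eq_sum_covDer (nabla : CovariantDerivative (𝓡 6) E6 (fun x : M ↦ T6 x))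
    (h : nabla.torsion = 0) {k : ℕ} (α : Π x : M, (Fin (k + 1) → T6 x) → ℝ) (x : M)
    (a : T6 x [⋀^Fin (k + 1)]→ₗ[ℝ] ℝ) (ha : α x = ⇑a) (v : Fin (k + 2) → T6 x) :
    extDer α x v = ∑ i : Fin (k + 2), (-1 : ℝ) ^ (i : ℕ) *
      covDer nabla α x (v i) (i.removeNth v) := by
  -- The directional derivatives agree on the two sides; only the connection terms have to be
  -- regrouped into brackets.
  have key := sum_update_removeNth a v fun i j ↦ nabla (extend E6 (v j)) x (v i)
  simp only [extDer, covDer, mlieBracket_extend nabla h, ha, mul_sub, Finset.sum_sub_distrib]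
  rw [← key]
  rfl

variable [RiemannianBundle (fun x : M ↦ T6 x)]

/-- The tensor acts on arguments, hence with a minus sign on forms. A form parallel for the new
connection therefore has old covariant derivative equal to the derivation action of the tensor. -/
theorem covDer_addOneForm (D : CovariantDerivative (𝓡 6) E6 (fun x : M ↦ T6 x))
    (B : Π x : M, T6 x →L[ℝ] T6 x →L[ℝ] T6 x) {k : ℕ} (α : Π x : M, (Fin k → T6 x) → ℝ) (x : M)
    (a : T6 x [⋀^Fin k]→ₗ[ℝ] ℝ) (ha : α x = ⇑a) (X : T6 x) (v : Fin k → T6 x) :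
    covDer (D.addOneForm fun x ↦ (B x).flip) α x X v =
      covDer D α x X v - derAlt a ((B x X : T6 x →L[ℝ] T6 x) : T6 x →ₗ[ℝ] T6 x) v := by
  have h1 : ∀ i, (D.addOneForm fun x ↦ (B x).flip) (extend E6 (v i)) x X =
      D (extend E6 (v i)) x X + B x X (v i) := by
    intro i
    change D (extend E6 (v i)) x X + B x X (extend E6 (v i) x) = _
    rw [extend_apply_self]
  simp only [covDer, h1, ha, AlternatingMap.map_update_add, Finset.sum_add_distrib, derAlt_apply,
    ContinuousLinearMap.coe_coe]
  ring

end CovariantDerivatives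

/-! ### Passage from the manifold to a tangent space. -/

section Pointwise

variable {M : Type*} [TopologicalSpace M] [ChartedSpace E6 M] [IsManifold (𝓡 6) ∞ M]
  [RiemannianBundle (fun x : M ↦ T6 x)] (S : SU3Structure M)

namespace SU3Structure

theorem isComplexVolume (x : M) : IsComplexVolume (S.J x) (S.Ψ x) :=
  ⟨S.J_sq x, S.J_orthogonal x, S.Ψ_complex x⟩

theorem exists_isAdaptedBasis (x : M) :
    ∃ b : OrthonormalBasis (Fin 6) ℝ (T6 x), IsAdaptedBasis (S.J x) (S.Ψ x) b := by
  refine _root_.exists_isAdaptedBasis ?_ (S.isComplexVolume x) (S.Ψ_norm x)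
  exact finrank_euclideanSpace_fin (𝕜 := ℝ) (n := 6)

theorem kahler_eq (x : M) : S.kahler x = omegaAlt (S.isComplexVolume x) := rfl

theorem ψp_eq (x : M) : S.ψp x = reAlt (S.Ψ x) := rfl

theorem ψm_eq (x : M) : S.ψm x = imAlt (S.Ψ x) := rfl

theorem vol_eq (x : M) : S.vol x = volAlt (omegaAlt (S.isComplexVolume x)) := by
  funext v
  rw [volAlt_apply]
  rfl

/-- The underlying linear family of a continuous bilinear map. -/
noncomputable def _root_.ContinuousLinearMap.toFamily {V : Type*} [NormedAddCommGroup V]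
    [NormedSpace ℝ V] (ξ : V →L[ℝ] V →L[ℝ] V) : V →ₗ[ℝ] V →ₗ[ℝ] V :=
  (ContinuousLinearMap.coeLM ℝ) ∘ₗ (ξ : V →ₗ[ℝ] V →L[ℝ] V)

variable [IsContMDiffRiemannianBundle (𝓡 6) ∞ E6 (fun x : M ↦ T6 x)]

theorem IsIntrinsicTorsion.isAntiHermitian {S : SU3Structure M}
    {nabla : CovariantDerivative (𝓡 6) E6 (fun x : M ↦ T6 x)}
    {η : Π x : M, T6 x →L[ℝ] ℝ} {ξ : Π x : M, T6 x →L[ℝ] T6 x →L[ℝ] T6 x}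
    (h : S.IsIntrinsicTorsion nabla η ξ) (x : M) (X : T6 x) :
    IsAntiHermitian (S.J x) ((ξ x).toFamily X) := by
  obtain ⟨b, hb⟩ := S.exists_isAdaptedBasis x
  exact (S.isComplexVolume x).isAntiHermitian_of_mem b (h.u_perp x X)

end SU3Structure

end Pointwise

/-! ### Items 1 to 3 and uniqueness for the intrinsic torsion. -/

section IntrinsicTorsion

variable {M : Type*} [TopologicalSpace M] [ChartedSpace E6 M] [IsManifold (𝓡 6) ∞ M]
  [RiemannianBundle (fun x : M ↦ T6 x)]
  [IsContMDiffRiemannianBundle (𝓡 6) ∞ E6 (fun x : M ↦ T6 x)] {S : SU3Structure M}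
  {nabla : CovariantDerivative (𝓡 6) E6 (fun x : M ↦ T6 x)}
  {η : Π x : M, T6 x →L[ℝ] ℝ} {ξ : Π x : M, T6 x →L[ℝ] T6 x →L[ℝ] T6 x}

namespace SU3Structure.IsIntrinsicTorsion

theorem covDer_kahler (h : S.IsIntrinsicTorsion nabla η ξ) (x : M) (X : T6 x) :
    covDer nabla S.kahler x X = ⇑(derAlt (omegaAlt (S.isComplexVolume x))
      (torsionFamily (S.J x) (η x : T6 x →ₗ[ℝ] ℝ) (ξ x).toFamily X)) := by
  funext v
  have := covDer_addOneForm nabla (fun x ↦ S.etaTensor η x + ξ x) S.kahler x _ (S.kahler_eq x) X v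
  rw [h.connection.omega] at this
  exact (sub_eq_zero.mp this.symm)

theorem covDer_ψp (h : S.IsIntrinsicTorsion nabla η ξ) (x : M) (X : T6 x) :
    covDer nabla S.ψp x X = ⇑(derAlt (reAlt (S.Ψ x))
      (torsionFamily (S.J x) (η x : T6 x →ₗ[ℝ] ℝ) (ξ x).toFamily X)) := by
  funext v
  have := covDer_addOneForm nabla (fun x ↦ S.etaTensor η x + ξ x) S.ψp x _ (S.ψp_eq x) X v
  rw [h.connection.psi_plus] at this
  exact (sub_eq_zero.mp this.symm)

theorem covDer_ψm (h : S.IsIntrinsicTorsion nabla η ξ) (x : M) (X : T6 x) :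
    covDer nabla S.ψm x X = ⇑(derAlt (imAlt (S.Ψ x))
      (torsionFamily (S.J x) (η x : T6 x →ₗ[ℝ] ℝ) (ξ x).toFamily X)) := by
  funext v
  have := covDer_addOneForm nabla (fun x ↦ S.etaTensor η x + ξ x) S.ψm x _ (S.ψm_eq x) X v
  rw [h.connection.psi_minus] at this
  exact (sub_eq_zero.mp this.symm)

theorem extDer_kahler (h : S.IsIntrinsicTorsion nabla η ξ) (ht : nabla.torsion = 0) (x : M) :
    extDer S.kahler x = ⇑(extAlt (omegaAlt (S.isComplexVolume x))
      (torsionFamily (S.J x) (η x : T6 x →ₗ[ℝ] ℝ) (ξ x).toFamily)) := by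
  funext v
  rw [extDer_eq_sum_covDer nabla ht S.kahler x _ (S.kahler_eq x) v, extAlt_apply]
  exact Finset.sum_congr rfl fun i _ ↦ by rw [h.covDer_kahler]

theorem extDer_ψp (h : S.IsIntrinsicTorsion nabla η ξ) (ht : nabla.torsion = 0) (x : M) :
    extDer S.ψp x = ⇑(extAlt (reAlt (S.Ψ x))
      (torsionFamily (S.J x) (η x : T6 x →ₗ[ℝ] ℝ) (ξ x).toFamily)) := by
  funext v
  rw [extDer_eq_sum_covDer nabla ht S.ψp x _ (S.ψp_eq x) v, extAlt_apply]
  exact Finset.sum_congr rfl fun i _ ↦ by rw [h.covDer_ψp]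

theorem extDer_ψm (h : S.IsIntrinsicTorsion nabla η ξ) (ht : nabla.torsion = 0) (x : M) :
    extDer S.ψm x = ⇑(extAlt (imAlt (S.Ψ x))
      (torsionFamily (S.J x) (η x : T6 x →ₗ[ℝ] ℝ) (ξ x).toFamily)) := by
  funext v
  rw [extDer_eq_sum_covDer nabla ht S.ψm x _ (S.ψm_eq x) v, extAlt_apply]
  exact Finset.sum_congr rfl fun i _ ↦ by rw [h.covDer_ψm]

theorem ξ_eq (h : S.IsIntrinsicTorsion nabla η ξ) (x : M) (e : OrthonormalBasis (Fin 6) ℝ (T6 x))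
    (X Y : T6 x) :
    ξ x X Y = -(1 / 2 : ℝ) •
      ∑ i, ∑ j, (S.r nabla x e X (e i) * S.ψp x ![e i, e j, Y]) • S.J x (e j) := by
  obtain ⟨b, hb⟩ := S.exists_isAdaptedBasis x
  simp only [SU3Structure.r, h.covDer_kahler x X]
  exact hb.torsion_apply_eq e (η x : T6 x →ₗ[ℝ] ℝ) (h.isAntiHermitian x) X Y

theorem two_mul_r_eq (h : S.IsIntrinsicTorsion nabla η ξ) (ht : nabla.torsion = 0) (x : M)
    (e : OrthonormalBasis (Fin 6) ℝ (T6 x)) (X Y : T6 x) :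
    2 * S.r nabla x e X Y =
      formInner e (intProd (S.J x X) (extDer S.kahler x)) (intProd Y (S.ψm x))
      - formInner e (intProd Y (intProd X (SU3Structure.dXi η S.ψp x))) (S.kahler x)
      + formInner e (intProd Y (intProd (S.J x X) (SU3Structure.dXi η S.ψm x))) (S.kahler x) := by
  obtain ⟨b, hb⟩ := S.exists_isAdaptedBasis x
  have h1 : SU3Structure.dXi η S.ψp x = ⇑(extAltTwist (η x : T6 x →ₗ[ℝ] ℝ)
      (torsionFamily (S.J x) (η x : T6 x →ₗ[ℝ] ℝ) (ξ x).toFamily) (reAlt (S.Ψ x))) := by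
    funext v
    rw [extAltTwist_apply, SU3Structure.dXi, h.extDer_ψp ht]
    rfl
  have h2 : SU3Structure.dXi η S.ψm x = ⇑(extAltTwist (η x : T6 x →ₗ[ℝ] ℝ)
      (torsionFamily (S.J x) (η x : T6 x →ₗ[ℝ] ℝ) (ξ x).toFamily) (imAlt (S.Ψ x))) := by
    funext v
    rw [extAltTwist_apply, SU3Structure.dXi, h.extDer_ψm ht]
    rfl
  rw [SU3Structure.r, h.covDer_kahler, h.extDer_kahler ht, h1, h2]
  exact hb.two_mul_half_formInner e (η x : T6 x →ₗ[ℝ] ℝ) (h.isAntiHermitian x) X Y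

theorem codiff_eq (h : S.IsIntrinsicTorsion nabla η ξ) (x : M)
    (e : OrthonormalBasis (Fin 6) ℝ (T6 x)) (v : Fin 1 → T6 x) :
    S.codiff nabla x e v = codiffAlt (omegaAlt (S.isComplexVolume x))
      (torsionFamily (S.J x) (η x : T6 x →ₗ[ℝ] ℝ) (ξ x).toFamily) e (v 0) := by
  rw [codiffAlt_apply, SU3Structure.codiff]
  simp only [h.covDer_kahler]

theorem codiff_eq_hodgeStar (h : S.IsIntrinsicTorsion nabla η ξ) (ht : nabla.torsion = 0) (x : M)
    (e : OrthonormalBasis (Fin 6) ℝ (T6 x)) (v : Fin 1 → T6 x) :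
    S.codiff nabla x e v =
      -hodgeStar e (S.vol x) (k := 5) (l := 1) rfl (wedge (extDer S.kahler x) (S.kahler x)) v := by
  obtain ⟨b, hb⟩ := S.exists_isAdaptedBasis x
  have hv : v = ![v 0] := by funext i; fin_cases i; rfl
  rw [h.codiff_eq, h.extDer_kahler ht, S.vol_eq, S.kahler_eq]
  conv_rhs => rw [hv]
  exact hb.codiffAlt_eq_hodgeStar e (η x : T6 x →ₗ[ℝ] ℝ) (h.isAntiHermitian x) (v 0)

theorem six_mul_add_eq_starStar (h : S.IsIntrinsicTorsion nabla η ξ) (ht : nabla.torsion = 0)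
    (x : M) (e : OrthonormalBasis (Fin 6) ℝ (T6 x)) (v : Fin 1 → T6 x) :
    6 * SU3Structure.oneForm η x v + formI (S.J x) (S.codiff nabla x e) v =
        S.starStar x e S.ψp S.ψp v ∧
    6 * SU3Structure.oneForm η x v + formI (S.J x) (S.codiff nabla x e) v =
        S.starStar x e S.ψm S.ψm v ∧
    6 * SU3Structure.oneForm η x v + formI (S.J x) (S.codiff nabla x e) v =
        -formI (S.J x) (S.starStar x e S.ψp S.ψm) v ∧
    6 * SU3Structure.oneForm η x v + formI (S.J x) (S.codiff nabla x e) v =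
        formI (S.J x) (S.starStar x e S.ψm S.ψp) v := by
  obtain ⟨b, hb⟩ := S.exists_isAdaptedBasis x
  have hp : ∀ φ : Π x : M, (Fin 3 → T6 x) → ℝ, ∀ v, S.starStar x e S.ψp φ v = -formInner e
      (intProd (v 0) (extAlt (reAlt (S.Ψ x))
        (torsionFamily (S.J x) (η x : T6 x →ₗ[ℝ] ℝ) (ξ x).toFamily))) (φ x) := by
    intro φ v
    rw [SU3Structure.starStar, S.vol_eq, h.extDer_ψp ht]
    exact hb.hodgeStar_wedge_hodgeStar_eq e _ _ v
  have hm : ∀ φ : Π x : M, (Fin 3 → T6 x) → ℝ, ∀ v, S.starStar x e S.ψm φ v = -formInner e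
      (intProd (v 0) (extAlt (imAlt (S.Ψ x))
        (torsionFamily (S.J x) (η x : T6 x →ₗ[ℝ] ℝ) (ξ x).toFamily))) (φ x) := by
    intro φ v
    rw [SU3Structure.starStar, S.vol_eq, h.extDer_ψm ht]
    exact hb.hodgeStar_wedge_hodgeStar_eq e _ _ v
  obtain ⟨h1, h2, h3, h4⟩ := hb.six_mul_add_eq e (η x : T6 x →ₗ[ℝ] ℝ) (h.isAntiHermitian x) (v 0)
  have hl : 6 * SU3Structure.oneForm η x v + formI (S.J x) (S.codiff nabla x e) v =
      6 * (η x : T6 x →ₗ[ℝ] ℝ) (v 0) - codiffAlt (omegaAlt (S.isComplexVolume x))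
      (torsionFamily (S.J x) (η x : T6 x →ₗ[ℝ] ℝ) (ξ x).toFamily) e (S.J x (v 0)) := by
    rw [formI, h.codiff_eq, pow_one, neg_one_mul, ← sub_eq_add_neg]
    rfl
  refine ⟨?_, ?_, ?_, ?_⟩
  · rw [hl, hp]
    exact h1
  · rw [hl, hm]
    exact h2
  · rw [hl, formI, hp, pow_one, neg_one_mul, neg_neg]
    exact h3
  · rw [hl, formI, hm, pow_one, neg_one_mul, neg_neg]
    exact h4

/-- The action of η_X + ξ_X on ω, ψ₊ and ψ₋ is prescribed by ∇, and it determines an element of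
su(3)^⊥. The two summands are then separated by their commutation with J. -/
theorem unique {η' : Π x : M, T6 x →L[ℝ] ℝ} {ξ' : Π x : M, T6 x →L[ℝ] T6 x →L[ℝ] T6 x}
    (h : S.IsIntrinsicTorsion nabla η ξ) (h' : S.IsIntrinsicTorsion nabla η' ξ') :
    η = η' ∧ ξ = ξ' := by
  have key : ∀ (x : M) (X : T6 x), -η x (S.J x X) = -η' x (S.J x X) ∧
      (ξ x).toFamily X = (ξ' x).toFamily X := by
    intro x X
    obtain ⟨b, hb⟩ := S.exists_isAdaptedBasis x
    have : Nontrivial (T6 x) := by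
      refine ⟨b 0, 0, fun h0 ↦ ?_⟩
      have := b.norm_eq_one 0
      rw [h0, norm_zero] at this
      exact zero_ne_one this
    refine (S.isComplexVolume x).smul_J_add_eq (h.isAntiHermitian x X) (h'.isAntiHermitian x X) ?_
    refine (S.isComplexVolume x).eq_of_derAlt_eq b (h.minimal x X) (h'.minimal x X) ?_ ?_ ?_
    · exact DFunLike.coe_injective ((h.covDer_kahler x X).symm.trans (h'.covDer_kahler x X))
    · exact DFunLike.coe_injective ((h.covDer_ψp x X).symm.trans (h'.covDer_ψp x X))
    · exact DFunLike.coe_injective ((h.covDer_ψm x X).symm.trans (h'.covDer_ψm x X))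
  constructor
  · funext x
    ext X
    -- The tensor sees η only through η∘J, so η itself is recovered by evaluating at JX.
    have := (key x (S.J x X)).1
    rw [S.J_sq, map_neg, map_neg, neg_neg, neg_neg] at this
    exact this
  · funext x
    ext X Y
    exact congrArg (fun L : T6 x →ₗ[ℝ] T6 x ↦ L Y) (key x X).2

end SU3Structure.IsIntrinsicTorsion

end IntrinsicTorsion

/-! ### Critical points on a manifold. -/

section LocalMinima

theorem mvfderiv_eq_zero_of_isLocalMin {M : Type*} [TopologicalSpace M] [ChartedSpace E6 M]
    {f : M → ℝ} {x : M} (hf : MDifferentiableAt (𝓡 6) 𝓘(ℝ, ℝ) f x) (hmin : IsLocalMin f x) :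
    mvfderiv (𝓡 6) f x = 0 := by
  have h1 : IsLocalMin (f ∘ (extChartAt (𝓡 6) x).symm) (extChartAt (𝓡 6) x x) := by
    refine IsLocalMin.comp_continuous ?_ (continuousAt_extChartAt_symm x)
    rwa [extChartAt_to_inv]
  have h2 : mfderiv (𝓡 6) 𝓘(ℝ, ℝ) f x = 0 := by
    have := hf.mfderiv
    have hw : writtenInExtChartAt (𝓡 6) 𝓘(ℝ, ℝ) x f = f ∘ (extChartAt (𝓡 6) x).symm := by
      rfl
    rw [hw, ModelWithCorners.range_eq_univ, fderivWithin_univ] at this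
    exact this.trans h1.fderiv_eq_zero
  ext v
  simp [mvfderiv, h2]

end LocalMinima

/-! ### Differentiability of J and Ψ along vector fields. -/

section ComplexVolumeDerivative

variable {M : Type*} [TopologicalSpace M] [ChartedSpace E6 M] [IsManifold (𝓡 6) ∞ M]

/-- Differentiability at a point of a vector field. -/
abbrev FieldMDiffAt (U : Π p : M, T6 p) (x : M) : Prop :=
  MDifferentiableAt (𝓡 6) (𝓡 6).tangent
    (fun p : M ↦ (TotalSpace.mk' E6 p (U p) : TangentBundle (𝓡 6) M)) x

/-- Smoothness around a point of a vector field. -/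
abbrev FieldSmoothAt (U : Π p : M, T6 p) (x : M) : Prop :=
  ContMDiffAt (𝓡 6) (𝓡 6).tangent ∞
    (fun p : M ↦ (TotalSpace.mk' E6 p (U p) : TangentBundle (𝓡 6) M)) x

instance (x : M) : FiniteDimensional ℝ (T6 x) := inferInstanceAs (FiniteDimensional ℝ E6)

theorem fieldSmoothAt_extend {x : M} (u : T6 x) : FieldSmoothAt (extend E6 u) x :=
  contMDiffAt_extend ..

theorem fieldMDiffAt_extend {x : M} (u : T6 x) : FieldMDiffAt (extend E6 u) x :=
  mdifferentiableAt_extend ..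

variable [RiemannianBundle (fun x : M ↦ T6 x)] (S : SU3Structure M)

namespace SU3Structure

theorem mdifferentiableAt_J {x : M} {U : Π p : M, T6 p} (hU : FieldMDiffAt U x) :
    FieldMDiffAt (fun p ↦ S.J p (U p)) x :=
  MDifferentiableAt.clm_bundle_apply ((S.J_smooth x).mdifferentiableAt (by simp)) hU

/-- Smoothness of Ψ is given only on smooth fields, while tensoriality has to be tested on merely
differentiable ones. Expanding `U` in a smooth local frame leaves differentiable coefficients times
smooth functions. -/
theorem mdifferentiableAt_Ψ {x : M} {U V W : Π p : M, T6 p} (hU : FieldMDiffAt U x)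
    (hV : FieldSmoothAt V x) (hW : FieldSmoothAt W x) :
    MDifferentiableAt (𝓡 6) 𝓘(ℝ, ℂ) (fun p ↦ S.Ψ p ![U p, V p, W p]) x := by
  let t := trivializationAt E6 (fun p : M ↦ T6 p) x
  have x_mem : x ∈ t.baseSet := FiberBundle.mem_baseSet_trivializationAt E6 _ x
  let b := Module.Basis.ofVectorSpace ℝ E6
  let s := t.localFrame b
  let c := t.localFrameCoeff (𝓡 6) b
  have hs (i) : FieldSmoothAt (s i) x := contMDiffAt_localFrame_of_mem ∞ _ b i x_mem
  have hc (i) : MDifferentiableAt (𝓡 6) 𝓘(ℝ, ℝ) (LinearMap.piApply (c i) U) x :=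
    mdifferentiableAt_localFrameCoeff b x_mem hU i
  have h1 : (fun p ↦ S.Ψ p ![U p, V p, W p]) =ᶠ[nhds x]
      ∑ i, fun p ↦ c i p (U p) • S.Ψ p ![s i p, V p, W p] := by
    have h0 : ∀ᶠ p in nhds x, U p = ∑ i, c i p (U p) • s i p :=
      t.eventually_eq_localFrame_sum_coeff_smul (I := 𝓡 6) (s := U) b x_mem
    filter_upwards [h0] with p hp'
    conv_lhs => rw [hp']
    rw [threeForm_sum₀, Finset.sum_apply]
    exact Finset.sum_congr rfl fun i _ ↦ rfl
  refine MDifferentiableAt.congr_of_eventuallyEq ?_ h1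
  refine MDifferentiableAt.sum fun i _ ↦ ?_
  refine MDifferentiableAt.smul (hc i) ?_
  have := S.Ψ_smooth ![s i, V, W] x (by
    intro j
    fin_cases j
    exacts [hs i, hV, hW])
  have h2 : (fun p ↦ S.Ψ p (fun j ↦ (![s i, V, W] : Fin 3 → Π p, T6 p) j p)) =
      fun p ↦ S.Ψ p ![s i p, V p, W p] := by
    funext p
    congr 1
    funext j
    fin_cases j <;> rfl
  rw [h2] at this
  exact this.mdifferentiableAt (by simp)

/-- The derivative `(X Ψ)(U, V, W) - Ψ(∇_X U, V, W) - Ψ(U, ∇_X V, W) - Ψ(U, V, ∇_X W)`. -/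
noncomputable def nablaΨ (nabla : CovariantDerivative (𝓡 6) E6 (fun x : M ↦ T6 x)) (x : M)
    (U V W : Π p : M, T6 p) : T6 x →L[ℝ] ℂ :=
  LinearMap.toContinuousLinearMap
  { toFun := fun X ↦ mvfderiv (𝓡 6) (fun p ↦ S.Ψ p ![U p, V p, W p]) x X -
      (S.Ψ x ![nabla U x X, V x, W x] + S.Ψ x ![U x, nabla V x X, W x] +
        S.Ψ x ![U x, V x, nabla W x X])
    map_add' := fun X Y ↦ by
      rw [map_add, map_add, map_add, map_add]
      erw [threeForm_add₀, threeForm_add₁, threeForm_add₂]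
      ring
    map_smul' := fun c X ↦ by
      rw [map_smul, map_smul, map_smul, map_smul]
      erw [threeForm_smul₀, threeForm_smul₁, threeForm_smul₂]
      simp only [Complex.real_smul, RingHom.id_apply]
      ring }

end SU3Structure

end ComplexVolumeDerivative

theorem mvfderiv_clm_comp {M : Type*} [TopologicalSpace M] [ChartedSpace E6 M] {F G : Type*}
    [NormedAddCommGroup F] [NormedSpace ℝ F] [NormedAddCommGroup G] [NormedSpace ℝ G]
    (L : F →L[ℝ] G) {f : M → F} {x : M} (hf : MDifferentiableAt (𝓡 6) 𝓘(ℝ, F) f x) (X : T6 x) :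
    mvfderiv (𝓡 6) (fun p ↦ L (f p)) x X = L (mvfderiv (𝓡 6) f x X) := by
  have h := mfderiv_comp x (L.mdifferentiableAt (x := f x)) hf
  rw [L.mfderiv_eq] at h
  exact congrArg (fun B : T6 x →L[ℝ] G ↦ B X) h

/-! ### ∇J and ∇Ψ as tensors. -/

section TensorialDerivatives

variable {M : Type*} [TopologicalSpace M] [ChartedSpace E6 M] [IsManifold (𝓡 6) ∞ M]
  [RiemannianBundle (fun x : M ↦ T6 x)] (S : SU3Structure M)
  (nabla : CovariantDerivative (𝓡 6) E6 (fun x : M ↦ T6 x))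

namespace SU3Structure

theorem nablaΨ_apply (x : M) (U V W : Π p : M, T6 p) (X : T6 x) :
    S.nablaΨ nabla x U V W X = mvfderiv (𝓡 6) (fun p ↦ S.Ψ p ![U p, V p, W p]) x X -
      (S.Ψ x ![nabla U x X, V x, W x] + S.Ψ x ![U x, nabla V x X, W x] +
        S.Ψ x ![U x, V x, nabla W x X]) := rfl

/-- The derivative of f in X(Ψ(fU, V, W)) is cancelled by the Leibniz term of ∇_X(fU). -/
theorem tensorialAt_nablaΨ {x : M} {V W : Π p : M, T6 p} (hV : FieldSmoothAt V x)
    (hW : FieldSmoothAt W x) :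
    TensorialAt (𝓡 6) E6 (fun U ↦ S.nablaΨ nabla x U V W) x where
  smul {f U} hf hU := by
    ext X
    have h1 : (fun p ↦ S.Ψ p ![(f • U) p, V p, W p]) =
        fun p ↦ f p • S.Ψ p ![U p, V p, W p] := by
      funext p
      exact threeForm_smul₀ ..
    have h2 := nabla.isCovariantDerivativeOn (s := Set.univ).leibniz hU hf
    have h3 : nabla (f • U) x X = f x • nabla U x X + mvfderiv (𝓡 6) f x X • U x := by
      rw [h2]; rfl
    have h4 : S.Ψ x ![nabla (f • U) x X, V x, W x] =
        f x • S.Ψ x ![nabla U x X, V x, W x] + mvfderiv (𝓡 6) f x X • S.Ψ x ![U x, V x, W x] := by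
      rw [h3]
      erw [threeForm_add₀, threeForm_smul₀, threeForm_smul₀]
      rfl
    have h5 : S.Ψ x ![(f • U) x, nabla V x X, W x] = f x • S.Ψ x ![U x, nabla V x X, W x] :=
      threeForm_smul₀ ..
    have h6 : S.Ψ x ![(f • U) x, V x, nabla W x X] = f x • S.Ψ x ![U x, V x, nabla W x X] :=
      threeForm_smul₀ ..
    rw [smul_apply, nablaΨ_apply, nablaΨ_apply, h1, h4, h5, h6,
      mvfderiv_fun_smul hf (S.mdifferentiableAt_Ψ hU hV hW)]
    simp only [add_apply, smul_apply,
      ContinuousLinearMap.smulRight_apply, Complex.real_smul]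
    ring
  add {U U'} hU hU' := by
    ext X
    have h1 : (fun p ↦ S.Ψ p ![(U + U') p, V p, W p]) =
        fun p ↦ S.Ψ p ![U p, V p, W p] + S.Ψ p ![U' p, V p, W p] := by
      funext p
      exact threeForm_add₀ ..
    have h2 := nabla.isCovariantDerivativeOn (s := Set.univ).add hU hU'
    have h3 : nabla (U + U') x X = nabla U x X + nabla U' x X := by
      rw [h2]; rfl
    have h4 : S.Ψ x ![nabla (U + U') x X, V x, W x] =
        S.Ψ x ![nabla U x X, V x, W x] + S.Ψ x ![nabla U' x X, V x, W x] := by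
      rw [h3]
      exact threeForm_add₀ ..
    have h5 : S.Ψ x ![(U + U') x, nabla V x X, W x] =
        S.Ψ x ![U x, nabla V x X, W x] + S.Ψ x ![U' x, nabla V x X, W x] :=
      threeForm_add₀ ..
    have h6 : S.Ψ x ![(U + U') x, V x, nabla W x X] =
        S.Ψ x ![U x, V x, nabla W x X] + S.Ψ x ![U' x, V x, nabla W x X] :=
      threeForm_add₀ ..
    rw [add_apply, nablaΨ_apply, nablaΨ_apply, nablaΨ_apply, h1, h4, h5, h6,
      mvfderiv_fun_add (S.mdifferentiableAt_Ψ hU hV hW) (S.mdifferentiableAt_Ψ hU' hV hW)]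
    simp only [add_apply]
    ring

theorem nablaΨ_swap₀₁ (x : M) (U V W : Π p : M, T6 p) (X : T6 x) :
    S.nablaΨ nabla x V U W X = -S.nablaΨ nabla x U V W X := by
  have h1 : (fun p ↦ S.Ψ p ![V p, U p, W p]) = fun p ↦ -S.Ψ p ![U p, V p, W p] := by
    funext p
    exact threeForm_swap₀₁ ..
  rw [nablaΨ_apply, nablaΨ_apply, h1, mvfderiv_fun_neg, neg_apply]
  erw [threeForm_swap₀₁ (S.Ψ x) (nabla U x X) (V x), threeForm_swap₀₁ (S.Ψ x) (U x) (V x),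
    threeForm_swap₀₁ (S.Ψ x) (U x) (nabla V x X)]
  ring

theorem nablaΨ_swap₁₂ (x : M) (U V W : Π p : M, T6 p) (X : T6 x) :
    S.nablaΨ nabla x U W V X = -S.nablaΨ nabla x U V W X := by
  have h1 : (fun p ↦ S.Ψ p ![U p, W p, V p]) = fun p ↦ -S.Ψ p ![U p, V p, W p] := by
    funext p
    exact threeForm_swap₁₂ ..
  rw [nablaΨ_apply, nablaΨ_apply, h1, mvfderiv_fun_neg, neg_apply]
  erw [threeForm_swap₁₂ (S.Ψ x) (U x) (nabla V x X) (W x),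
    threeForm_swap₁₂ (S.Ψ x) (U x) (V x) (nabla W x X),
    threeForm_swap₁₂ (S.Ψ x) (nabla U x X) (V x) (W x)]
  ring

theorem tensorialAt_nablaJ (x : M) :
    TensorialAt (𝓡 6) E6 (fun U : Π p : M, T6 p ↦
      nabla (fun p ↦ S.J p (U p)) x - (S.J x).comp (nabla U x)) x where
  smul {f U} hf hU := by
    have h1 : (fun p ↦ S.J p ((f • U) p)) = f • fun p ↦ S.J p (U p) := by
      funext p
      exact (S.J p).map_smul (f p) (U p)
    have h2 := nabla.isCovariantDerivativeOn (s := Set.univ).leibniz hU hf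
    have h3 := nabla.isCovariantDerivativeOn (s := Set.univ).leibniz (S.mdifferentiableAt_J hU) hf
    ext1 X
    rw [h1]
    change nabla (f • fun p ↦ S.J p (U p)) x X - S.J x (nabla (f • U) x X) = 
      f x • (nabla (fun p ↦ S.J p (U p)) x X - S.J x (nabla U x X))
    rw [h2, h3]
    change f x • nabla (fun p ↦ S.J p (U p)) x X + mvfderiv (𝓡 6) f x X • S.J x (U x) -
      S.J x (f x • nabla U x X + mvfderiv (𝓡 6) f x X • U x) = _
    rw [map_add, map_smul, map_smul, smul_sub]
    abel
  add {U U'} hU hU' := by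
    have h1 : (fun p ↦ S.J p ((U + U') p)) = (fun p ↦ S.J p (U p)) + fun p ↦ S.J p (U' p) := by
      funext p
      exact (S.J p).map_add (U p) (U' p)
    have h2 := nabla.isCovariantDerivativeOn (s := Set.univ).add hU hU'
    have h3 := nabla.isCovariantDerivativeOn (s := Set.univ).add (S.mdifferentiableAt_J hU)
      (S.mdifferentiableAt_J hU')
    rw [h1, h2, h3, ContinuousLinearMap.comp_add]
    abel

/-- The tensor `u ↦ (X ↦ (∇_X J) u)`. -/
noncomputable def nablaJ (x : M) : T6 x →L[ℝ] T6 x →L[ℝ] T6 x :=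
  TensorialAt.mkHom _ x (S.tensorialAt_nablaJ nabla x)

variable {S nabla} in
theorem nablaJ_apply {x : M} {U : Π p : M, T6 p} (hU : FieldMDiffAt U x) (X : T6 x) :
    S.nablaJ nabla x (U x) X = nabla (fun p ↦ S.J p (U p)) x X - S.J x (nabla U x X) := by
  rw [nablaJ, TensorialAt.mkHom_apply _ hU]
  rfl

/-- This is the derivative of J² = −1. -/
theorem nablaJ_J (x : M) (u X : T6 x) :
    S.nablaJ nabla x (S.J x u) X = -S.J x (S.nablaJ nabla x u X) := by
  have hU := fieldMDiffAt_extend u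
  have h1 := nablaJ_apply (S := S) (nabla := nabla) hU X
  have h2 := nablaJ_apply (S := S) (nabla := nabla) (S.mdifferentiableAt_J hU) X
  have h3 : (fun p ↦ S.J p (S.J p (extend E6 u p))) = (-1 : ℝ) • extend E6 u := by
    funext p
    simp [S.J_sq]
  have h4 := nabla.isCovariantDerivativeOn (s := Set.univ).smul_const (-1 : ℝ) hU
  rw [h3, h4] at h2
  rw [extend_apply_self] at h1 h2
  rw [h1, h2, map_sub, S.J_sq, smul_apply, neg_one_smul]
  abel

/-- The skewness of J is differentiated; metric compatibility turns it into skewness of ∇_X J. -/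
theorem nablaJ_skew [IsContMDiffRiemannianBundle (𝓡 6) ∞ E6 (fun x : M ↦ T6 x)]
    {nabla : CovariantDerivative (𝓡 6) E6 (fun x : M ↦ T6 x)}
    (h : nabla.IsMetricCompatible) (x : M) (u w X : T6 x) :
    ⟪S.nablaJ nabla x u X, w⟫_ℝ = -⟪u, S.nablaJ nabla x w X⟫_ℝ := by
  have hU := fieldMDiffAt_extend u
  have hW := fieldMDiffAt_extend w
  have h1 := nablaJ_apply (S := S) (nabla := nabla) hU X
  have h2 := nablaJ_apply (S := S) (nabla := nabla) hW X
  have h3 := h.mvfderiv_inner_eq (extend E6 X) (S.mdifferentiableAt_J hU) hW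
  have h4 := h.mvfderiv_inner_eq (extend E6 X) hU (S.mdifferentiableAt_J hW)
  have hs : ∀ (p : M) (a b : T6 p), ⟪a, S.J p b⟫_ℝ = -⟪S.J p a, b⟫_ℝ := by
    intro p a b
    rw [← S.J_orthogonal p (S.J p a) b, S.J_sq, inner_neg_left, neg_neg]
  have h5 : (fun p ↦ ⟪extend E6 u p, S.J p (extend E6 w p)⟫_ℝ) =
      fun p ↦ -⟪S.J p (extend E6 u p), extend E6 w p⟫_ℝ := by
    funext p
    exact hs p _ _
  rw [h5, mvfderiv_fun_neg, neg_apply, h3] at h4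
  simp only [extend_apply_self] at h1 h2 h4
  rw [h1, h2, inner_sub_left, inner_sub_right, hs]
  have h6 := hs x (nabla (extend E6 u) x X) w
  linarith

end SU3Structure

end TensorialDerivatives

/-! ### Complex coordinates, Hadamard's inequality and complex three-forms. -/

section Hadamard

open Complex in
-- The defect in Cauchy–Schwarz is a sum of squared moduli, by Lagrange's identity.
-- `normSq_cross_le` reads the same identity the other way.
theorem normSq_sum_mul_le (u₀ u₁ u₂ c₀ c₁ c₂ : ℂ) :
    normSq (u₀ * c₀ + u₁ * c₁ + u₂ * c₂) ≤
      (normSq u₀ + normSq u₁ + normSq u₂) * (normSq c₀ + normSq c₁ + normSq c₂) := by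
  have h : (normSq u₀ + normSq u₁ + normSq u₂) * (normSq c₀ + normSq c₁ + normSq c₂) -
      normSq (u₀ * c₀ + u₁ * c₁ + u₂ * c₂) =
      normSq (u₀ * starRingEnd ℂ c₁ - u₁ * starRingEnd ℂ c₀) +
      normSq (u₀ * starRingEnd ℂ c₂ - u₂ * starRingEnd ℂ c₀) +
      normSq (u₁ * starRingEnd ℂ c₂ - u₂ * starRingEnd ℂ c₁) := by
    simp only [normSq_apply, add_re, add_im, sub_re, sub_im, mul_re, mul_im, conj_re, conj_im]
    ring
  have h₁ := normSq_nonneg (u₀ * starRingEnd ℂ c₁ - u₁ * starRingEnd ℂ c₀)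
  have h₂ := normSq_nonneg (u₀ * starRingEnd ℂ c₂ - u₂ * starRingEnd ℂ c₀)
  have h₃ := normSq_nonneg (u₁ * starRingEnd ℂ c₂ - u₂ * starRingEnd ℂ c₁)
  linarith

open Complex in
theorem normSq_cross_le (v₀ v₁ v₂ w₀ w₁ w₂ : ℂ) :
    normSq (v₁ * w₂ - v₂ * w₁) + normSq (v₂ * w₀ - v₀ * w₂) + normSq (v₀ * w₁ - v₁ * w₀) ≤
      (normSq v₀ + normSq v₁ + normSq v₂) * (normSq w₀ + normSq w₁ + normSq w₂) := by
  have h : (normSq v₀ + normSq v₁ + normSq v₂) * (normSq w₀ + normSq w₁ + normSq w₂) -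
      (normSq (v₁ * w₂ - v₂ * w₁) + normSq (v₂ * w₀ - v₀ * w₂) + normSq (v₀ * w₁ - v₁ * w₀)) =
      normSq (v₀ * starRingEnd ℂ w₀ + v₁ * starRingEnd ℂ w₁ + v₂ * starRingEnd ℂ w₂) := by
    simp only [normSq_apply, add_re, add_im, sub_re, sub_im, mul_re, mul_im, conj_re, conj_im]
    ring
  have h₁ := normSq_nonneg
    (v₀ * starRingEnd ℂ w₀ + v₁ * starRingEnd ℂ w₁ + v₂ * starRingEnd ℂ w₂)
  linarith

variable {V : Type*} [NormedAddCommGroup V] [InnerProductSpace ℝ V]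
  {J : V →L[ℝ] V} {Ψ : V [⋀^Fin 3]→L[ℝ] ℂ} {b : OrthonormalBasis (Fin 6) ℝ V}

/-- The complex coordinate of `u` along `v`. -/
noncomputable def complexCoord (J : V →L[ℝ] V) (v u : V) : ℂ := ⟨⟪v, u⟫_ℝ, ⟪J v, u⟫_ℝ⟩

namespace IsAdaptedBasis

theorem sum_coord (h : IsAdaptedBasis J Ψ b) (u : V) :
    u = (⟪b 0, u⟫_ℝ • b 0 + ⟪J (b 0), u⟫_ℝ • J (b 0)) +
      (⟪b 1, u⟫_ℝ • b 1 + ⟪J (b 1), u⟫_ℝ • J (b 1)) +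
      (⟪b 2, u⟫_ℝ • b 2 + ⟪J (b 2), u⟫_ℝ • J (b 2)) := by
  have := b.sum_repr' u
  rw [Fin.sum_univ_six] at this
  have h0 : J (b 0) = b 3 := by simpa [jSgn, jIdx] using h.apply_J 0
  have h1 : J (b 1) = b 4 := by simpa [jSgn, jIdx] using h.apply_J 1
  have h2 : J (b 2) = b 5 := by simpa [jSgn, jIdx] using h.apply_J 2
  rw [h0, h1, h2]
  conv_lhs => rw [← this]
  abel

theorem inner_self_eq_sum_normSq (h : IsAdaptedBasis J Ψ b) (u : V) :
    ⟪u, u⟫_ℝ = Complex.normSq (complexCoord J (b 0) u) + Complex.normSq (complexCoord J (b 1) u) +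
      Complex.normSq (complexCoord J (b 2) u) := by
  have h1 : ⟪u, u⟫_ℝ = ⟪u, (⟪b 0, u⟫_ℝ • b 0 + ⟪J (b 0), u⟫_ℝ • J (b 0)) +
      (⟪b 1, u⟫_ℝ • b 1 + ⟪J (b 1), u⟫_ℝ • J (b 1)) +
      (⟪b 2, u⟫_ℝ • b 2 + ⟪J (b 2), u⟫_ℝ • J (b 2))⟫_ℝ := by
    conv_lhs => arg 3; rw [h.sum_coord u]
  rw [h1]
  simp only [inner_add_right, real_inner_smul_right, Complex.normSq_apply, complexCoord]
  rw [real_inner_comm (b 0) u, real_inner_comm (b 1) u, real_inner_comm (b 2) u,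
    real_inner_comm (J (b 0)) u, real_inner_comm (J (b 1)) u, real_inner_comm (J (b 2)) u]

/-- A complex linear functional in the complex coordinates of an adapted basis. -/
theorem apply_eq_sum_coord (h : IsAdaptedBasis J Ψ b) {f : V → ℂ}
    (hadd : ∀ u v, f (u + v) = f u + f v) (hsmul : ∀ (c : ℝ) u, f (c • u) = c * f u)
    (hJ : ∀ u, f (J u) = Complex.I * f u) (u : V) :
    f u = complexCoord J (b 0) u * f (b 0) + complexCoord J (b 1) u * f (b 1) +
      complexCoord J (b 2) u * f (b 2) := by
  have hz : ∀ v, complexCoord J v u = ⟪v, u⟫_ℝ + ⟪J v, u⟫_ℝ * Complex.I := fun v ↦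
    (Complex.re_add_im (complexCoord J v u)).symm
  conv_lhs => rw [h.sum_coord u]
  simp only [hadd, hsmul, hJ, hz]
  ring

/-- A complex alternating three-form is determined by its value on an adapted basis. -/
theorem apply_eq_det_mul (h : IsAdaptedBasis J Ψ b) {f : V → V → V → ℂ}
    (hadd : ∀ u v w x, f (u + v) w x = f u w x + f v w x)
    (hsmul : ∀ (c : ℝ) u v w, f (c • u) v w = c * f u v w)
    (hJ : ∀ u v w, f (J u) v w = Complex.I * f u v w)
    (hs₀₁ : ∀ u v w, f v u w = -f u v w) (hs₁₂ : ∀ u v w, f u w v = -f u v w) (u v w : V) :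
    f u v w = (complexCoord J (b 0) u *
        (complexCoord J (b 1) v * complexCoord J (b 2) w -
          complexCoord J (b 2) v * complexCoord J (b 1) w) +
      complexCoord J (b 1) u *
        (complexCoord J (b 2) v * complexCoord J (b 0) w -
          complexCoord J (b 0) v * complexCoord J (b 2) w) +
      complexCoord J (b 2) u *
        (complexCoord J (b 0) v * complexCoord J (b 1) w -
          complexCoord J (b 1) v * complexCoord J (b 0) w)) * f (b 0) (b 1) (b 2) := by
  have e₀ : ∀ u v w, f u v w = complexCoord J (b 0) u * f (b 0) v w +
      complexCoord J (b 1) u * f (b 1) v w + complexCoord J (b 2) u * f (b 2) v w := fun u v w ↦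
    h.apply_eq_sum_coord (f := fun x ↦ f x v w) (fun _ _ ↦ hadd _ _ _ _) (fun _ _ ↦ hsmul _ _ _ _)
      (fun _ ↦ hJ _ _ _) u
  have e₁ : ∀ u v w, f u v w = complexCoord J (b 0) v * f u (b 0) w +
      complexCoord J (b 1) v * f u (b 1) w + complexCoord J (b 2) v * f u (b 2) w := by
    intro u v w
    rw [hs₀₁ v u, e₀, hs₀₁ u (b 0), hs₀₁ u (b 1), hs₀₁ u (b 2)]
    ring
  have e₂ : ∀ u v w, f u v w = complexCoord J (b 0) w * f u v (b 0) +
      complexCoord J (b 1) w * f u v (b 1) + complexCoord J (b 2) w * f u v (b 2) := by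
    intro u v w
    rw [hs₁₂ u w v, e₁, hs₁₂ u (b 0) v, hs₁₂ u (b 1) v, hs₁₂ u (b 2) v]
    ring
  have d₀₁ : ∀ u w, f u u w = 0 := fun u w ↦ self_eq_neg.mp (hs₀₁ u u w)
  have d₁₂ : ∀ u w, f u w w = 0 := fun u w ↦ self_eq_neg.mp (hs₁₂ u w w)
  have d₀₂ : ∀ u w, f u w u = 0 := fun u w ↦ by rw [hs₁₂ u u w, d₀₁, neg_zero]
  have p1 : f (b 1) (b 0) (b 2) = -f (b 0) (b 1) (b 2) := hs₀₁ _ _ _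
  have p2 : f (b 0) (b 2) (b 1) = -f (b 0) (b 1) (b 2) := hs₁₂ _ _ _
  have p3 : f (b 1) (b 2) (b 0) = f (b 0) (b 1) (b 2) := by rw [hs₁₂, p1, neg_neg]
  have p4 : f (b 2) (b 0) (b 1) = f (b 0) (b 1) (b 2) := by rw [hs₀₁, p2, neg_neg]
  have p5 : f (b 2) (b 1) (b 0) = -f (b 0) (b 1) (b 2) := by rw [hs₀₁, p3]
  rw [e₀ u, e₁ (b 0) v, e₁ (b 1) v, e₁ (b 2) v, e₂ (b 0) (b 1), e₂ (b 0) (b 2), e₂ (b 1) (b 0),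
    e₂ (b 1) (b 2), e₂ (b 2) (b 0), e₂ (b 2) (b 1)]
  simp only [d₀₁, d₁₂, d₀₂, p1, p2, p3, p4, p5]
  ring

/-- Hadamard's inequality. -/
theorem normSq_Ψ_le (h : IsAdaptedBasis J Ψ b) (u v w : V) :
    Complex.normSq (Ψ ![u, v, w]) ≤ ⟪u, u⟫_ℝ * (⟪v, v⟫_ℝ * ⟪w, w⟫_ℝ) := by
  rw [h.apply_eq_det_mul (f := fun u v w ↦ Ψ ![u, v, w]) (fun _ _ _ _ ↦ threeForm_add₀ ..)
    (fun _ _ _ _ ↦ threeForm_smul₀ ..) h.complex (fun _ _ _ ↦ threeForm_swap₀₁ ..)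
    (fun _ _ _ ↦ threeForm_swap₁₂ ..), h.apply_Ψ, mul_one, h.inner_self_eq_sum_normSq u,
    h.inner_self_eq_sum_normSq v, h.inner_self_eq_sum_normSq w]
  -- Ψ(u, v, w) is a 3×3 determinant of complex coordinates: Cauchy–Schwarz separates u from the
  -- cross product of v and w, whose length is bounded next.
  refine (normSq_sum_mul_le ..).trans ?_
  refine mul_le_mul_of_nonneg_left (normSq_cross_le ..) ?_
  exact add_nonneg (add_nonneg (Complex.normSq_nonneg _) (Complex.normSq_nonneg _))
    (Complex.normSq_nonneg _)

theorem Ψ_apply_left (h : IsAdaptedBasis J Ψ b) (u : V) :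
    Ψ ![u, b 1, b 2] = complexCoord J (b 0) u ∧ Ψ ![b 0, u, b 2] = complexCoord J (b 1) u ∧
      Ψ ![b 0, b 1, u] = complexCoord J (b 2) u := by
  refine ⟨?_, ?_, ?_⟩
  · rw [h.apply_eq_sum_coord (f := fun u ↦ Ψ ![u, b 1, b 2]) (fun _ _ ↦ threeForm_add₀ ..)
      (fun _ _ ↦ threeForm_smul₀ ..) (fun _ ↦ h.complex ..) u, threeForm_self₀₁, threeForm_self₀₂,
      h.apply_Ψ]
    ring
  · rw [h.apply_eq_sum_coord (f := fun u ↦ Ψ ![b 0, u, b 2]) (fun _ _ ↦ threeForm_add₁ ..)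
      (fun _ _ ↦ threeForm_smul₁ ..) (fun _ ↦ h.complex₁ ..) u, threeForm_self₀₁, threeForm_self₁₂,
      h.apply_Ψ]
    ring
  · rw [h.apply_eq_sum_coord (f := fun u ↦ Ψ ![b 0, b 1, u]) (fun _ _ ↦ threeForm_add₂ ..)
      (fun _ _ ↦ threeForm_smul₂ ..) (fun _ ↦ h.complex₂ ..) u, threeForm_self₀₂, threeForm_self₁₂,
      h.apply_Ψ]
    ring

end IsAdaptedBasis

/-- Skewness kills ⟨u, ξu⟩; skewness and anticommutation together make ⟨Ju, ξu⟩ its own negative.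
Hence ξ does not affect the value of Ψ on an adapted triple to first order. -/
theorem IsAntiHermitian.complexCoord_apply_self (h : IsComplexVolume J Ψ) {ξ : V →ₗ[ℝ] V}
    (hξ : IsAntiHermitian J ξ) (u : V) : complexCoord J u (ξ u) = 0 := by
  have h1 := hξ.skew u u
  have h2 := hξ.skew u (J u)
  have h3 := h.skew_J u (ξ u)
  rw [hξ.anti, inner_neg_right, neg_neg] at h2
  rw [real_inner_comm] at h1 h2
  apply Complex.ext
  · simp only [complexCoord, Complex.zero_re]
    linarith
  · simp only [complexCoord, Complex.zero_im]
    rw [real_inner_comm] at h2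
    have h4 := real_inner_comm (J u) (ξ u)
    linarith

/-- A three-form which behaves like the covariant derivative of `Ψ` is given by the infinitesimal
action of an element of `ℝ J + u(3)^⊥`. -/
theorem IsAdaptedBasis.apply_eq_of_compat (h : IsAdaptedBasis J Ψ b) {f : V → V → V → ℂ}
    {ξ : V →ₗ[ℝ] V} (hξ : IsAntiHermitian J ξ)
    (hadd : ∀ u v w x, f (u + v) w x = f u w x + f v w x)
    (hsmul : ∀ (c : ℝ) u v w, f (c • u) v w = c * f u v w)
    (hJ : ∀ u v w, f (J u) v w = Complex.I * f u v w - 2 * Complex.I * Ψ ![ξ u, v, w])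
    (hs₀₁ : ∀ u v w, f v u w = -f u v w) (hs₁₂ : ∀ u v w, f u w v = -f u v w) {N : ℝ}
    (hN : f (b 0) (b 1) (b 2) = 3 * N * Complex.I) {A : V →ₗ[ℝ] V}
    (hA : ∀ u, A u = N • J u + ξ u) (u v w : V) :
    f u v w = Ψ ![A u, v, w] + Ψ ![u, A v, w] + Ψ ![u, v, A w] := by
  have hAJ : ∀ u v w, Ψ ![A (J u), v, w] = Complex.I * Ψ ![A u, v, w] -
      2 * Complex.I * Ψ ![ξ u, v, w] := by
    intro u v w
    rw [hA, hA, hξ.anti, ← neg_one_smul ℝ]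
    simp only [threeForm_add₀, threeForm_smul₀, h.complex]
    push_cast
    ring
  -- The failure of complex linearity is the same for `f` and for the action of `A`. Their
  -- difference is a complex alternating three-form, determined by its value on `b 0`, `b 1`, `b 2`.
  have key := h.apply_eq_det_mul
    (f := fun u v w ↦ f u v w - (Ψ ![A u, v, w] + Ψ ![u, A v, w] + Ψ ![u, v, A w]))
    (fun u v w x ↦ by simp only [hadd, map_add, threeForm_add₀]; ring)
    (fun c u v w ↦ by simp only [hsmul, map_smul, threeForm_smul₀]; ring)
    (fun u v w ↦ by simp only [hJ, hAJ, h.complex]; ring)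
    (fun u v w ↦ by
      simp only [hs₀₁ u v w, threeForm_swap₀₁ Ψ (A u) v, threeForm_swap₀₁ Ψ u (A v),
        threeForm_swap₀₁ Ψ u v]
      ring)
    (fun u v w ↦ by
      simp only [hs₁₂ u v w, threeForm_swap₁₂ Ψ (A u) v, threeForm_swap₁₂ Ψ u (A v),
        threeForm_swap₁₂ Ψ u v]
      ring) u v w
  have hb : f (b 0) (b 1) (b 2) - (Ψ ![A (b 0), b 1, b 2] + Ψ ![b 0, A (b 1), b 2] +
      Ψ ![b 0, b 1, A (b 2)]) = 0 := by
    rw [hA, hA, hA, threeForm_add₀, threeForm_add₁, threeForm_add₂, threeForm_smul₀,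
      threeForm_smul₁, threeForm_smul₂, h.complex, h.complex₁, h.complex₂, h.apply_Ψ, (h.Ψ_apply_left _).1,
      (h.Ψ_apply_left _).2.1, (h.Ψ_apply_left _).2.2, hN,
      hξ.complexCoord_apply_self h.toIsComplexVolume, hξ.complexCoord_apply_self h.toIsComplexVolume,
      hξ.complexCoord_apply_self h.toIsComplexVolume]
    ring
  simp only [hb, mul_zero] at key
  exact sub_eq_zero.mp key

end Hadamard

/-! ### The covariant derivative of Ψ. -/

section CovariantDerivativeOfΨ

variable {M : Type*} [TopologicalSpace M] [ChartedSpace E6 M] [IsManifold (𝓡 6) ∞ M]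
  [RiemannianBundle (fun x : M ↦ T6 x)] (S : SU3Structure M)
  (nabla : CovariantDerivative (𝓡 6) E6 (fun x : M ↦ T6 x))

namespace SU3Structure

/-- The tensor `(∇_X Ψ)(u, v, w)`. -/
noncomputable def covΨ (x : M) (u v w : T6 x) : T6 x →L[ℝ] ℂ :=
  S.nablaΨ nabla x (extend E6 u) (extend E6 v) (extend E6 w)

theorem covΨ_add (x : M) (u u' v w : T6 x) :
    S.covΨ nabla x (u + u') v w = S.covΨ nabla x u v w + S.covΨ nabla x u' v w := by
  have h := S.tensorialAt_nablaΨ nabla (fieldSmoothAt_extend v) (fieldSmoothAt_extend w)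
  rw [covΨ, covΨ, covΨ, ← h.add (fieldMDiffAt_extend u) (fieldMDiffAt_extend u')]
  refine h.pointwise (fieldMDiffAt_extend _)
    (mdifferentiableAt_add_section (fieldMDiffAt_extend u) (fieldMDiffAt_extend u')) ?_
  simp

theorem covΨ_smul (x : M) (c : ℝ) (u v w : T6 x) :
    S.covΨ nabla x (c • u) v w = c • S.covΨ nabla x u v w := by
  have h := S.tensorialAt_nablaΨ nabla (fieldSmoothAt_extend v) (fieldSmoothAt_extend w)
  have h1 := h.smul (f := fun _ ↦ c) mdifferentiableAt_const (fieldMDiffAt_extend u)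
  rw [covΨ, covΨ, ← h1]
  refine h.pointwise (fieldMDiffAt_extend _)
    (MDifferentiableAt.smul_section mdifferentiableAt_const (fieldMDiffAt_extend u)) ?_
  simp

theorem covΨ_swap₀₁ (x : M) (u v w X : T6 x) :
    S.covΨ nabla x v u w X = -S.covΨ nabla x u v w X := S.nablaΨ_swap₀₁ ..

theorem covΨ_swap₁₂ (x : M) (u v w X : T6 x) :
    S.covΨ nabla x u w v X = -S.covΨ nabla x u v w X := S.nablaΨ_swap₁₂ ..

/-- Differentiating Ψ(JU, V, W) = iΨ(U, V, W) produces the extra term in ∇J: ∇Ψ fails to be complex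
linear exactly by ∇J. -/
theorem covΨ_J (x : M) (u v w X : T6 x) :
    S.covΨ nabla x (S.J x u) v w X =
      Complex.I * S.covΨ nabla x u v w X - S.Ψ x ![S.nablaJ nabla x u X, v, w] := by
  have hU := fieldMDiffAt_extend u
  have h := S.tensorialAt_nablaΨ nabla (fieldSmoothAt_extend v) (fieldSmoothAt_extend w)
  have h1 : S.covΨ nabla x (S.J x u) v w = S.nablaΨ nabla x (fun p ↦ S.J p (extend E6 u p))
      (extend E6 v) (extend E6 w) := by
    refine h.pointwise (fieldMDiffAt_extend _) (S.mdifferentiableAt_J hU) ?_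
    simp
  have h2 := nablaJ_apply (S := S) (nabla := nabla) hU X
  have h3 : (fun p ↦ S.Ψ p ![S.J p (extend E6 u p), extend E6 v p, extend E6 w p]) =
      fun p ↦ (Complex.I • ContinuousLinearMap.id ℝ ℂ)
        (S.Ψ p ![extend E6 u p, extend E6 v p, extend E6 w p]) := by
    funext p
    exact S.Ψ_complex ..
  have h4 : nabla (fun p ↦ S.J p (extend E6 u p)) x X =
      S.nablaJ nabla x u X + S.J x (nabla (extend E6 u) x X) := by
    rw [extend_apply_self] at h2
    rw [h2]
    abel
  rw [h1, covΨ, nablaΨ_apply, nablaΨ_apply, h3, mvfderiv_clm_comp _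
    (S.mdifferentiableAt_Ψ hU (fieldSmoothAt_extend v) (fieldSmoothAt_extend w)), h4]
  simp only [extend_apply_self]
  erw [threeForm_add₀, S.Ψ_complex, S.Ψ_complex, S.Ψ_complex]
  simp only [smul_apply, ContinuousLinearMap.id_apply, smul_eq_mul]
  ring

variable [IsContMDiffRiemannianBundle (𝓡 6) ∞ E6 (fun x : M ↦ T6 x)]
  {nabla : CovariantDerivative (𝓡 6) E6 (fun x : M ↦ T6 x)}

theorem mvfderiv_inner_extend_self (h : nabla.IsMetricCompatible) {x : M} (u X : T6 x) :
    mvfderiv (𝓡 6) (fun p ↦ ⟪extend E6 u p, extend E6 u p⟫_ℝ) x X =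
      2 * ⟪u, nabla (extend E6 u) x X⟫_ℝ := by
  have h1 := h.mvfderiv_inner_eq (extend E6 X) (fieldMDiffAt_extend u) (fieldMDiffAt_extend u)
  simp only [extend_apply_self] at h1
  rw [h1, real_inner_comm]
  ring

/-- Hadamard's inequality bounds |Ψ(U, V, W)|² by the product of the squared lengths at every point,
with equality at x for fields extending an adapted triple. The difference is minimal at x, and its
vanishing derivative, by metric compatibility, is the claim. No adapted frame around x is needed. -/
theorem covΨ_re_eq_zero (h : nabla.IsMetricCompatible) {x : M}
    {b : OrthonormalBasis (Fin 6) ℝ (T6 x)} (hb : IsAdaptedBasis (S.J x) (S.Ψ x) b) (X : T6 x) :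
    (S.covΨ nabla x (b 0) (b 1) (b 2) X).re = 0 := by
  let q : Fin 6 → M → ℝ := fun i p ↦ ⟪extend E6 (b i) p, extend E6 (b i) p⟫_ℝ
  let g : M → ℂ := fun p ↦ S.Ψ p ![extend E6 (b 0) p, extend E6 (b 1) p, extend E6 (b 2) p]
  have hq : ∀ i, MDifferentiableAt (𝓡 6) 𝓘(ℝ, ℝ) (q i) x := fun i ↦
    MDifferentiableAt.inner_bundle (fieldMDiffAt_extend (b i)) (fieldMDiffAt_extend (b i))
  have hg : MDifferentiableAt (𝓡 6) 𝓘(ℝ, ℂ) g x :=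
    S.mdifferentiableAt_Ψ (fieldMDiffAt_extend _) (fieldSmoothAt_extend _) (fieldSmoothAt_extend _)
  have hre : MDifferentiableAt (𝓡 6) 𝓘(ℝ, ℝ) (fun p ↦ Complex.reCLM (g p)) x :=
    (Complex.reCLM.mdifferentiableAt).comp x hg
  have him : MDifferentiableAt (𝓡 6) 𝓘(ℝ, ℝ) (fun p ↦ Complex.imCLM (g p)) x :=
    (Complex.imCLM.mdifferentiableAt).comp x hg
  have hqx : ∀ i, q i x = 1 := by
    intro i
    simp [q]
  have hgx : g x = 1 := by
    simp only [g, extend_apply_self]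
    exact hb.apply_Ψ
  let f : M → ℝ := fun p ↦ q 0 p * (q 1 p * q 2 p) -
    (Complex.reCLM (g p) * Complex.reCLM (g p) + Complex.imCLM (g p) * Complex.imCLM (g p))
  have hf1 : MDifferentiableAt (𝓡 6) 𝓘(ℝ, ℝ) (fun p ↦ q 1 p * q 2 p) x := (hq 1).mul (hq 2)
  have hf2 : MDifferentiableAt (𝓡 6) 𝓘(ℝ, ℝ) (fun p ↦ q 0 p * (q 1 p * q 2 p)) x := (hq 0).mul hf1
  have hf3 : MDifferentiableAt (𝓡 6) 𝓘(ℝ, ℝ)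
      (fun p ↦ Complex.reCLM (g p) * Complex.reCLM (g p)) x := hre.mul hre
  have hf4 : MDifferentiableAt (𝓡 6) 𝓘(ℝ, ℝ)
      (fun p ↦ Complex.imCLM (g p) * Complex.imCLM (g p)) x := him.mul him
  have hf5 : MDifferentiableAt (𝓡 6) 𝓘(ℝ, ℝ)
      (fun p ↦ Complex.reCLM (g p) * Complex.reCLM (g p) +
        Complex.imCLM (g p) * Complex.imCLM (g p)) x := hf3.add hf4
  have hf : MDifferentiableAt (𝓡 6) 𝓘(ℝ, ℝ) f x := hf2.sub hf5
  have hmin : IsLocalMin f x := by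
    refine Filter.Eventually.of_forall fun p ↦ ?_
    have h0 : f x = 0 := by simp [f, hqx, hgx]
    rw [h0]
    obtain ⟨b', hb'⟩ := S.exists_isAdaptedBasis p
    have := hb'.normSq_Ψ_le (extend E6 (b 0) p) (extend E6 (b 1) p) (extend E6 (b 2) p)
    rw [Complex.normSq_apply] at this
    exact sub_nonneg.mpr this
  have key := congrArg (fun L : T6 x →L[ℝ] ℝ ↦ L X) (mvfderiv_eq_zero_of_isLocalMin hf hmin)
  simp only [f] at key
  rw [mvfderiv_fun_sub hf2 hf5, mvfderiv_fun_add hf3 hf4, mvfderiv_fun_mul (hq 0) hf1,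
    mvfderiv_fun_mul (hq 1) (hq 2), mvfderiv_fun_mul hre hre, mvfderiv_fun_mul him him] at key
  simp only [sub_apply, add_apply, smul_apply, zero_apply, mvfderiv_clm_comp _ hg] at key
  simp only [hqx, hgx, smul_eq_mul, Complex.reCLM_apply, Complex.imCLM_apply, Complex.one_re,
    Complex.one_im] at key
  simp only [q, mvfderiv_inner_extend_self h] at key
  have e0 : S.covΨ nabla x (b 0) (b 1) (b 2) X = mvfderiv (𝓡 6) g x X -
      (S.Ψ x ![nabla (extend E6 (b 0)) x X, b 1, b 2] +
        S.Ψ x ![b 0, nabla (extend E6 (b 1)) x X, b 2] +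
        S.Ψ x ![b 0, b 1, nabla (extend E6 (b 2)) x X]) := by
    rw [covΨ, nablaΨ_apply]
    simp only [extend_apply_self]
    rfl
  rw [e0, (hb.Ψ_apply_left _).1, (hb.Ψ_apply_left _).2.1, (hb.Ψ_apply_left _).2.2]
  simp only [Complex.sub_re, Complex.add_re, complexCoord]
  linarith

end SU3Structure

end CovariantDerivativeOfΨ

/-! ### Construction of the minimal SU(3)-connection. -/

section Existence

variable {M : Type*} [TopologicalSpace M] [ChartedSpace E6 M] [IsManifold (𝓡 6) ∞ M]
  [RiemannianBundle (fun x : M ↦ T6 x)] (S : SU3Structure M)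
  (nabla : CovariantDerivative (𝓡 6) E6 (fun x : M ↦ T6 x))

namespace SU3Structure

/-- The tensor `ξ_X Y = -½ J (∇_X J) Y`. -/
noncomputable def unitaryTorsion (x : M) : T6 x →L[ℝ] T6 x →L[ℝ] T6 x :=
  (-(1 / 2 : ℝ)) • (ContinuousLinearMap.compL ℝ (T6 x) (T6 x) (T6 x) (S.J x)).comp
    (S.nablaJ nabla x).flip

theorem unitaryTorsion_apply (x : M) (X Y : T6 x) :
    S.unitaryTorsion nabla x X Y = (-(1 / 2 : ℝ)) • S.J x (S.nablaJ nabla x Y X) := rfl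

/-- The one-form `η` with `-3 η(J X) = Im (∇_X Ψ)(b₀, b₁, b₂)`. -/
noncomputable def volumeTorsion (x : M) (b : Fin 6 → T6 x) : T6 x →L[ℝ] ℝ :=
  ((1 / 3 : ℝ) • Complex.imCLM.comp (S.covΨ nabla x (b 0) (b 1) (b 2))).comp (S.J x)

theorem neg_volumeTorsion_J (x : M) (b : Fin 6 → T6 x) (X : T6 x) :
    -S.volumeTorsion nabla x b (S.J x X) =
      (1 / 3 : ℝ) * (S.covΨ nabla x (b 0) (b 1) (b 2) X).im := by
  simp [volumeTorsion, S.J_sq]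

variable {nabla}

theorem two_smul_J_unitaryTorsion (x : M) (X v : T6 x) :
    (2 : ℝ) • S.J x (S.unitaryTorsion nabla x X v) = S.nablaJ nabla x v X := by
  rw [unitaryTorsion_apply, map_smul, S.J_sq]
  module

theorem covDer_ψ_aux (x : M) (X : T6 x) (v : Fin 3 → T6 x) (L : ℂ →L[ℝ] ℝ) :
    covDer nabla (fun p w ↦ L (S.Ψ p w)) x X v =
      L (S.covΨ nabla x (v 0) (v 1) (v 2) X) := by
  have h1 : (fun p ↦ L (S.Ψ p fun i ↦ extend E6 (v i) p)) =
      fun p ↦ L (S.Ψ p ![extend E6 (v 0) p, extend E6 (v 1) p, extend E6 (v 2) p]) := by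
    funext p
    congr 2
    funext i
    fin_cases i <;> rfl
  have h2 := mvfderiv_clm_comp L (S.mdifferentiableAt_Ψ (fieldMDiffAt_extend (v 0))
    (fieldSmoothAt_extend (v 1)) (fieldSmoothAt_extend (v 2))) X
  have h3 : ∀ (y : T6 x), Function.update v 0 y = ![y, v 1, v 2] ∧
      Function.update v 1 y = ![v 0, y, v 2] ∧ Function.update v 2 y = ![v 0, v 1, y] := by
    intro y
    refine ⟨?_, ?_, ?_⟩ <;> (funext i; fin_cases i <;> rfl)
  rw [covDer, covΨ, nablaΨ_apply, map_sub, map_add, map_add, ← h2]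
  simp only [extend_apply_self, Fin.sum_univ_three, (h3 _).1, (h3 _).2.1, (h3 _).2.2]
  rw [← h1]

variable [IsContMDiffRiemannianBundle (𝓡 6) ∞ E6 (fun x : M ↦ T6 x)]

theorem isAntiHermitian_unitaryTorsion (h : nabla.IsMetricCompatible) (x : M) (X : T6 x) :
    IsAntiHermitian (S.J x) ((S.unitaryTorsion nabla x).toFamily X) where
  skew v w := by
    change ⟪S.unitaryTorsion nabla x X v, w⟫_ℝ = -⟪v, S.unitaryTorsion nabla x X w⟫_ℝ
    rw [unitaryTorsion_apply, unitaryTorsion_apply, real_inner_smul_left, real_inner_smul_right,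
      (S.isComplexVolume x).skew_J, S.nablaJ_skew h, nablaJ_J,
      inner_neg_right]
    ring
  anti v := by
    change S.unitaryTorsion nabla x X (S.J x v) = -S.J x (S.unitaryTorsion nabla x X v)
    rw [unitaryTorsion_apply, unitaryTorsion_apply, nablaJ_J, map_neg, map_smul, smul_neg]

theorem covDer_kahler_eq (h : nabla.IsMetricCompatible) (x : M) (X : T6 x) (v : Fin 2 → T6 x) :
    covDer nabla S.kahler x X v = ⟪v 0, S.nablaJ nabla x (v 1) X⟫_ℝ := by
  have hU := fieldMDiffAt_extend (v 0)
  have hV := fieldMDiffAt_extend (v 1)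
  have h1 := nablaJ_apply (S := S) (nabla := nabla) hV X
  have h2 := h.mvfderiv_inner_eq (extend E6 X) hU (S.mdifferentiableAt_J hV)
  simp only [extend_apply_self] at h1 h2
  simp only [covDer, kahler, Fin.sum_univ_two, Function.update_self, ne_eq, zero_ne_one, one_ne_zero,
    not_false_eq_true, Function.update_of_ne]
  rw [h2, h1, inner_sub_right]
  ring

/-- The unitary part accounts for the failure of complex linearity of ∇Ψ, since ∇_X J = 2Jξ_X. What
remains is a multiple of Ψ, imaginary by `covΨ_re_eq_zero` and matched by the choice of η. -/
theorem covΨ_eq (h : nabla.IsMetricCompatible) {x : M}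
    {b : OrthonormalBasis (Fin 6) ℝ (T6 x)} (hb : IsAdaptedBasis (S.J x) (S.Ψ x) b)
    (X u v w : T6 x) {A : T6 x →ₗ[ℝ] T6 x}
    (hA : A = torsionFamily (S.J x) (S.volumeTorsion nabla x b : T6 x →ₗ[ℝ] ℝ)
      (S.unitaryTorsion nabla x).toFamily X) :
    S.covΨ nabla x u v w X =
      S.Ψ x ![A u, v, w] + S.Ψ x ![u, A v, w] + S.Ψ x ![u, v, A w] := by
  refine hb.apply_eq_of_compat (f := fun u v w ↦ S.covΨ nabla x u v w X)
    (S.isAntiHermitian_unitaryTorsion h x X) (fun u v w y ↦ ?_) (fun c u v w ↦ ?_)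
    (fun u v w ↦ ?_) (fun u v w ↦ S.covΨ_swap₀₁ ..) (fun u v w ↦ S.covΨ_swap₁₂ ..)
    (N := -S.volumeTorsion nabla x b (S.J x X)) ?_ (fun u ↦ ?_) u v w
  · simp only [covΨ_add, add_apply]
  · simp only [covΨ_smul, smul_apply, Complex.real_smul]
  · rw [covΨ_J, ← S.two_smul_J_unitaryTorsion]
    erw [threeForm_smul₀, S.Ψ_complex]
    push_cast
    rw [mul_assoc]
    rfl
  · rw [neg_volumeTorsion_J]
    apply Complex.ext
    · simp [S.covΨ_re_eq_zero h hb]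
    · simp
  · rw [hA]
    rfl

theorem exists_isIntrinsicTorsion (h : nabla.IsMetricCompatible) :
    ∃ (η : Π x : M, T6 x →L[ℝ] ℝ) (ξ : Π x : M, T6 x →L[ℝ] T6 x →L[ℝ] T6 x),
      S.IsIntrinsicTorsion nabla η ξ := by
  -- The bases are chosen point by point without continuity; this suffices, as η and ξ are required
  -- only to be families of linear maps.
  choose b hb using S.exists_isAdaptedBasis
  refine ⟨fun x ↦ S.volumeTorsion nabla x (b x), S.unitaryTorsion nabla, ?_⟩
  set η := fun x ↦ S.volumeTorsion nabla x (b x)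
  set ξ := S.unitaryTorsion nabla
  have hu : ∀ (x : M) (X : T6 x), ((ξ x X : T6 x →L[ℝ] T6 x) : T6 x →ₗ[ℝ] T6 x) ∈
      soPerp (uAlg (S.J x)) := fun x X ↦
    (S.isAntiHermitian_unitaryTorsion h x X).mem_soPerp (S.isComplexVolume x)
  have hsu : ∀ (x : M) (X : T6 x),
      ((S.etaTensor η x X + ξ x X : T6 x →L[ℝ] T6 x) : T6 x →ₗ[ℝ] T6 x) ∈
        soPerp (suAlg (S.J x) (S.Ψ x)) := fun x X ↦
    soPerp_add (soPerp_smul (-η x (S.J x X)) (hb x).J_mem_soPerp) (soPerp_uAlg_subset _ _ (hu x X))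
  have hcov : ∀ (x : M) (X : T6 x) (v : Fin 3 → T6 x) (L : ℂ →L[ℝ] ℝ)
      (a : T6 x [⋀^Fin 3]→ₗ[ℝ] ℝ), (∀ w, a w = L (S.Ψ x w)) →
      covDer nabla (fun p w ↦ L (S.Ψ p w)) x X v =
        derAlt a (((S.etaTensor η x + ξ x) X : T6 x →L[ℝ] T6 x) : T6 x →ₗ[ℝ] T6 x) v := by
    intro x X v L a ha
    have hv : v = ![v 0, v 1, v 2] := by
      funext i
      fin_cases i <;> rfl
    rw [covDer_ψ_aux, S.covΨ_eq h (hb x) X (v 0) (v 1) (v 2) rfl, hv, derAlt_three, ha, ha, ha,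
      map_add, map_add]
    rfl
  refine ⟨⟨?_, fun x X v ↦ ?_, fun x X v ↦ ?_, fun x X v ↦ ?_⟩, hsu, hu⟩
  · rw [CovariantDerivative.isMetricCompatible_iff]
    intro x X U V hX hU hV
    have h1 := h.mvfderiv_inner_eq X hU hV
    have h2 := (hsu x (X x)).1 (U x) (V x)
    have h3 : ∀ W : Π p : M, T6 p,
        (nabla.addOneForm fun x ↦ (S.etaTensor η x + ξ x).flip) W x (X x) =
          nabla W x (X x) + (S.etaTensor η x (X x) + ξ x (X x)) (W x) := fun W ↦ rfl
    simp only [h3, inner_add_left, inner_add_right]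
    rw [h1]
    simp only [ContinuousLinearMap.coe_coe] at h2
    linarith
  · rw [covDer_addOneForm nabla (fun x ↦ S.etaTensor η x + ξ x) S.kahler x _ (S.kahler_eq x) X v,
      S.covDer_kahler_eq h]
    have hv : v = ![v 0, v 1] := by
      funext i
      fin_cases i <;> rfl
    have h2 := (hsu x X).1 (v 0) (S.J x (v 1))
    have h3 := (S.isAntiHermitian_unitaryTorsion h x X).anti (v 1)
    have h4 := S.two_smul_J_unitaryTorsion (nabla := nabla) x X (v 1)
    set A : T6 x →ₗ[ℝ] T6 x :=
      (((S.etaTensor η x + ξ x) X : T6 x →L[ℝ] T6 x) : T6 x →ₗ[ℝ] T6 x) with hA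
    have h5 : ∀ u, A u = -η x (S.J x X) • S.J x u + ξ x X u := fun u ↦ rfl
    -- A skew endomorphism acts on ω through its commutator with J. The multiple of J contributes
    -- nothing, and ξ contributes 2Jξ_X = ∇_X J, which explains the factor −½ in `unitaryTorsion`.
    have h6 : S.J x (A (v 1)) - A (S.J x (v 1)) = S.nablaJ nabla x (v 1) X := by
      have h7 : ξ x X (S.J x (v 1)) = -S.J x (ξ x X (v 1)) := h3
      rw [← h4, h5, h5, h7, map_add, map_smul]
      module
    rw [hv, derAlt_two, omegaAlt_apply, omegaAlt_apply]
    have h8 : ⟪A (v 0), S.J x (v 1)⟫_ℝ = -⟪v 0, A (S.J x (v 1))⟫_ℝ := h2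
    simp only [Matrix.cons_val_zero, Matrix.cons_val_one]
    rw [← h6, inner_sub_right]
    linarith
  · rw [covDer_addOneForm nabla (fun x ↦ S.etaTensor η x + ξ x) S.ψp x _ (S.ψp_eq x) X v]
    exact sub_eq_zero.mpr (hcov x X v Complex.reCLM _ fun _ ↦ rfl)
  · rw [covDer_addOneForm nabla (fun x ↦ S.etaTensor η x + ξ x) S.ψm x _ (S.ψm_eq x) X v]
    exact sub_eq_zero.mpr (hcov x X v Complex.imCLM _ fun _ ↦ rfl)

end SU3Structure

end Existence

/-! ### Assembly of existence, uniqueness and the formulas. -/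

theorem theorem2p5 {M : Type*} [TopologicalSpace M] [ChartedSpace E6 M] [IsManifold (𝓡 6) ∞ M]
    [RiemannianBundle (fun x : M ↦ T6 x)]
    [IsContMDiffRiemannianBundle (𝓡 6) ∞ E6 (fun x : M ↦ T6 x)]
    (S : SU3Structure M)
    (nabla : CovariantDerivative (𝓡 6) E6 (fun x : M ↦ T6 x))
    (h_metric : nabla.IsMetricCompatible) (h_torsion : nabla.torsion = 0) :
    (∃! T : (Π x : M, T6 x →L[ℝ] ℝ) × (Π x : M, T6 x →L[ℝ] T6 x →L[ℝ] T6 x),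
      S.IsIntrinsicTorsion nabla T.1 T.2) ∧
    ∀ (η : Π x : M, T6 x →L[ℝ] ℝ) (ξ : Π x : M, T6 x →L[ℝ] T6 x →L[ℝ] T6 x),
      S.IsIntrinsicTorsion nabla η ξ →
      ∀ (x : M) (e : OrthonormalBasis (Fin 6) ℝ (T6 x)),
        (∀ X Y : T6 x, ξ x X Y = -(1 / 2 : ℝ) •
          ∑ i, ∑ j, (S.r nabla x e X (e i) * S.ψp x ![e i, e j, Y]) • S.J x (e j)) ∧
        (∀ X Y : T6 x, 2 * S.r nabla x e X Y =
          formInner e (intProd (S.J x X) (extDer S.kahler x)) (intProd Y (S.ψm x))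
          - formInner e (intProd Y (intProd X (SU3Structure.dXi η S.ψp x))) (S.kahler x)
          + formInner e (intProd Y (intProd (S.J x X) (SU3Structure.dXi η S.ψm x))) (S.kahler x)) ∧
        (∀ v : Fin 1 → T6 x,
          6 * SU3Structure.oneForm η x v + formI (S.J x) (S.codiff nabla x e) v =
              S.starStar x e S.ψp S.ψp v ∧
          6 * SU3Structure.oneForm η x v + formI (S.J x) (S.codiff nabla x e) v =
              S.starStar x e S.ψm S.ψm v ∧
          6 * SU3Structure.oneForm η x v + formI (S.J x) (S.codiff nabla x e) v =
              -formI (S.J x) (S.starStar x e S.ψp S.ψm) v ∧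
          6 * SU3Structure.oneForm η x v + formI (S.J x) (S.codiff nabla x e) v =
              formI (S.J x) (S.starStar x e S.ψm S.ψp) v) ∧
        (∀ v : Fin 1 → T6 x, S.codiff nabla x e v =
          -hodgeStar e (S.vol x) (k := 5) (l := 1) rfl (wedge (extDer S.kahler x) (S.kahler x)) v) :=
  ⟨by
    obtain ⟨η, ξ, h⟩ := S.exists_isIntrinsicTorsion h_metric
    refine ⟨(η, ξ), h, fun T hT ↦ ?_⟩
    exact Prod.ext (hT.unique h).1 (hT.unique h).2,
  fun _ _ h x e ↦ ⟨h.ξ_eq x e, h.two_mul_r_eq h_torsion x e, h.six_mul_add_eq_starStar h_torsion x e,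
    h.codiff_eq_hodgeStar h_torsion x e⟩⟩
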